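/- Let $(M,g)$ be a Yang Pure Space, i.e. a connected smooth 4-manifold with a smooth Lorentz metric $g$ of signature $(-+++)$ whose Ricci tensor satisfies $\nabla_aR_{bc}-\nabla_bR_{ac}=0$. Suppose that the Ricci tensor has Segré type $\{(1,1)(11)\}$ at every point, i.e. there is a pseudo-orthonormal basis $t_0,t_1,t_2,t_3$ of eigenvectors of $R^a{}_b$ ($t_0$ timelike) such that $t_0,t_1$ have the same eigenvalue $\rho_1$ and $t_2,t_3$ have the same eigenvalue $\rho_2\neq\rho_1$. Then there are real constants $\lambda$ and $\Phi_{11}\neq 0$ such that: 1. the Ricci scalar is $R=4\lambda$ everywhere, and in every such basis of eigenvectors the Newman–Penrose component $\tfrac14R_{ab}(k^an^b+m^a\bar m^b)$ of the Ricci tensor, with $k=(t_0+t_1)/\sqrt2$, $n=(t_0-t_1)/\sqrt2$, $m=(t_2+it_3)/\sqrt2$, equals $\Phi_{11}$; 2. every point of $M$ has a neighbourhood with coordinates $(u,r,\mathrm{Re}\,\zeta,\mathrm{Im}\,\zeta)$, with $1+(\Phi_{11}+\tfrac{\lambda}{2})\zeta\bar\zeta>0$, in which $$ds^2=-2\,du\,dr-2\Big(\Phi_{11}-\frac{\lambda}{2}\Big)r^2du^2+2\Big(1+\Big(\Phi_{11}+\frac{\lambda}{2}\Big)\zeta\bar\zeta\Big)^{-2}d\zeta\,d\bar\zeta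 ;$$ 3. on this neighbourhood the metric is generated by a non-null electromagnetic field if and only if $\Phi_{11}>0$. Here this means that there is a smooth 2-form $F$ with $dF=0$ and $\nabla^aF_{ab}=0$, whose invariants $F_{ab}F^{ab}$ and $F_{ab}{}^*F^{ab}$ nowhere vanish simultaneously, such that $R_{ab}-\tfrac12Rg_{ab}+\lambda g_{ab}=8\pi T_{ab}$ with $T_{ab}=F_{ac}F_b{}^c-\tfrac14g_{ab}F_{cd}F^{cd}$. -/

import Mathlib

open scoped Manifold ContDiff

noncomputable section

/-- The coordinate space `ℝ⁴`. -/
abbrev R4 : Type := EuclideanSpace ℝ (Fin 4)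

/-! ### Tensor calculus in coordinates

`G x` is the matrix of metric components `g_{ab}` at the coordinate point `x`. -/

/-- The partial derivative `∂_i f` at `x`. -/
def pd (i : Fin 4) (f : R4 → ℝ) (x : R4) : ℝ :=
  fderiv ℝ f x (EuclideanSpace.single i 1)

/-- The Christoffel symbol `Γ^k_{ij}` of the Levi-Civita connection. -/
def christoffel (G : R4 → Matrix (Fin 4) (Fin 4) ℝ) (k i j : Fin 4) (x : R4) : ℝ :=
  (1 / 2) * ∑ l, (G x)⁻¹ k l *
    (pd i (fun y => G y j l) x + pd j (fun y => G y i l) x - pd l (fun y => G y i j) x)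

/-- The Riemann tensor `R^a_{bcd}`
`= ∂_c Γ^a_{db} - ∂_d Γ^a_{cb} + Γ^a_{ce} Γ^e_{db} - Γ^a_{de} Γ^e_{cb}`. -/
def riemann (G : R4 → Matrix (Fin 4) (Fin 4) ℝ) (a b c d : Fin 4) (x : R4) : ℝ :=
  pd c (christoffel G a d b) x - pd d (christoffel G a c b) x
    + ∑ e, (christoffel G a c e x * christoffel G e d b x
      - christoffel G a d e x * christoffel G e c b x)

/-- The Ricci tensor `R_{bd} = R^a_{bad}`. -/
def ricci (G : R4 → Matrix (Fin 4) (Fin 4) ℝ) (x : R4) : Matrix (Fin 4) (Fin 4) ℝ :=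
  Matrix.of fun b d => ∑ a, riemann G a b a d x

/-- The Ricci scalar `R = g^{ab} R_{ab}`. -/
def scalarCurv (G : R4 → Matrix (Fin 4) (Fin 4) ℝ) (x : R4) : ℝ :=
  ∑ a, ∑ b, (G x)⁻¹ a b * ricci G x a b

/-- The covariant derivative `∇_c S_{ab}` of a covariant 2-tensor field `S`. -/
def covDeriv (G S : R4 → Matrix (Fin 4) (Fin 4) ℝ) (c a b : Fin 4) (x : R4) : ℝ :=
  pd c (fun y => S y a b) x
    - ∑ e, (christoffel G e c a x * S x e b + christoffel G e c b x * S x a e)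

/-- Evaluation `S_{ab} v^a w^b` of a covariant 2-tensor on two vectors. -/
def evalTensor (S : Matrix (Fin 4) (Fin 4) ℝ) (v w : Fin 4 → ℝ) : ℝ :=
  ∑ a, ∑ b, S a b * v a * w b

/-- The Minkowski matrix `diag(-1, 1, 1, 1)`. -/
def minkowski : Matrix (Fin 4) (Fin 4) ℝ := Matrix.diagonal ![-1, 1, 1, 1]

/-- `t 0, t 1, t 2, t 3` (given by their coordinate components) is a pseudo-orthonormal tetrad at
`x`, with `t 0` timelike, consisting of eigenvectors `R^a_b v^b = ρ v^a` of the Ricci tensor; the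
eigenvalue is `ρ₁` on `t 0, t 1` and `ρ₂` on `t 2, t 3`. The eigenvector equation is written with
the index lowered, `R_{ab} v^b = ρ g_{ab} v^b`. -/
structure IsRicciTetrad (G : R4 → Matrix (Fin 4) (Fin 4) ℝ) (x : R4)
    (t : Fin 4 → Fin 4 → ℝ) (ρ₁ ρ₂ : ℝ) : Prop where
  orthonormal : ∀ i j, evalTensor (G x) (t i) (t j) = minkowski i j
  eigen_zero : (ricci G x).mulVec (t 0) = ρ₁ • (G x).mulVec (t 0)
  eigen_one : (ricci G x).mulVec (t 1) = ρ₁ • (G x).mulVec (t 1)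
  eigen_two : (ricci G x).mulVec (t 2) = ρ₂ • (G x).mulVec (t 2)
  eigen_three : (ricci G x).mulVec (t 3) = ρ₂ • (G x).mulVec (t 3)

/-- The Newman-Penrose component `Φ₁₁ = (1/4) R_{ab} (k^a n^b + m^a m̄^b)` of the Ricci tensor in
the null tetrad `k = (t₀ + t₁)/√2`, `n = (t₀ - t₁)/√2`, `m = (t₂ + i t₃)/√2`. Since `R_{ab}` is
symmetric, `R_{ab} m^a m̄^b = (R(t₂, t₂) + R(t₃, t₃))/2`. -/
def npPhi11 (G : R4 → Matrix (Fin 4) (Fin 4) ℝ) (x : R4) (t : Fin 4 → Fin 4 → ℝ) : ℝ :=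
  (1 / 4) * (evalTensor (ricci G x) ((√2)⁻¹ • (t 0 + t 1)) ((√2)⁻¹ • (t 0 - t 1))
    + (evalTensor (ricci G x) (t 2) (t 2) + evalTensor (ricci G x) (t 3) (t 3)) / 2)

/-! ### Lorentz metrics on 4-manifolds -/

/-- The coordinate vector field `∂_i` of a chart `e`, at the point with coordinates `x`. -/
def coordVec {M : Type*} [TopologicalSpace M] [ChartedSpace R4 M]
    (e : OpenPartialHomeomorph M R4) (i : Fin 4) (x : R4) : TangentSpace (𝓡 4) (e.symm x) :=
  mfderiv (𝓡 4) (𝓡 4) e.symm x (EuclideanSpace.single i 1 : R4)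

/-- A smooth Lorentz metric (signature `-+++`) on a 4-manifold `M`. -/
structure LorentzMetric (M : Type*) [TopologicalSpace M] [ChartedSpace R4 M] where
  /-- the bilinear form on each tangent space -/
  form : ∀ p : M, LinearMap.BilinForm ℝ (TangentSpace (𝓡 4) p)
  symm : ∀ p v w, form p v w = form p w v
  /-- every tangent space has a pseudo-orthonormal basis -/
  lorentz : ∀ p, ∃ t : Module.Basis (Fin 4) ℝ (TangentSpace (𝓡 4) p),
    ∀ i j, form p (t i) (t j) = minkowski i j
  /-- the components in every smooth chart are smooth -/
  smooth : ∀ e ∈ IsManifold.maximalAtlas (𝓡 4) ∞ M, ∀ i j,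
    ContDiffOn ℝ ∞ (fun x => form (e.symm x) (coordVec e i x) (coordVec e j x)) e.target

variable {M : Type*} [TopologicalSpace M] [ChartedSpace R4 M]

/-- The components `g_{ij} = g(∂_i, ∂_j)` of the metric in the chart `e`. -/
def LorentzMetric.comp (g : LorentzMetric M) (e : OpenPartialHomeomorph M R4) (x : R4) :
    Matrix (Fin 4) (Fin 4) ℝ :=
  Matrix.of fun i j => g.form (e.symm x) (coordVec e i x) (coordVec e j x)

/-- Yang pure space: `∇_a R_{bc} - ∇_b R_{ac} = 0` everywhere. -/
def IsYangPureSpace (g : LorentzMetric M) : Prop :=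
  ∀ e ∈ IsManifold.maximalAtlas (𝓡 4) ∞ M, ∀ x ∈ e.target, ∀ a b c,
    covDeriv (g.comp e) (ricci (g.comp e)) a b c x
      - covDeriv (g.comp e) (ricci (g.comp e)) b a c x = 0

/-- The Ricci tensor has Segré type `{(1,1)(11)}` at every point: there is a pseudo-orthonormal
tetrad of eigenvectors, the timelike one and a spacelike one sharing an eigenvalue, the other two
spacelike ones sharing a different eigenvalue. -/
def HasSegreType_11_11 (g : LorentzMetric M) : Prop :=
  ∀ e ∈ IsManifold.maximalAtlas (𝓡 4) ∞ M, ∀ x ∈ e.target,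
    ∃ (t : Fin 4 → Fin 4 → ℝ) (ρ₁ ρ₂ : ℝ), ρ₁ ≠ ρ₂ ∧ IsRicciTetrad (g.comp e) x t ρ₁ ρ₂

/-- The components, in coordinates `x = (u, r, Re ζ, Im ζ)`, of the line element
`-2 du dr - 2 (Φ - Λ/2) r² du² + 2 (1 + (Φ + Λ/2) ζ ζ̄)⁻² dζ dζ̄`. -/
def decomposableMetric (Φ Λ : ℝ) (x : R4) : Matrix (Fin 4) (Fin 4) ℝ :=
  let h : ℝ := 2 * ((1 + (Φ + Λ / 2) * (x 2 ^ 2 + x 3 ^ 2)) ^ 2)⁻¹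
  !![-2 * (Φ - Λ / 2) * x 1 ^ 2, -1, 0, 0;
     -1, 0, 0, 0;
     0, 0, h, 0;
     0, 0, 0, h]

/-! ### Electromagnetic fields -/

/-- The invariant `F_{cd} F^{cd}`. -/
def fieldInvariant (G F : R4 → Matrix (Fin 4) (Fin 4) ℝ) (x : R4) : ℝ :=
  ∑ a, ∑ b, ∑ c, ∑ d, (G x)⁻¹ a c * (G x)⁻¹ b d * F x a b * F x c d

/-- The invariant `F_{ab} *F^{ab} = (1/2) ε^{abcd} F_{ab} F_{cd}`, up to the sign that depends on
the orientation. -/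
def dualInvariant (G F : R4 → Matrix (Fin 4) (Fin 4) ℝ) (x : R4) : ℝ :=
  (1 / 2) * (√|(G x).det|)⁻¹ * ∑ σ : Equiv.Perm (Fin 4),
    ((Equiv.Perm.sign σ : ℤ) : ℝ) * F x (σ 0) (σ 1) * F x (σ 2) (σ 3)

/-- The energy-momentum tensor `T_{ab} = F_{ac} F_b^c - (1/4) g_{ab} F_{cd} F^{cd}`. -/
def emStress (G F : R4 → Matrix (Fin 4) (Fin 4) ℝ) (x : R4) : Matrix (Fin 4) (Fin 4) ℝ :=
  Matrix.of fun a b => (∑ c, ∑ d, (G x)⁻¹ c d * F x a c * F x b d)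
    - (1 / 4) * G x a b * fieldInvariant G F x

/-- `F` is (given by its components in the coordinate domain `U`) a smooth non-null source-free
electromagnetic field on `U` that generates the metric `G` through Einstein's equations with
cosmological constant `Λ`. -/
structure IsNonNullEMSource (G : R4 → Matrix (Fin 4) (Fin 4) ℝ) (U : Set R4) (Λ : ℝ)
    (F : R4 → Matrix (Fin 4) (Fin 4) ℝ) : Prop where
  smooth : ∀ a b, ContDiffOn ℝ ∞ (fun x => F x a b) U
  antisymm : ∀ x ∈ U, ∀ a b, F x a b = -F x b a
  /-- `∂_a F_{bc} + ∂_b F_{ca} + ∂_c F_{ab} = 0` -/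
  closed : ∀ x ∈ U, ∀ a b c, pd a (fun y => F y b c) x + pd b (fun y => F y c a) x
    + pd c (fun y => F y a b) x = 0
  /-- `∇^a F_{ab} = 0` -/
  coclosed : ∀ x ∈ U, ∀ b, ∑ a, ∑ c, (G x)⁻¹ a c * covDeriv G F c a b x = 0
  nonNull : ∀ x ∈ U, ¬ (fieldInvariant G F x = 0 ∧ dualInvariant G F x = 0)
  /-- `R_{ab} - (1/2) R g_{ab} + Λ g_{ab} = 8 π T_{ab}` -/
  einstein : ∀ x ∈ U, ricci G x - ((1 / 2) * scalarCurv G x) • G x + Λ • G x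
    = (8 * Real.pi) • emStress G F x

end

open scoped Manifold ContDiff

noncomputable section

/-! ### Partial derivatives of real functions and of matrices -/

section PartialDerivatives

variable {U : Set R4} {x : R4}

/-! The core is that the Codazzi condition together with the Segré type forces the Ricci tensor to
be parallel. Contracting the second Bianchi identity with the Codazzi condition shows that the Ricci
scalar is constant (`MetricOn.pd_scalarCurv_eq_zero`). As an endomorphism the Ricci tensor satisfies
a quadratic equation whose coefficients are half the scalar and the product of the two eigenvalues.
Differentiating it gives, in an eigenvector tetrad, an algebraic equation for `∇ Ric`, which is
totally symmetric. That equation kills the off-diagonal components within each eigenplane, hence by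
symmetry the gradient of the product, hence every component with two indices in one plane. Among
three indices two always share a plane, so `∇ Ric = 0` and the eigenvalues are locally constant
(`symm_tensor_eq_zero`, `IsCodazziPair.covM_ricci`). Eigenvalues do not depend on the tetrad or the
chart, so connectedness makes them global constants; they are written `Λ - 2Φ` and `Λ + 2Φ`.

The spectral projectors are then smooth, and projecting and orthonormalising a frozen tetrad gives a
smooth eigenvector tetrad (`IsCodazziPair.exists_frame`). Its connection commutes with the
eigenvalue matrix, so it takes values in the abelian algebra of boosts of one plane and rotations of
the other. The first Bianchi identity and the Ricci contraction leave the curvatures `ρ₁ θ⁰ ∧ θ¹`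
and `ρ₂ θ² ∧ θ³`: the structure equations of a product of two surfaces of constant curvature
(`MetricOn.exists_isProductCoframe`).

Coordinates come from flat linear systems. For each surface the structure equations say that a
certain linear system is integrable; `exists_flat_solution` integrates it along rays, and ratios and
products of components of a solution, with one further primitive, are the coordinates `u, r` and the
stereographic `ζ`. The identity between quadratic forms makes the Jacobian invertible, and the
inverse function theorem turns these functions into a chart.

For the field equations, the left side of Einstein's equations is `2Φ` times the metric with a sign
change on the first plane. The trace of the stress tensor over the second plane is nonnegative, so a
source forces `Φ > 0`; conversely a constant multiple of `du ∧ dr` is a source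
(`exists_emSource_iff`). -/

theorem ContDiffOn.differentiableAt_of_isOpen {f : R4 → ℝ} (hU : IsOpen U)
    (hf : ContDiffOn ℝ ∞ f U) (hx : x ∈ U) : DifferentiableAt ℝ f x :=
  (hf.contDiffAt (hU.mem_nhds hx)).differentiableAt (by simp)

theorem pd_const (i : Fin 4) (c : ℝ) (x : R4) : pd i (fun _ => c) x = 0 := by
  simp [pd]

theorem pd_add (i : Fin 4) {f g : R4 → ℝ} (hf : DifferentiableAt ℝ f x)
    (hg : DifferentiableAt ℝ g x) : pd i (fun y => f y + g y) x = pd i f x + pd i g x := by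
  simp only [pd]; rw [fderiv_fun_add hf hg]; rfl

theorem pd_sub (i : Fin 4) {f g : R4 → ℝ} (hf : DifferentiableAt ℝ f x)
    (hg : DifferentiableAt ℝ g x) : pd i (fun y => f y - g y) x = pd i f x - pd i g x := by
  simp only [pd]; rw [fderiv_fun_sub hf hg]; rfl

theorem pd_neg (i : Fin 4) (f : R4 → ℝ) : pd i (fun y => - f y) x = - pd i f x := by
  simp only [pd]; rw [fderiv_fun_neg]; rfl

theorem pd_mul (i : Fin 4) {f g : R4 → ℝ} (hf : DifferentiableAt ℝ f x)
    (hg : DifferentiableAt ℝ g x) :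
    pd i (fun y => f y * g y) x = pd i f x * g x + f x * pd i g x := by
  simp only [pd]; rw [fderiv_fun_mul hf hg]
  simp [add_comm, mul_comm]

theorem pd_const_mul (i : Fin 4) (c : ℝ) {f : R4 → ℝ} (hf : DifferentiableAt ℝ f x) :
    pd i (fun y => c * f y) x = c * pd i f x := by
  rw [pd_mul i (differentiableAt_const c) hf, pd_const]; ring

theorem pd_sum {ι : Type*} (i : Fin 4) (s : Finset ι) {f : ι → R4 → ℝ}
    (hf : ∀ j ∈ s, DifferentiableAt ℝ (f j) x) :
    pd i (fun y => ∑ j ∈ s, f j y) x = ∑ j ∈ s, pd i (f j) x := by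
  simp only [pd]; rw [fderiv_fun_sum hf]; simp

theorem pd_inv (i : Fin 4) {f : R4 → ℝ} (hf : DifferentiableAt ℝ f x) (h0 : f x ≠ 0) :
    pd i (fun y => (f y)⁻¹) x = - pd i f x / f x ^ 2 := by
  simp only [pd]
  have h1 := ((hasDerivAt_inv h0).comp_hasFDerivAt x hf.hasFDerivAt).fderiv
  rw [show (fun y => (f y)⁻¹) = Inv.inv ∘ f from rfl, h1]
  simp [div_eq_inv_mul]

theorem pd_congr (i : Fin 4) {f g : R4 → ℝ} (hU : IsOpen U) (h : ∀ y ∈ U, f y = g y)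
    (hx : x ∈ U) : pd i f x = pd i g x := by
  simp only [pd]
  rw [Filter.EventuallyEq.fderiv_eq (Filter.eventuallyEq_of_mem (hU.mem_nhds hx) h)]

theorem pd_contDiffOn (i : Fin 4) {f : R4 → ℝ} (hU : IsOpen U) (hf : ContDiffOn ℝ ∞ f U) :
    ContDiffOn ℝ ∞ (pd i f) U :=
  (hf.fderiv_of_isOpen hU (by simp)).clm_apply contDiffOn_const

theorem pd_comm (i j : Fin 4) {f : R4 → ℝ} (hU : IsOpen U) (hf : ContDiffOn ℝ ∞ f U)
    (hx : x ∈ U) : pd i (pd j f) x = pd j (pd i f) x := by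
  have hs : IsSymmSndFDerivAt ℝ f x :=
    (hf.contDiffAt (hU.mem_nhds hx)).isSymmSndFDerivAt
      (by simp only [minSmoothness_of_isRCLikeNormedField]; exact WithTop.coe_le_coe.2 le_top)
  have hd : DifferentiableAt ℝ (fderiv ℝ f) x :=
    ((hf.fderiv_of_isOpen (m := ∞) hU (by simp)).contDiffAt (hU.mem_nhds hx)).differentiableAt
      (by simp)
  have key : ∀ i j, pd i (pd j f) x
      = fderiv ℝ (fderiv ℝ f) x (EuclideanSpace.single i 1) (EuclideanSpace.single j 1) := by
    intro i j
    unfold pd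
    rw [fderiv_clm_apply hd (differentiableAt_const _)]
    simp
  rw [key, key]
  exact hs _ _

theorem fderiv_eq_sum_pd (f : R4 → ℝ) (x v : R4) : fderiv ℝ f x v = ∑ i, v i * pd i f x := by
  have hv : v = ∑ i, v i • (EuclideanSpace.single i (1 : ℝ) : R4) := by
    ext k
    simp [Finset.sum_apply, Pi.single_apply]
  conv_lhs => rw [hv]
  simp [pd]

/-- The entrywise partial derivative of a matrix-valued function. -/
def mpd {ι κ : Type*} (c : Fin 4) (M : R4 → Matrix ι κ ℝ) (x : R4) : Matrix ι κ ℝ :=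
  Matrix.of fun i j => pd c (fun y => M y i j) x

/-- Smoothness of all the entries of a matrix-valued function. -/
def MSmooth {ι κ : Type*} (U : Set R4) (M : R4 → Matrix ι κ ℝ) : Prop :=
  ∀ i j, ContDiffOn ℝ ∞ (fun x => M x i j) U

/-! ### Calculus of matrix-valued functions. -/

variable {ι κ μ : Type*}

theorem MSmooth.mono {V : Set R4} {M : R4 → Matrix ι κ ℝ} (h : MSmooth U M) (hV : V ⊆ U) :
    MSmooth V M := fun i j => (h i j).mono hV

theorem MSmooth.diff {M : R4 → Matrix ι κ ℝ} (hU : IsOpen U) (h : MSmooth U M) (hx : x ∈ U)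
    (i : ι) (j : κ) : DifferentiableAt ℝ (fun y => M y i j) x :=
  (h i j).differentiableAt_of_isOpen hU hx

theorem MSmooth.const (M : Matrix ι κ ℝ) : MSmooth U fun _ => M := fun _ _ => contDiffOn_const

theorem MSmooth.add {M N : R4 → Matrix ι κ ℝ} (hM : MSmooth U M) (hN : MSmooth U N) :
    MSmooth U fun x => M x + N x := fun i j => (hM i j).add (hN i j)

theorem MSmooth.sub {M N : R4 → Matrix ι κ ℝ} (hM : MSmooth U M) (hN : MSmooth U N) :
    MSmooth U fun x => M x - N x := fun i j => (hM i j).sub (hN i j)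

theorem MSmooth.smul {f : R4 → ℝ} {M : R4 → Matrix ι κ ℝ} (hf : ContDiffOn ℝ ∞ f U)
    (hM : MSmooth U M) : MSmooth U fun x => f x • M x := fun i j => hf.mul (hM i j)

theorem MSmooth.transpose {M : R4 → Matrix ι κ ℝ} (hM : MSmooth U M) :
    MSmooth U fun x => (M x).transpose := fun i j => hM j i

theorem MSmooth.mul [Fintype κ] {M : R4 → Matrix ι κ ℝ} {N : R4 → Matrix κ μ ℝ}
    (hM : MSmooth U M) (hN : MSmooth U N) : MSmooth U fun x => M x * N x := fun i j => by
  simp only [Matrix.mul_apply]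
  exact ContDiffOn.sum fun k _ => (hM i k).mul (hN k j)

theorem MSmooth.sum {α : Type*} (s : Finset α) {M : α → R4 → Matrix ι κ ℝ}
    (hM : ∀ a, MSmooth U (M a)) : MSmooth U fun x => ∑ a ∈ s, M a x := fun i j => by
  simp only [Matrix.sum_apply]
  exact ContDiffOn.sum fun k _ => hM k i j

theorem MSmooth.congr {M N : R4 → Matrix ι κ ℝ} (hM : MSmooth U M) (h : ∀ x ∈ U, N x = M x) :
    MSmooth U N := fun i j => (hM i j).congr fun x hx => by rw [h x hx]

theorem MSmooth.det [Fintype ι] [DecidableEq ι] {M : R4 → Matrix ι ι ℝ} (hM : MSmooth U M) :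
    ContDiffOn ℝ ∞ (fun x => (M x).det) U := by
  simp only [Matrix.det_apply']
  exact ContDiffOn.sum fun σ _ => contDiffOn_const.mul (contDiffOn_prod fun i _ => hM (σ i) i)

/-- By Cramer's rule each entry of the inverse is a minor divided by the determinant. -/
theorem MSmooth.inv [Fintype ι] [DecidableEq ι] {M : R4 → Matrix ι ι ℝ} (hM : MSmooth U M)
    (hd : ∀ x ∈ U, (M x).det ≠ 0) : MSmooth U fun x => (M x)⁻¹ := by
  intro i j
  simp only [Matrix.inv_def, Matrix.smul_apply, smul_eq_mul, Ring.inverse_eq_inv',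
    Matrix.adjugate_apply]
  refine (hM.det.inv hd).mul (MSmooth.det fun k l => ?_)
  by_cases h : k = j
  · subst h; simp only [Matrix.updateRow_self]; exact contDiffOn_const
  · simp only [Matrix.updateRow_ne h]; exact hM k l

theorem MSmooth.mpd (c : Fin 4) {M : R4 → Matrix ι κ ℝ} (hU : IsOpen U) (hM : MSmooth U M) :
    MSmooth U (mpd c M) := fun i j => pd_contDiffOn c hU (hM i j)

theorem mpd_congr (c : Fin 4) {M N : R4 → Matrix ι κ ℝ} (hU : IsOpen U)
    (h : ∀ y ∈ U, M y = N y) (hx : x ∈ U) : mpd c M x = mpd c N x := by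
  ext i j; exact pd_congr c hU (fun y hy => by rw [h y hy]) hx

theorem mpd_comm (c d : Fin 4) {M : R4 → Matrix ι κ ℝ} (hU : IsOpen U) (hM : MSmooth U M)
    (hx : x ∈ U) : mpd c (mpd d M) x = mpd d (mpd c M) x := by
  ext i j; exact pd_comm c d hU (hM i j) hx

theorem mpd_const (c : Fin 4) (M : Matrix ι κ ℝ) : mpd c (fun _ => M) x = 0 := by
  ext i j; exact pd_const c _ x

theorem mpd_transpose (c : Fin 4) (M : R4 → Matrix ι κ ℝ) :
    mpd c (fun y => (M y).transpose) x = (mpd c M x).transpose := rfl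

theorem mpd_add (c : Fin 4) {M N : R4 → Matrix ι κ ℝ} (hU : IsOpen U) (hM : MSmooth U M)
    (hN : MSmooth U N) (hx : x ∈ U) : mpd c (fun y => M y + N y) x = mpd c M x + mpd c N x := by
  ext i j; exact pd_add c (hM.diff hU hx i j) (hN.diff hU hx i j)

theorem mpd_sub (c : Fin 4) {M N : R4 → Matrix ι κ ℝ} (hU : IsOpen U) (hM : MSmooth U M)
    (hN : MSmooth U N) (hx : x ∈ U) : mpd c (fun y => M y - N y) x = mpd c M x - mpd c N x := by
  ext i j; exact pd_sub c (hM.diff hU hx i j) (hN.diff hU hx i j)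

theorem mpd_smul (c : Fin 4) {f : R4 → ℝ} {M : R4 → Matrix ι κ ℝ} (hU : IsOpen U)
    (hf : ContDiffOn ℝ ∞ f U) (hM : MSmooth U M) (hx : x ∈ U) :
    mpd c (fun y => f y • M y) x = pd c f x • M x + f x • mpd c M x := by
  ext i j; exact pd_mul c (hf.differentiableAt_of_isOpen hU hx) (hM.diff hU hx i j)

theorem mpd_mul [Fintype κ] (c : Fin 4) {M : R4 → Matrix ι κ ℝ} {N : R4 → Matrix κ μ ℝ}
    (hU : IsOpen U) (hM : MSmooth U M) (hN : MSmooth U N) (hx : x ∈ U) :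
    mpd c (fun y => M y * N y) x = mpd c M x * N x + M x * mpd c N x := by
  ext i j
  simp only [mpd, Matrix.of_apply, Matrix.add_apply, Matrix.mul_apply]
  refine (pd_sum c Finset.univ fun k _ => (hM.diff hU hx i k).fun_mul (hN.diff hU hx k j)).trans ?_
  rw [← Finset.sum_add_distrib]
  exact Finset.sum_congr rfl fun k _ => pd_mul c (hM.diff hU hx i k) (hN.diff hU hx k j)

theorem mpd_sum {α : Type*} (c : Fin 4) (s : Finset α) {M : α → R4 → Matrix ι κ ℝ}
    (hU : IsOpen U) (hM : ∀ a, MSmooth U (M a)) (hx : x ∈ U) :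
    mpd c (fun y => ∑ a ∈ s, M a y) x = ∑ a ∈ s, mpd c (M a) x := by
  ext i j
  simp only [mpd, Matrix.of_apply, Matrix.sum_apply]
  exact pd_sum c s fun a _ => (hM a).diff hU hx i j

/-- The curvature `∂_c A_d - ∂_d A_c + [A_c, A_d]` of a matrix-valued 1-form. -/
def curvM {ι : Type*} [Fintype ι] (A : Fin 4 → R4 → Matrix ι ι ℝ) (c d : Fin 4) (x : R4) :
    Matrix ι ι ℝ :=
  mpd c (A d) x - mpd d (A c) x + (A c x * A d x - A d x * A c x)

theorem curvM_swap [Fintype ι] (A : Fin 4 → R4 → Matrix ι ι ℝ) (c d : Fin 4) (x : R4) :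
    curvM A d c x = - curvM A c d x := by
  simp only [curvM]; abel

theorem MSmooth.curvM [Fintype ι] {A : Fin 4 → R4 → Matrix ι ι ℝ} (hU : IsOpen U)
    (hA : ∀ c, MSmooth U (A c)) (c d : Fin 4) : MSmooth U (curvM A c d) :=
  (((hA d).mpd c hU).sub ((hA c).mpd d hU)).add (((hA c).mul (hA d)).sub ((hA d).mul (hA c)))

/-- The second Bianchi identity for a matrix-valued 1-form. -/
theorem curvM_bianchi [Fintype ι] {A : Fin 4 → R4 → Matrix ι ι ℝ} (hU : IsOpen U)
    (hA : ∀ c, MSmooth U (A c)) (hx : x ∈ U) (c d e : Fin 4) :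
    (mpd e (curvM A c d) x + (A e x * curvM A c d x - curvM A c d x * A e x))
    + (mpd c (curvM A d e) x + (A c x * curvM A d e x - curvM A d e x * A c x))
    + (mpd d (curvM A e c) x + (A d x * curvM A e c x - curvM A e c x * A d x)) = 0 := by
  have key : ∀ c d e : Fin 4, mpd e (curvM A c d) x
      = mpd e (mpd c (A d)) x - mpd e (mpd d (A c)) x
        + ((mpd e (A c) x * A d x + A c x * mpd e (A d) x)
          - (mpd e (A d) x * A c x + A d x * mpd e (A c) x)) := by
    intro c d e
    have h1 := mpd_add (x := x) e hU (((hA d).mpd c hU).sub ((hA c).mpd d hU))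
      (((hA c).mul (hA d)).sub ((hA d).mul (hA c))) hx
    refine h1.trans ?_
    rw [mpd_sub e hU ((hA d).mpd c hU) ((hA c).mpd d hU) hx,
      mpd_sub e hU ((hA c).mul (hA d)) ((hA d).mul (hA c)) hx,
      mpd_mul e hU (hA c) (hA d) hx, mpd_mul e hU (hA d) (hA c) hx]
  rw [key, key, key, mpd_comm e c hU (hA d) hx, mpd_comm e d hU (hA c) hx,
    mpd_comm c d hU (hA e) hx]
  simp only [curvM]
  noncomm_ring

/-- Gauge transformation: an intertwiner of two connections intertwines their curvatures. -/
theorem curvM_gauge [Fintype ι] {A B : Fin 4 → R4 → Matrix ι ι ℝ} {K : R4 → Matrix ι ι ℝ}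
    (hU : IsOpen U) (hA : ∀ c, MSmooth U (A c)) (hB : ∀ c, MSmooth U (B c)) (hK : MSmooth U K)
    (h : ∀ x ∈ U, ∀ c, K x * B c x = mpd c K x + A c x * K x) (hx : x ∈ U) (c d : Fin 4) :
    K x * curvM B c d x = curvM A c d x * K x := by
  -- The intertwining relation in direction `d`, differentiated along `c`. Antisymmetrising in `c,
  -- d` removes the second derivatives of `K`.
  have key : ∀ c d, mpd c K x * B d x + K x * mpd c (B d) x
      = mpd c (mpd d K) x + (mpd c (A d) x * K x + A d x * mpd c K x) := by
    intro c d
    have h1 := mpd_congr (x := x) c hU (fun y hy => h y hy d) hx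
    rw [mpd_mul c hU hK (hB d) hx, mpd_add c hU (hK.mpd d hU) ((hA d).mul hK) hx,
      mpd_mul c hU (hA d) hK hx] at h1
    exact h1
  have hd : ∀ c, mpd c K x = K x * B c x - A c x * K x := fun c => by rw [h x hx c]; abel
  have e1 : K x * mpd c (B d) x = mpd c (mpd d K) x + (mpd c (A d) x * K x + A d x * mpd c K x)
    - mpd c K x * B d x := by rw [← key]; abel
  have e2 : K x * mpd d (B c) x = mpd d (mpd c K) x + (mpd d (A c) x * K x + A c x * mpd d K x)
    - mpd d K x * B c x := by rw [← key]; abel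
  simp only [curvM, mul_add, mul_sub, add_mul, sub_mul]
  rw [e1, e2, mpd_comm c d hU hK hx, hd c, hd d]
  noncomm_ring

end PartialDerivatives

/-! ### The Levi-Civita connection of a metric in coordinates -/

section LeviCivita

/-- `G` is the matrix of components of a smooth nondegenerate metric on the open set `U`. -/
structure MetricOn (G : R4 → Matrix (Fin 4) (Fin 4) ℝ) (U : Set R4) : Prop where
  isOpen : IsOpen U
  smooth : MSmooth U G
  symm : ∀ x ∈ U, (G x).transpose = G x
  det : ∀ x ∈ U, (G x).det ≠ 0

/-- The matrix `(Γ^a_{cb})_{ab}` of the connection in the direction `∂_c`. -/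
def conn (G : R4 → Matrix (Fin 4) (Fin 4) ℝ) (c : Fin 4) (x : R4) : Matrix (Fin 4) (Fin 4) ℝ :=
  Matrix.of fun a b => christoffel G a c b x

variable {G : R4 → Matrix (Fin 4) (Fin 4) ℝ} {U : Set R4} {x : R4}

theorem MetricOn.mono {V : Set R4} (h : MetricOn G U) (hV : IsOpen V) (hVU : V ⊆ U) :
    MetricOn G V :=
  ⟨hV, h.smooth.mono hVU, fun x hx => h.symm x (hVU hx), fun x hx => h.det x (hVU hx)⟩

theorem MetricOn.pd_symm (h : MetricOn G U) (hx : x ∈ U) (l i j : Fin 4) :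
    pd l (fun y => G y i j) x = pd l (fun y => G y j i) x :=
  pd_congr l h.isOpen (fun y hy => by
    conv_lhs => rw [← h.symm y hy]
    rfl) hx

theorem MetricOn.inv_mul (h : MetricOn G U) (hx : x ∈ U) : (G x)⁻¹ * G x = 1 :=
  Matrix.nonsing_inv_mul _ (isUnit_iff_ne_zero.2 (h.det x hx))

theorem MetricOn.mul_inv (h : MetricOn G U) (hx : x ∈ U) : G x * (G x)⁻¹ = 1 :=
  Matrix.mul_nonsing_inv _ (isUnit_iff_ne_zero.2 (h.det x hx))

theorem MetricOn.inv_smooth (h : MetricOn G U) : MSmooth U fun x => (G x)⁻¹ :=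
  h.smooth.inv h.det

theorem MetricOn.inv_symm (h : MetricOn G U) (hx : x ∈ U) :
    ((G x)⁻¹).transpose = (G x)⁻¹ := by
  rw [Matrix.transpose_nonsing_inv, h.symm x hx]

theorem MetricOn.christoffel_symm (h : MetricOn G U) (hx : x ∈ U) (k i j : Fin 4) :
    christoffel G k i j x = christoffel G k j i x := by
  simp only [christoffel]
  congr 1
  refine Finset.sum_congr rfl fun l _ => ?_
  rw [h.pd_symm hx l i j]; ring

theorem MetricOn.christoffel_smooth (h : MetricOn G U) (k i j : Fin 4) :
    ContDiffOn ℝ ∞ (christoffel G k i j) U :=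
  contDiffOn_const.mul (ContDiffOn.sum fun l _ => (h.inv_smooth k l).mul
    (((pd_contDiffOn i h.isOpen (h.smooth j l)).add (pd_contDiffOn j h.isOpen (h.smooth i l))).sub
      (pd_contDiffOn l h.isOpen (h.smooth i j))))

theorem MetricOn.conn_smooth (h : MetricOn G U) (c : Fin 4) : MSmooth U (conn G c) :=
  fun a b => h.christoffel_smooth a c b

theorem MetricOn.conn_swap (h : MetricOn G U) (hx : x ∈ U) (a b c : Fin 4) :
    conn G c x a b = conn G b x a c := h.christoffel_symm hx a c b

theorem MetricOn.mul_conn_apply (h : MetricOn G U) (hx : x ∈ U) (c l b : Fin 4) :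
    (G x * conn G c x) l b = (1 / 2) * (pd c (fun y => G y b l) x + pd b (fun y => G y c l) x
      - pd l (fun y => G y c b) x) := by
  have hc : conn G c x = (G x)⁻¹ * Matrix.of fun l b => (1 / 2) * (pd c (fun y => G y b l) x
      + pd b (fun y => G y c l) x - pd l (fun y => G y c b) x) := by
    ext a b
    simp only [conn, christoffel, Matrix.of_apply, Matrix.mul_apply, Finset.mul_sum]
    exact Finset.sum_congr rfl fun l _ => by ring
  rw [hc, ← mul_assoc, h.mul_inv hx, one_mul]
  rfl

/-- Metric compatibility. -/
theorem MetricOn.mpd_eq (h : MetricOn G U) (hx : x ∈ U) (c : Fin 4) :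
    mpd c G x = G x * conn G c x + (conn G c x).transpose * G x := by
  have h1 : (conn G c x).transpose * G x = (G x * conn G c x).transpose := by
    rw [Matrix.transpose_mul, h.symm x hx]
  rw [h1]
  ext i j
  rw [Matrix.add_apply, Matrix.transpose_apply, h.mul_conn_apply hx, h.mul_conn_apply hx]
  simp only [mpd, Matrix.of_apply]
  rw [h.pd_symm hx c j i, h.pd_symm hx j c i, h.pd_symm hx i c j]; ring

/-- Uniqueness of the torsion-free metric connection. -/
theorem MetricOn.conn_unique (h : MetricOn G U) (hx : x ∈ U)
    {B : Fin 4 → Matrix (Fin 4) (Fin 4) ℝ} (hB : ∀ a b c, B c a b = B b a c)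
    (hG : ∀ c, mpd c G x = G x * B c + (B c).transpose * G x) (c : Fin 4) :
    B c = conn G c x := by
  have hs : ∀ l b c, (G x * B c) l b = (G x * B b) l c := by
    intro l b c
    simp only [Matrix.mul_apply, hB _ b c]
  have hG' : ∀ c i j, pd c (fun y => G y i j) x = (G x * B c) i j + (G x * B c) j i := by
    intro c i j
    have h1 : (B c).transpose * G x = (G x * B c).transpose := by
      rw [Matrix.transpose_mul, h.symm x hx]
    have h2 := congrFun (congrFun (hG c) i) j
    rw [h1] at h2
    exact h2
  -- Koszul's argument: compatibility in three permutations of the indices, combined by symmetry,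
  -- determines the lowered connection.
  have key : G x * B c = G x * conn G c x := by
    ext l b
    rw [h.mul_conn_apply hx, hG', hG', hG', hs c l b, hs b l c, hs l b c]
    ring
  calc B c = (G x)⁻¹ * (G x * B c) := by rw [← mul_assoc, h.inv_mul hx, one_mul]
    _ = conn G c x := by rw [key, ← mul_assoc, h.inv_mul hx, one_mul]

theorem riemann_eq_curvM (a b c d : Fin 4) : riemann G a b c d x = curvM (conn G) c d x a b := by
  simp only [riemann, curvM, Matrix.add_apply, Matrix.sub_apply, Matrix.mul_apply,
    Finset.sum_sub_distrib]
  rfl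

theorem ricci_apply (b d : Fin 4) : ricci G x b d = ∑ a, curvM (conn G) a d x a b := by
  simp only [ricci, Matrix.of_apply, riemann_eq_curvM]

theorem MetricOn.curv_smooth (h : MetricOn G U) (c d : Fin 4) : MSmooth U (curvM (conn G) c d) :=
  MSmooth.curvM h.isOpen h.conn_smooth c d

theorem MetricOn.ricci_smooth (h : MetricOn G U) : MSmooth U (ricci G) := fun b d =>
  (ContDiffOn.sum fun a _ => h.curv_smooth a d a b).congr fun _ _ => ricci_apply b d

/-- The first Bianchi identity. -/
theorem MetricOn.bianchi_first (h : MetricOn G U) (hx : x ∈ U) (a b c d : Fin 4) :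
    curvM (conn G) c d x a b + curvM (conn G) d b x a c + curvM (conn G) b c x a d = 0 := by
  have hp : ∀ e a b c, mpd e (conn G c) x a b = mpd e (conn G b) x a c := fun e a b c =>
    pd_congr e h.isOpen (fun y hy => h.conn_swap hy a b c) hx
  simp only [curvM, Matrix.add_apply, Matrix.sub_apply, Matrix.mul_apply]
  simp only [fun e => h.conn_swap hx e d c, fun e => h.conn_swap hx e b c,
    fun e => h.conn_swap hx e b d]
  rw [hp c a b d, hp d a b c, hp b a c d]
  ring

/-- The curvature, with the index lowered, is antisymmetric. -/
theorem MetricOn.curv_antisymm (h : MetricOn G U) (hx : x ∈ U) (c d : Fin 4) :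
    (curvM (conn G) c d x).transpose * G x = - (G x * curvM (conn G) c d x) := by
  -- Second derivatives of the metric computed from compatibility. Their symmetry in `c, d` is the
  -- antisymmetry of the curvature once the products of connection matrices cancel.
  have key : ∀ c d, mpd c (mpd d G) x
      = (mpd c G x * conn G d x + G x * mpd c (conn G d) x)
        + ((mpd c (conn G d) x).transpose * G x + (conn G d x).transpose * mpd c G x) := by
    intro c d
    rw [mpd_congr c h.isOpen (fun y hy => h.mpd_eq hy d) hx,
      mpd_add c h.isOpen (h.smooth.mul (h.conn_smooth d))
        ((h.conn_smooth d).transpose.mul h.smooth) hx,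
      mpd_mul c h.isOpen h.smooth (h.conn_smooth d) hx,
      mpd_mul c h.isOpen (h.conn_smooth d).transpose h.smooth hx, mpd_transpose]
  have e := mpd_comm c d h.isOpen h.smooth hx
  rw [key, key, h.mpd_eq hx c, h.mpd_eq hx d] at e
  simp only [curvM, Matrix.transpose_add, Matrix.transpose_sub, Matrix.transpose_mul]
  rw [eq_neg_iff_add_eq_zero]
  rw [← sub_eq_zero] at e
  rw [← e]
  noncomm_ring

/-- By `MetricOn.curv_antisymm` the transposed curvature matrix is conjugate, through `G`, to the
negative of the matrix, so the trace equals its own negative. -/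
theorem MetricOn.curv_trace (h : MetricOn G U) (hx : x ∈ U) (c d : Fin 4) :
    (curvM (conn G) c d x).trace = 0 := by
  have e := h.curv_antisymm hx c d
  have h1 : (curvM (conn G) c d x).transpose
      = - (G x * curvM (conn G) c d x * (G x)⁻¹) := by
    rw [← neg_mul, ← e, mul_assoc, h.mul_inv hx, mul_one]
  have h2 := congrArg Matrix.trace h1
  rw [Matrix.trace_transpose, Matrix.trace_neg, Matrix.trace_mul_comm, ← mul_assoc,
    h.inv_mul hx, one_mul] at h2
  linarith

/-- The contracted first Bianchi identity is the antisymmetric part of the Ricci tensor plus the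
trace of the curvature matrix, which is zero. -/
theorem MetricOn.ricci_symm (h : MetricOn G U) (hx : x ∈ U) :
    (ricci G x).transpose = ricci G x := by
  ext d b
  rw [Matrix.transpose_apply, ricci_apply, ricci_apply]
  have h1 : ∑ a, (curvM (conn G) a d x a b + curvM (conn G) d b x a a
      + curvM (conn G) b a x a d) = 0 :=
    Finset.sum_eq_zero fun a _ => h.bianchi_first hx a b a d
  have h2 : ∑ a, curvM (conn G) d b x a a = 0 := h.curv_trace hx d b
  rw [Finset.sum_add_distrib, Finset.sum_add_distrib, h2] at h1
  have h3 : ∑ a, curvM (conn G) b a x a d = - ∑ a, curvM (conn G) a b x a d := by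
    rw [← Finset.sum_neg_distrib]
    exact Finset.sum_congr rfl fun a _ => by rw [curvM_swap]; rfl
  linarith

/-- The covariant derivative of a covariant 2-tensor, as a matrix. -/
def covM (G S : R4 → Matrix (Fin 4) (Fin 4) ℝ) (c : Fin 4) (x : R4) : Matrix (Fin 4) (Fin 4) ℝ :=
  mpd c S x - ((conn G c x).transpose * S x + S x * conn G c x)

theorem covDeriv_eq_covM (S : R4 → Matrix (Fin 4) (Fin 4) ℝ) (c a b : Fin 4) :
    covDeriv G S c a b x = covM G S c x a b := by
  simp only [covDeriv, covM, Matrix.sub_apply, Matrix.add_apply, Matrix.mul_apply,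
    Finset.sum_add_distrib, mul_comm (S x a _)]
  rfl

theorem MetricOn.mpd_inv (h : MetricOn G U) (hx : x ∈ U) (c : Fin 4) :
    mpd c (fun y => (G y)⁻¹) x
      = - (conn G c x * (G x)⁻¹ + (G x)⁻¹ * (conn G c x).transpose) := by
  have e := mpd_congr c h.isOpen (fun y hy => h.inv_mul hy) hx
  rw [mpd_mul c h.isOpen h.inv_smooth h.smooth hx, mpd_const, h.mpd_eq hx] at e
  have e1 : mpd c (fun y => (G y)⁻¹) x * G x
      = - ((G x)⁻¹ * (G x * conn G c x + (conn G c x).transpose * G x)) :=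
    eq_neg_of_add_eq_zero_left e
  calc mpd c (fun y => (G y)⁻¹) x = mpd c (fun y => (G y)⁻¹) x * G x * (G x)⁻¹ := by
        rw [mul_assoc, h.mul_inv hx, mul_one]
    _ = _ := by
        rw [e1, mul_add, ← mul_assoc, h.inv_mul hx, one_mul, neg_mul, add_mul, mul_assoc, mul_assoc,
          h.mul_inv hx, mul_one]

theorem MetricOn.scalarCurv_eq_trace (h : MetricOn G U) (hx : x ∈ U) :
    scalarCurv G x = ((G x)⁻¹ * ricci G x).trace := by
  simp only [scalarCurv, Matrix.trace, Matrix.diag, Matrix.mul_apply]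
  refine Finset.sum_congr rfl fun a _ => Finset.sum_congr rfl fun b _ => ?_
  conv_lhs => rw [← h.ricci_symm hx]
  rfl

theorem pd_trace {M : R4 → Matrix (Fin 4) (Fin 4) ℝ} (c : Fin 4) (hU : IsOpen U)
    (hM : MSmooth U M) (hx : x ∈ U) : pd c (fun y => (M y).trace) x = (mpd c M x).trace :=
  pd_sum c _ fun i _ => hM.diff hU hx i i

/-- The inverse metric is parallel, so all connection terms cancel under the trace. -/
theorem MetricOn.pd_scalarCurv (h : MetricOn G U) (hx : x ∈ U) (c : Fin 4) :
    pd c (scalarCurv G) x = ((G x)⁻¹ * covM G (ricci G) c x).trace := by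
  rw [pd_congr c h.isOpen (fun y hy => h.scalarCurv_eq_trace hy) hx,
    pd_trace c h.isOpen (h.inv_smooth.mul h.ricci_smooth) hx,
    mpd_mul c h.isOpen h.inv_smooth h.ricci_smooth hx, h.mpd_inv hx]
  have e : mpd c (ricci G) x = covM G (ricci G) c x
      + ((conn G c x).transpose * ricci G x + ricci G x * conn G c x) := by
    simp only [covM]; abel
  rw [e]
  simp only [neg_mul, add_mul, mul_add, Matrix.trace_add, Matrix.trace_neg, ← mul_assoc]
  rw [Matrix.trace_mul_comm _ (conn G c x), ← mul_assoc]
  ring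

theorem MetricOn.covM_ricci_symm (h : MetricOn G U) (hx : x ∈ U) (c : Fin 4) :
    (covM G (ricci G) c x).transpose = covM G (ricci G) c x := by
  simp only [covM, Matrix.transpose_sub, Matrix.transpose_add, Matrix.transpose_mul,
    Matrix.transpose_transpose, h.ricci_symm hx, ← mpd_transpose]
  rw [mpd_congr c h.isOpen (fun y hy => h.ricci_symm hy) hx, add_comm]

/-- The covariant derivative `∇_e R^a_{bcd}` of the Riemann tensor. -/
def covRiem (G : R4 → Matrix (Fin 4) (Fin 4) ℝ) (e c d : Fin 4) (x : R4) :
    Matrix (Fin 4) (Fin 4) ℝ :=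
  mpd e (curvM (conn G) c d) x
    + (conn G e x * curvM (conn G) c d x - curvM (conn G) c d x * conn G e x)
    - ∑ f, (conn G e x f c • curvM (conn G) f d x + conn G e x f d • curvM (conn G) c f x)

theorem covRiem_swap (e c d : Fin 4) : covRiem G e d c x = - covRiem G e c d x := by
  have h1 : mpd e (curvM (conn G) d c) x = - mpd e (curvM (conn G) c d) x := by
    ext i j
    simp only [mpd, Matrix.of_apply, Matrix.neg_apply, curvM_swap (conn G) c d, pd_neg]
  have h2 : ∀ f, curvM (conn G) f c x = - curvM (conn G) c f x := fun f => curvM_swap _ _ _ _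
  have h3 : ∀ f, curvM (conn G) d f x = - curvM (conn G) f d x := fun f => curvM_swap _ _ _ _
  simp only [covRiem, h1, h2, h3, smul_neg, Finset.sum_add_distrib,
    Finset.sum_neg_distrib]
  noncomm_ring

/-- The second Bianchi identity in tensor form. Compared with `curvM_bianchi` it has extra terms
where the connection acts on the two form indices; these cancel in pairs because the connection is
torsion-free. -/
theorem MetricOn.covRiem_cyclic (h : MetricOn G U) (hx : x ∈ U) (e c d : Fin 4) :
    covRiem G e c d x + covRiem G c d e x + covRiem G d e c x = 0 := by
  have hb := curvM_bianchi h.isOpen h.conn_smooth hx c d e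
  have hs : ∑ f, (conn G e x f c • curvM (conn G) f d x + conn G e x f d • curvM (conn G) c f x)
      + ∑ f, (conn G c x f d • curvM (conn G) f e x + conn G c x f e • curvM (conn G) d f x)
      + ∑ f, (conn G d x f e • curvM (conn G) f c x + conn G d x f c • curvM (conn G) e f x)
      = 0 := by
    rw [← Finset.sum_add_distrib, ← Finset.sum_add_distrib]
    refine Finset.sum_eq_zero fun f _ => ?_
    rw [h.conn_swap hx f c e, h.conn_swap hx f d e, h.conn_swap hx f d c,
      curvM_swap _ f d, curvM_swap _ f c, curvM_swap _ f e]
    simp only [smul_neg]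
    abel
  rw [← sub_zero (0 : Matrix (Fin 4) (Fin 4) ℝ)]
  nth_rewrite 1 [← hb]
  rw [← hs]
  simp only [covRiem]
  abel

/-- Contraction commutes with covariant differentiation: the connection terms of the contracted
upper and lower indices cancel. -/
theorem MetricOn.covRiem_contract (h : MetricOn G U) (hx : x ∈ U) (e b d : Fin 4) :
    ∑ a, covRiem G e a d x a b = covM G (ricci G) e x b d := by
  have h1 : mpd e (ricci G) x b d = ∑ a, mpd e (curvM (conn G) a d) x a b := by
    have := pd_sum e Finset.univ (f := fun a y => curvM (conn G) a d y a b) (x := x)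
      fun a _ => (h.curv_smooth a d).diff h.isOpen hx a b
    simp only [mpd, Matrix.of_apply, ricci_apply]
    exact this
  simp only [covRiem, covM, Matrix.sub_apply, Matrix.add_apply, h1, Matrix.mul_apply,
    Matrix.transpose_apply, Matrix.sum_apply, Matrix.smul_apply, smul_eq_mul, ricci_apply]
  simp only [Fin.sum_univ_four]
  ring

/-- The antisymmetry of the curvature, differentiated; the metric that lowers the index is parallel.
-/
theorem MetricOn.covRiem_antisymm (h : MetricOn G U) (hx : x ∈ U) (e c d : Fin 4) :
    (covRiem G e c d x).transpose * G x = - (G x * covRiem G e c d x) := by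
  have h1 := mpd_congr e h.isOpen (fun y hy => h.curv_antisymm hy c d) hx
  have h2 : mpd e (fun y => - (G y * curvM (conn G) c d y)) x
      = - mpd e (fun y => G y * curvM (conn G) c d y) x := by
    ext i j; exact pd_neg e _
  rw [h2, mpd_mul e h.isOpen h.smooth (h.curv_smooth c d) hx,
    mpd_mul e h.isOpen (h.curv_smooth c d).transpose h.smooth hx, mpd_transpose,
    h.mpd_eq hx] at h1
  have h3 : (∑ f, (conn G e x f c • curvM (conn G) f d x
        + conn G e x f d • curvM (conn G) c f x)).transpose * G x
      = - (G x * ∑ f, (conn G e x f c • curvM (conn G) f d x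
        + conn G e x f d • curvM (conn G) c f x)) := by
    rw [Matrix.transpose_sum, Finset.sum_mul, Finset.mul_sum, ← Finset.sum_neg_distrib]
    refine Finset.sum_congr rfl fun f _ => ?_
    rw [Matrix.transpose_add, Matrix.transpose_smul, Matrix.transpose_smul, add_mul, mul_add,
      Matrix.smul_mul, Matrix.smul_mul, h.curv_antisymm hx, h.curv_antisymm hx,
      Matrix.mul_smul, Matrix.mul_smul]
    simp only [smul_neg]; abel
  simp only [covRiem, Matrix.transpose_sub, Matrix.transpose_add, Matrix.transpose_mul, sub_mul,
    mul_sub, add_mul, mul_add, h3]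
  have h4 : (mpd e (curvM (conn G) c d) x).transpose * G x
      = - ((G x * conn G e x + (conn G e x).transpose * G x) * curvM (conn G) c d x
        + G x * mpd e (curvM (conn G) c d) x)
      - (curvM (conn G) c d x).transpose
        * (G x * conn G e x + (conn G e x).transpose * G x) := by
    rw [← h1]; abel
  rw [h4]
  have h5 := h.curv_antisymm hx c d
  have e1 : (curvM (conn G) c d x).transpose * (conn G e x).transpose * G x
      = (curvM (conn G) c d x).transpose * ((conn G e x).transpose * G x) := mul_assoc _ _ _
  have e2 : (conn G e x).transpose * (curvM (conn G) c d x).transpose * G x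
      = - ((conn G e x).transpose * (G x * curvM (conn G) c d x)) := by
    rw [mul_assoc, h5, mul_neg]
  have e3 : (curvM (conn G) c d x).transpose * (G x * conn G e x)
      = - (G x * curvM (conn G) c d x * conn G e x) := by
    rw [← mul_assoc, h5, neg_mul]
  rw [mul_add, e1, e2, e3]
  noncomm_ring

/-- In a space whose Ricci tensor is a Codazzi tensor the Ricci scalar is constant. -/
theorem MetricOn.pd_scalarCurv_eq_zero (h : MetricOn G U) (hx : x ∈ U)
    (hC : ∀ a b c, covM G (ricci G) a x b c = covM G (ricci G) b x a c) (c : Fin 4) :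
    pd c (scalarCurv G) x = 0 := by
  have hS : ∀ a b c, covM G (ricci G) a x b c = covM G (ricci G) a x c b := fun a b c => by
    conv_lhs => rw [← h.covM_ricci_symm hx]
    rfl
  -- the divergence of the Riemann tensor vanishes
  have hdiv : ∀ b d, ∑ a, covRiem G a c d x a b = 0 := by
    intro b d
    have h1 : ∑ a, (covRiem G a c d x + covRiem G c d a x + covRiem G d a c x) a b = 0 :=
      Finset.sum_eq_zero fun a _ => by rw [h.covRiem_cyclic hx]; rfl
    simp only [Matrix.add_apply, Finset.sum_add_distrib, h.covRiem_contract hx,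
      fun a => covRiem_swap (G := G) (x := x) c a d, Matrix.neg_apply,
      Finset.sum_neg_distrib] at h1
    rw [hS c b d, hC c d b, hS d c b] at h1
    linarith
  -- Raising the second index exposes the antisymmetry of the first pair.
  have hanti : ∀ e c d, covRiem G e c d x * (G x)⁻¹
      = - ((covRiem G e c d x) * (G x)⁻¹).transpose := by
    intro e c d
    have h1 := h.covRiem_antisymm hx e c d
    have h2 : covRiem G e c d x = - ((G x)⁻¹ * ((covRiem G e c d x).transpose * G x)) := by
      rw [h1, mul_neg, neg_neg, ← mul_assoc, h.inv_mul hx, one_mul]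
    rw [Matrix.transpose_mul, h.inv_symm hx]
    nth_rewrite 1 [h2]
    rw [neg_mul, mul_assoc, mul_assoc, h.mul_inv hx, mul_one]
  -- A further contraction of the vanishing divergence of the Riemann tensor.
  have h1 : ∑ d, ∑ a, (covRiem G a c d x * (G x)⁻¹) a d = 0 := by
    refine Finset.sum_eq_zero fun d _ => ?_
    simp only [Matrix.mul_apply]
    rw [Finset.sum_comm]
    simp only [← Finset.sum_mul, hdiv, zero_mul, Finset.sum_const_zero]
  -- By antisymmetry in both pairs the same double contraction is the divergence of the Ricci
  -- tensor.
  have h2 : ∑ d, ∑ a, (covRiem G a c d x * (G x)⁻¹) a d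
      = ∑ a, ∑ b, covM G (ricci G) a x b c * (G x)⁻¹ b a := by
    rw [Finset.sum_comm]
    refine Finset.sum_congr rfl fun a _ => ?_
    simp only [← h.covRiem_contract hx, Finset.sum_mul]
    rw [Finset.sum_comm]
    refine Finset.sum_congr rfl fun d _ => ?_
    rw [hanti, covRiem_swap (G := G) (x := x) a d c]
    simp [Matrix.mul_apply, mul_comm]
  -- The Codazzi condition identifies the divergence of the Ricci tensor, now known to vanish, with
  -- the gradient of its trace.
  rw [h.pd_scalarCurv hx, Matrix.trace_mul_comm, ← h1, h2]
  simp only [Matrix.trace, Matrix.diag, Matrix.mul_apply]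
  rw [Finset.sum_comm' (t' := Finset.univ) (s' := fun _ => Finset.univ) (by simp)]
  refine Finset.sum_congr rfl fun a _ => Finset.sum_congr rfl fun b _ => ?_
  have hi : (G x)⁻¹ a b = (G x)⁻¹ b a := congrFun (congrFun (h.inv_symm hx) b) a
  rw [hS a b c, hC a c b, hS c a b, hi]

end LeviCivita

/-! ### Pointwise algebra of the eigenvector tetrads -/

section Tetrads

/-- The diagonal matrix of the eigenvalues `ρ₁, ρ₁, ρ₂, ρ₂`. -/
def eigDiag (ρ₁ ρ₂ : ℝ) : Matrix (Fin 4) (Fin 4) ℝ := Matrix.diagonal ![ρ₁, ρ₁, ρ₂, ρ₂]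

/-- The columns of `E` form a tetrad, pseudo-orthonormal for `g`, of eigenvectors of `R`. -/
structure IsEigenTetrad (g R E : Matrix (Fin 4) (Fin 4) ℝ) (ρ₁ ρ₂ : ℝ) : Prop where
  orthonormal : E.transpose * g * E = minkowski
  eigen : R * E = g * E * eigDiag ρ₁ ρ₂

theorem IsRicciTetrad.isEigenTetrad {G : R4 → Matrix (Fin 4) (Fin 4) ℝ} {x : R4}
    {t : Fin 4 → Fin 4 → ℝ} {ρ₁ ρ₂ : ℝ} (h : IsRicciTetrad G x t ρ₁ ρ₂) :
    IsEigenTetrad (G x) (ricci G x) (Matrix.of fun a i => t i a) ρ₁ ρ₂ := by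
  constructor
  · ext i j
    rw [← h.orthonormal i j]
    simp only [evalTensor, Matrix.mul_apply, Matrix.transpose_apply, Matrix.of_apply,
      Finset.sum_mul]
    rw [Finset.sum_comm]
    exact Finset.sum_congr rfl fun a _ => Finset.sum_congr rfl fun b _ => by ring
  · ext a i
    have h0 := congrFun h.eigen_zero a
    have h1 := congrFun h.eigen_one a
    have h2 := congrFun h.eigen_two a
    have h3 := congrFun h.eigen_three a
    simp only [Matrix.mulVec, dotProduct, Pi.smul_apply, smul_eq_mul] at h0 h1 h2 h3
    rw [eigDiag, Matrix.mul_diagonal]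
    simp only [Matrix.mul_apply, Matrix.of_apply]
    fin_cases i
    · simpa [mul_comm] using h0
    · simpa [mul_comm] using h1
    · simpa [mul_comm] using h2
    · simpa [mul_comm] using h3

theorem minkowski_mul_self : minkowski * minkowski = 1 := by
  rw [minkowski, Matrix.diagonal_mul_diagonal, ← Matrix.diagonal_one]
  congr 1; ext i; fin_cases i <;> simp

theorem minkowski_mul_eigDiag (ρ₁ ρ₂ : ℝ) :
    minkowski * eigDiag ρ₁ ρ₂ = eigDiag ρ₁ ρ₂ * minkowski := by
  rw [minkowski, eigDiag, Matrix.diagonal_mul_diagonal, Matrix.diagonal_mul_diagonal]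
  congr 1; ext i; exact mul_comm _ _

theorem eigDiag_mul_self (ρ₁ ρ₂ : ℝ) :
    eigDiag ρ₁ ρ₂ * eigDiag ρ₁ ρ₂ = (ρ₁ + ρ₂) • eigDiag ρ₁ ρ₂ - (ρ₁ * ρ₂) • 1 := by
  ext i j
  simp only [eigDiag, Matrix.diagonal_mul_diagonal, Matrix.sub_apply, Matrix.smul_apply,
    Matrix.diagonal_apply, Matrix.one_apply, smul_eq_mul]
  split_ifs
  · fin_cases i <;> simp <;> ring
  · simp

variable {g R E : Matrix (Fin 4) (Fin 4) ℝ} {ρ₁ ρ₂ : ℝ}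

namespace IsEigenTetrad

theorem left_inv (h : IsEigenTetrad g R E ρ₁ ρ₂) :
    (minkowski * E.transpose * g) * E = 1 := by
  rw [mul_assoc, mul_assoc, ← mul_assoc E.transpose, h.orthonormal, minkowski_mul_self]

theorem right_inv (h : IsEigenTetrad g R E ρ₁ ρ₂) :
    E * (minkowski * E.transpose * g) = 1 := mul_eq_one_comm.1 h.left_inv

theorem inv_eq (h : IsEigenTetrad g R E ρ₁ ρ₂) : g⁻¹ = E * minkowski * E.transpose := by
  apply Matrix.inv_eq_left_inv
  rw [← h.right_inv]; simp only [mul_assoc]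

theorem mul_inv (h : IsEigenTetrad g R E ρ₁ ρ₂) : g * (E * minkowski * E.transpose) = 1 := by
  rw [mul_eq_one_comm, ← h.right_inv]; simp only [mul_assoc]

/-- `E` is invertible, so an identity between covariant 2-tensors may be checked on its tetrad
components. -/
theorem eq_of_conj (h : IsEigenTetrad g R E ρ₁ ρ₂) {S T : Matrix (Fin 4) (Fin 4) ℝ}
    (hST : E.transpose * S * E = E.transpose * T * E) : S = T := by
  have hl : g * E * minkowski * E.transpose = 1 := by
    rw [← h.mul_inv]; simp only [mul_assoc]
  have key : ∀ S, (g * E * minkowski) * (E.transpose * S * E)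
      * (minkowski * E.transpose * g) = S := by
    intro S
    calc _ = (g * E * minkowski * E.transpose) * S * (E * (minkowski * E.transpose * g)) := by
          simp only [mul_assoc]
      _ = S := by rw [hl, h.right_inv, one_mul, mul_one]
  rw [← key S, hST, key T]

theorem conj_eq (h : IsEigenTetrad g R E ρ₁ ρ₂) :
    E.transpose * R * E = minkowski * eigDiag ρ₁ ρ₂ := by
  rw [mul_assoc, h.eigen, ← mul_assoc, ← mul_assoc, h.orthonormal]

/-- The mixed tensor `g⁻¹ * R` is diagonal in the tetrad with two values, hence is annihilated by
`(X - ρ₁)(X - ρ₂)`. In this form the relation no longer mentions eigenvectors. -/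
theorem quadratic (h : IsEigenTetrad g R E ρ₁ ρ₂) :
    R * g⁻¹ * R = (ρ₁ + ρ₂) • R - (ρ₁ * ρ₂) • g := by
  apply h.eq_of_conj
  have e : E.transpose * (R * g⁻¹ * R) * E
      = (E.transpose * R * E) * minkowski * (E.transpose * R * E) := by
    rw [h.inv_eq]; simp only [mul_assoc]
  rw [e, mul_sub, sub_mul, Matrix.mul_smul, Matrix.mul_smul, Matrix.smul_mul, Matrix.smul_mul,
    h.conj_eq, h.orthonormal, mul_assoc, ← mul_assoc minkowski minkowski, minkowski_mul_self,
    one_mul, mul_assoc, eigDiag_mul_self, mul_sub, Matrix.mul_smul, Matrix.mul_smul, mul_one]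

theorem trace_eq (h : IsEigenTetrad g R E ρ₁ ρ₂) : (g⁻¹ * R).trace = 2 * (ρ₁ + ρ₂) := by
  rw [h.inv_eq, mul_assoc, mul_assoc, Matrix.trace_mul_comm, mul_assoc, mul_assoc,
    ← mul_assoc E.transpose, h.conj_eq, ← mul_assoc, minkowski_mul_self, one_mul]
  simp [eigDiag, Matrix.trace, Fin.sum_univ_four]; ring

theorem inv_mul_self (h : IsEigenTetrad g R E ρ₁ ρ₂) : g⁻¹ * g = 1 := by
  rw [h.inv_eq, mul_eq_one_comm, h.mul_inv]

/-- Newton's identity for two double eigenvalues. It presents the product through traces, hence as a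
smooth function of the point that needs no choice of tetrad. -/
theorem prod_eq (h : IsEigenTetrad g R E ρ₁ ρ₂) :
    ρ₁ * ρ₂ = ((g⁻¹ * R).trace ^ 2 / 2 - (g⁻¹ * (R * g⁻¹ * R)).trace) / 4 := by
  rw [h.quadratic, mul_sub, Matrix.trace_sub, Matrix.mul_smul, Matrix.mul_smul, h.inv_mul_self,
    Matrix.trace_smul, Matrix.trace_smul, h.trace_eq]
  simp; ring

/-- Eigenvectors for the second eigenvalue are not timelike. -/
theorem nonneg_of_eigen (h : IsEigenTetrad g R E ρ₁ ρ₂) (hne : ρ₁ ≠ ρ₂) {v : Fin 4 → ℝ}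
    (hv : R.mulVec v = ρ₂ • g.mulVec v) : 0 ≤ v ⬝ᵥ g.mulVec v := by
  obtain ⟨w, hw⟩ : ∃ w, w = (minkowski * E.transpose * g).mulVec v := ⟨_, rfl⟩
  have hvw : v = E.mulVec w := by
    rw [hw, Matrix.mulVec_mulVec, h.right_inv, Matrix.one_mulVec]
  have h1 : (eigDiag ρ₁ ρ₂).mulVec w = ρ₂ • w := by
    have h2 : (minkowski * E.transpose).mulVec (R.mulVec v)
        = (minkowski * E.transpose).mulVec (ρ₂ • g.mulVec v) := by rw [hv]
    rw [Matrix.mulVec_smul, Matrix.mulVec_mulVec, Matrix.mulVec_mulVec, ← hw, hvw,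
      Matrix.mulVec_mulVec, mul_assoc, h.eigen, ← mul_assoc, ← mul_assoc, h.left_inv,
      one_mul] at h2
    exact h2
  -- The components along the first plane are multiplied by `ρ₁` and also by `ρ₂`, so they vanish.
  have hw0 : w 0 = 0 := by
    have := congrFun h1 0
    simp [eigDiag, Matrix.mulVec_diagonal] at this
    tauto
  have hw1 : w 1 = 0 := by
    have := congrFun h1 1
    simp [eigDiag, Matrix.mulVec_diagonal] at this
    tauto
  have h3 : v ⬝ᵥ g.mulVec v = w ⬝ᵥ minkowski.mulVec w := by
    rw [hvw, ← h.orthonormal, Matrix.mulVec_mulVec, ← Matrix.mulVec_mulVec w (E.transpose * g),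
      ← Matrix.mulVec_mulVec _ E.transpose, Matrix.dotProduct_mulVec w E.transpose,
      Matrix.vecMul_transpose, Matrix.mulVec_mulVec]
  rw [h3]
  simp only [dotProduct, minkowski, Matrix.mulVec_diagonal, Fin.sum_univ_four, hw0, hw1]
  simp
  nlinarith [mul_self_nonneg (w 2), mul_self_nonneg (w 3)]

theorem dotProduct_zero (h : IsEigenTetrad g R E ρ₁ ρ₂) :
    (fun a => E a 0) ⬝ᵥ g.mulVec (fun a => E a 0) = -1 := by
  have := congrFun (congrFun h.orthonormal 0) 0
  simp only [minkowski, Matrix.diagonal_apply_eq, Matrix.mul_apply, Matrix.transpose_apply,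
    Finset.sum_mul] at this
  simp only [dotProduct, Matrix.mulVec, Finset.mul_sum]
  rw [Finset.sum_comm, show (-1 : ℝ) = ![-1, 1, 1, 1] 0 from rfl, ← this]
  exact Finset.sum_congr rfl fun a _ => Finset.sum_congr rfl fun b _ => by ring

theorem mulVec_zero (h : IsEigenTetrad g R E ρ₁ ρ₂) :
    R.mulVec (fun a => E a 0) = ρ₁ • g.mulVec (fun a => E a 0) := by
  ext b
  have := congrFun (congrFun h.eigen b) 0
  rw [eigDiag, Matrix.mul_diagonal] at this
  simp only [Matrix.mul_apply] at this
  simp only [Matrix.mulVec, dotProduct, Pi.smul_apply, smul_eq_mul, this]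
  simp [mul_comm]

/-- The eigenvalues do not depend on the tetrad. -/
theorem unique {E' : Matrix (Fin 4) (Fin 4) ℝ} {ρ₁' ρ₂' : ℝ} (h : IsEigenTetrad g R E ρ₁ ρ₂)
    (hne : ρ₁ ≠ ρ₂) (h' : IsEigenTetrad g R E' ρ₁' ρ₂') : ρ₁' = ρ₁ ∧ ρ₂' = ρ₂ := by
  have hs : ρ₁' + ρ₂' = ρ₁ + ρ₂ := by
    have := h.trace_eq; rw [h'.trace_eq] at this; linarith
  have hp : ρ₁' * ρ₂' = ρ₁ * ρ₂ := by rw [h.prod_eq, h'.prod_eq]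
  have h0 : (ρ₁' - ρ₁) * (ρ₁' - ρ₂) = 0 := by
    have : ρ₂' = ρ₁ + ρ₂ - ρ₁' := by linarith
    rw [this] at hp
    linear_combination -hp
  -- Sum and product fix the eigenvalues up to exchange. The exchange would give a timelike
  -- eigenvector for `ρ₂`, which `nonneg_of_eigen` forbids.
  rcases mul_eq_zero.1 h0 with h1 | h1
  · exact ⟨by linarith, by linarith⟩
  · exfalso
    have h2 : ρ₁' = ρ₂ := by linarith
    subst h2
    have := h.nonneg_of_eigen hne h'.mulVec_zero
    rw [h'.dotProduct_zero] at this
    linarith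

/-- `J⁻¹ * E` holds the components of the same vectors in the new coordinates. -/
theorem pullback (h : IsEigenTetrad g R E ρ₁ ρ₂) {J : Matrix (Fin 4) (Fin 4) ℝ}
    (hJ : J.det ≠ 0) :
    IsEigenTetrad (J.transpose * g * J) (J.transpose * R * J) (J⁻¹ * E) ρ₁ ρ₂ := by
  have h1 : J * J⁻¹ = 1 := Matrix.mul_nonsing_inv _ (isUnit_iff_ne_zero.2 hJ)
  have h2 : (J⁻¹).transpose * J.transpose = 1 := by
    rw [← Matrix.transpose_mul, h1, Matrix.transpose_one]
  constructor
  · rw [Matrix.transpose_mul, ← h.orthonormal]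
    calc _ = E.transpose * ((J⁻¹).transpose * J.transpose) * g * (J * J⁻¹) * E := by
          simp only [mul_assoc]
      _ = _ := by rw [h1, h2, mul_one, mul_one]
  · calc _ = J.transpose * R * (J * J⁻¹) * E := by simp only [mul_assoc]
      _ = J.transpose * (R * E) := by rw [h1, mul_one, mul_assoc]
      _ = J.transpose * g * (J * J⁻¹) * E * eigDiag ρ₁ ρ₂ := by
          rw [h.eigen, h1, mul_one]; simp only [mul_assoc]
      _ = _ := by simp only [mul_assoc]

end IsEigenTetrad

theorem evalTensor_add_left (S : Matrix (Fin 4) (Fin 4) ℝ) (u v w : Fin 4 → ℝ) :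
    evalTensor S (u + v) w = evalTensor S u w + evalTensor S v w := by
  simp only [evalTensor, Pi.add_apply, ← Finset.sum_add_distrib]
  exact Finset.sum_congr rfl fun a _ => Finset.sum_congr rfl fun b _ => by ring

theorem evalTensor_sub_right (S : Matrix (Fin 4) (Fin 4) ℝ) (u v w : Fin 4 → ℝ) :
    evalTensor S u (v - w) = evalTensor S u v - evalTensor S u w := by
  simp only [evalTensor, Pi.sub_apply, ← Finset.sum_sub_distrib]
  exact Finset.sum_congr rfl fun a _ => Finset.sum_congr rfl fun b _ => by ring

theorem evalTensor_smul_smul (S : Matrix (Fin 4) (Fin 4) ℝ) (c d : ℝ) (u v : Fin 4 → ℝ) :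
    evalTensor S (c • u) (d • v) = c * d * evalTensor S u v := by
  simp only [evalTensor, Pi.smul_apply, smul_eq_mul, Finset.mul_sum]
  exact Finset.sum_congr rfl fun a _ => Finset.sum_congr rfl fun b _ => by ring

/-- The Ricci tensor is diagonal in the tetrad: the `k, n` component is `(-ρ₁ - ρ₁) / 2 = -ρ₁`, and
the `m, m̄` component is `ρ₂`. -/
theorem IsRicciTetrad.npPhi11_eq {G : R4 → Matrix (Fin 4) (Fin 4) ℝ} {x : R4}
    {t : Fin 4 → Fin 4 → ℝ} {ρ₁ ρ₂ : ℝ} (h : IsRicciTetrad G x t ρ₁ ρ₂) :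
    npPhi11 G x t = (ρ₂ - ρ₁) / 4 := by
  have key : ∀ i j, evalTensor (ricci G x) (t i) (t j) = (minkowski * eigDiag ρ₁ ρ₂) i j := by
    intro i j
    rw [← h.isEigenTetrad.conj_eq]
    simp only [evalTensor, Matrix.mul_apply, Matrix.transpose_apply, Matrix.of_apply,
      Finset.sum_mul]
    rw [Finset.sum_comm]
    exact Finset.sum_congr rfl fun a _ => Finset.sum_congr rfl fun b _ => by ring
  have h2 : (√2 : ℝ)⁻¹ * (√2)⁻¹ = 1 / 2 := by
    rw [← mul_inv, Real.mul_self_sqrt (by norm_num)]; norm_num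
  rw [npPhi11, evalTensor_smul_smul, evalTensor_add_left, evalTensor_sub_right,
    evalTensor_sub_right, h2]
  simp only [key, minkowski, eigDiag, Matrix.diagonal_mul_diagonal, Matrix.diagonal_apply]
  simp
  ring

end Tetrads

/-! ### The Ricci tensor under coordinate transformations -/

section Transformation

variable {U V : Set R4} {y : R4}

/-- The Jacobian matrix `(∂_i ψ^a)_{ai}`. -/
def jacobian (ψ : R4 → R4) (y : R4) : Matrix (Fin 4) (Fin 4) ℝ :=
  Matrix.of fun a i => pd i (fun z => ψ z a) y

theorem pd_comp (i : Fin 4) {f : R4 → ℝ} {ψ : R4 → R4} (hf : DifferentiableAt ℝ f (ψ y))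
    (hψ : ∀ a, DifferentiableAt ℝ (fun z => ψ z a) y) :
    pd i (fun z => f (ψ z)) y = ∑ a, jacobian ψ y a i * pd a f (ψ y) := by
  have hψ' : DifferentiableAt ℝ ψ y := (differentiableAt_euclidean).2 hψ
  have h1 : pd i (fun z => f (ψ z)) y
      = fderiv ℝ f (ψ y) (fderiv ℝ ψ y (EuclideanSpace.single i 1)) := by
    unfold pd
    rw [show (fun z => f (ψ z)) = f ∘ ψ from rfl, fderiv_comp y hf hψ']
    rfl
  rw [h1, fderiv_eq_sum_pd]
  refine Finset.sum_congr rfl fun a _ => ?_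
  congr 1
  simp only [jacobian, Matrix.of_apply, pd]
  have := ((EuclideanSpace.proj (𝕜 := ℝ) a).hasFDerivAt.comp y hψ'.hasFDerivAt).fderiv
  rw [show (fun z => ψ z a) = (EuclideanSpace.proj (𝕜 := ℝ) a : R4 →L[ℝ] ℝ) ∘ ψ from rfl, this]
  rfl

theorem jacobian_smooth (hV : IsOpen V) {ψ : R4 → R4}
    (hψ : ∀ a, ContDiffOn ℝ ∞ (fun z => ψ z a) V) : MSmooth V (jacobian ψ) :=
  fun a i => pd_contDiffOn i hV (hψ a)

theorem contDiffOn_comp_of_coord {f : R4 → ℝ} {ψ : R4 → R4} (hf : ContDiffOn ℝ ∞ f U)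
    (hψ : ∀ a, ContDiffOn ℝ ∞ (fun z => ψ z a) V) (hm : Set.MapsTo ψ V U) :
    ContDiffOn ℝ ∞ (fun z => f (ψ z)) V :=
  hf.comp ((contDiffOn_euclidean).2 hψ) hm

theorem mpd_comp {ι κ : Type*} (c : Fin 4) {M : R4 → Matrix ι κ ℝ} {ψ : R4 → R4}
    (hU : IsOpen U) (hV : IsOpen V) (hM : MSmooth U M)
    (hψ : ∀ a, ContDiffOn ℝ ∞ (fun z => ψ z a) V) (hm : Set.MapsTo ψ V U) (hy : y ∈ V) :
    mpd c (fun z => M (ψ z)) y = ∑ a, jacobian ψ y a c • mpd a M (ψ y) := by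
  ext i j
  simp only [mpd, Matrix.of_apply, Matrix.sum_apply, Matrix.smul_apply, smul_eq_mul]
  exact pd_comp c (hM.diff hU (hm hy) i j) fun a => (hψ a).differentiableAt_of_isOpen hV hy

/-- The Ricci tensor is a tensor. -/
theorem MetricOn.ricci_pullback {G G' : R4 → Matrix (Fin 4) (Fin 4) ℝ} (h : MetricOn G U)
    (h' : MetricOn G' V) {ψ : R4 → R4} (hψ : ∀ a, ContDiffOn ℝ ∞ (fun z => ψ z a) V)
    (hm : Set.MapsTo ψ V U)
    (hG : ∀ y ∈ V, G' y = (jacobian ψ y).transpose * G (ψ y) * jacobian ψ y) (hy : y ∈ V) :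
    ricci G' y = (jacobian ψ y).transpose * ricci G (ψ y) * jacobian ψ y := by
  have hV := h'.isOpen
  have hU := h.isOpen
  have hJs : MSmooth V (jacobian ψ) := jacobian_smooth hV hψ
  have hJd : ∀ y ∈ V, (jacobian ψ y).det ≠ 0 := fun y hy h0 => h'.det y hy (by
    rw [hG y hy, Matrix.det_mul, h0, mul_zero])
  have hJr : ∀ y ∈ V, jacobian ψ y * (jacobian ψ y)⁻¹ = 1 := fun y hy =>
    Matrix.mul_nonsing_inv _ (isUnit_iff_ne_zero.2 (hJd y hy))
  have hJl : ∀ y ∈ V, (jacobian ψ y)⁻¹ * jacobian ψ y = 1 := fun y hy =>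
    Matrix.nonsing_inv_mul _ (isUnit_iff_ne_zero.2 (hJd y hy))
  -- The connection pulled back along `ψ`, still expressed in the old coordinate frame. The Jacobian
  -- is then the gauge transformation to the new frame.
  set P : Fin 4 → R4 → Matrix (Fin 4) (Fin 4) ℝ := fun c y =>
    ∑ d, jacobian ψ y d c • conn G d (ψ y) with hP
  have hAs : ∀ d, MSmooth V fun z => conn G d (ψ z) := fun d i j =>
    contDiffOn_comp_of_coord (h.conn_smooth d i j) hψ hm
  have hPs : ∀ c, MSmooth V (P c) := fun c =>
    MSmooth.sum _ fun d => MSmooth.smul (hJs d c) (hAs d)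
  have hJsym : ∀ y ∈ V, ∀ a b c, mpd c (jacobian ψ) y a b = mpd b (jacobian ψ) y a c :=
    fun y hy a b c => pd_comm c b hV (hψ a) hy
  -- the pulled back connection
  have hconn : ∀ y ∈ V, ∀ c, jacobian ψ y * conn G' c y
      = mpd c (jacobian ψ) y + P c y * jacobian ψ y := by
    intro y hy c
    -- The transformed connection is torsion-free, since second derivatives of `ψ` commute, and
    -- metric; uniqueness identifies it with the Levi-Civita connection of `G'`.
    have huniq := h'.conn_unique hy
      (B := fun c => (jacobian ψ y)⁻¹ * (mpd c (jacobian ψ) y + P c y * jacobian ψ y)) ?_ ?_ c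
    · rw [← huniq, ← mul_assoc, hJr y hy, one_mul]
    · intro a b c
      have e : ∀ a, (mpd c (jacobian ψ) y + P c y * jacobian ψ y) a b
          = (mpd b (jacobian ψ) y + P b y * jacobian ψ y) a c := by
        intro a
        rw [Matrix.add_apply, Matrix.add_apply, hJsym y hy a b c]
        congr 1
        simp only [hP, Finset.sum_mul, Matrix.sum_apply, Matrix.smul_apply,
          Matrix.mul_apply, smul_eq_mul]
        rw [Finset.sum_comm]
        refine Finset.sum_congr rfl fun d _ => Finset.sum_congr rfl fun e _ => ?_
        rw [h.conn_swap (hm hy) a d e]; ring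
      simp only [Matrix.mul_apply (M := (jacobian ψ y)⁻¹), e]
    · intro c
      have hJB : ∀ c, jacobian ψ y * ((jacobian ψ y)⁻¹
          * (mpd c (jacobian ψ) y + P c y * jacobian ψ y))
          = mpd c (jacobian ψ) y + P c y * jacobian ψ y := fun c => by
        rw [← mul_assoc, hJr y hy, one_mul]
      have hGP : ∑ a, jacobian ψ y a c • mpd a G (ψ y)
          = G (ψ y) * P c y + (P c y).transpose * G (ψ y) := by
        simp only [hP, Finset.mul_sum, Matrix.transpose_sum, Finset.sum_mul,
          ← Finset.sum_add_distrib, h.mpd_eq (hm hy), smul_add, Matrix.transpose_smul,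
          Matrix.mul_smul, Matrix.smul_mul]
      have hGs : MSmooth V fun z => G (ψ z) := fun i j =>
        contDiffOn_comp_of_coord (h.smooth i j) hψ hm
      rw [mpd_congr c hV hG hy, mpd_mul c hV (hJs.transpose.mul hGs) hJs hy,
        mpd_mul c hV hJs.transpose hGs hy, mpd_transpose, mpd_comp c hU hV h.smooth hψ hm hy,
        hGP, hG y hy]
      have e1 : (jacobian ψ y).transpose * G (ψ y) * jacobian ψ y * ((jacobian ψ y)⁻¹
          * (mpd c (jacobian ψ) y + P c y * jacobian ψ y))
          = (jacobian ψ y).transpose * G (ψ y)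
            * (mpd c (jacobian ψ) y + P c y * jacobian ψ y) := by
        rw [mul_assoc, hJB]
      have e2 : ((jacobian ψ y)⁻¹ * (mpd c (jacobian ψ) y + P c y * jacobian ψ y)).transpose
          * ((jacobian ψ y).transpose * G (ψ y) * jacobian ψ y)
          = (mpd c (jacobian ψ) y + P c y * jacobian ψ y).transpose * G (ψ y) * jacobian ψ y := by
        rw [← mul_assoc, ← mul_assoc, ← Matrix.transpose_mul, hJB]
      rw [e1, e2, Matrix.transpose_add, Matrix.transpose_mul]
      noncomm_ring
  have hg := fun c d => curvM_gauge hV hPs h'.conn_smooth hJs hconn hy c d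
  -- the curvature of the pulled back connection
  have hcurv : ∀ c d, curvM P c d y
      = ∑ e, ∑ f, (jacobian ψ y e c * jacobian ψ y f d) • curvM (conn G) e f (ψ y) := by
    intro c d
    have hmp : ∀ c d, mpd c (P d) y = ∑ e, mpd c (jacobian ψ) y e d • conn G e (ψ y)
        + ∑ e, ∑ f, (jacobian ψ y e c * jacobian ψ y f d) • mpd e (conn G f) (ψ y) := by
      intro c d
      rw [mpd_sum c _ hV (fun e => MSmooth.smul (hJs e d) (hAs e)) hy]
      have e1 : ∀ e, mpd c (fun y => jacobian ψ y e d • conn G e (ψ y)) y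
          = mpd c (jacobian ψ) y e d • conn G e (ψ y)
            + ∑ f, (jacobian ψ y f c * jacobian ψ y e d) • mpd f (conn G e) (ψ y) := by
        intro e
        rw [mpd_smul c hV (hJs e d) (hAs e) hy, mpd_comp c hU hV (h.conn_smooth e) hψ hm hy,
          Finset.smul_sum]
        simp only [smul_smul]
        congr 1
        exact Finset.sum_congr rfl fun f _ => by rw [mul_comm]
      simp only [e1, Finset.sum_add_distrib]
      rw [Finset.sum_comm]
    have hPP : ∀ c d, P c y * P d y = ∑ e, ∑ f, (jacobian ψ y e c * jacobian ψ y f d)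
        • (conn G e (ψ y) * conn G f (ψ y)) := by
      intro c d
      simp only [hP, Finset.sum_mul, Finset.mul_sum, Matrix.smul_mul, Matrix.mul_smul, smul_smul]
      rw [Finset.sum_comm]
      exact Finset.sum_congr rfl fun e _ => Finset.sum_congr rfl fun f _ => by
        rw [mul_comm]
    simp only [curvM, hmp, hPP, hJsym y hy _ d c, smul_add, smul_sub, Finset.sum_add_distrib,
      Finset.sum_sub_distrib]
    rw [Finset.sum_comm (f := fun e f => (jacobian ψ y e d * jacobian ψ y f c)
        • mpd e (conn G f) (ψ y)),
      Finset.sum_comm (f := fun e f => (jacobian ψ y e d * jacobian ψ y f c)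
        • (conn G e (ψ y) * conn G f (ψ y)))]
    simp only [mul_comm (jacobian ψ y _ d)]
    abel
  have hR : ∀ c d, curvM (conn G') c d y = (jacobian ψ y)⁻¹ * (∑ e, ∑ f,
      (jacobian ψ y e c * jacobian ψ y f d) • curvM (conn G) e f (ψ y)) * jacobian ψ y := by
    intro c d
    rw [← hcurv, mul_assoc, ← hg, ← mul_assoc, hJl y hy, one_mul]
  ext b d
  rw [ricci_apply]
  have hdel : ∀ e k, ∑ a, jacobian ψ y e a * (jacobian ψ y)⁻¹ a k = if e = k then 1 else 0 := by
    intro e k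
    rw [← Matrix.mul_apply, hJr y hy, Matrix.one_apply]
  have e1 : ∀ a, curvM (conn G') a d y a b = ∑ k, ∑ e, (jacobian ψ y e a * (jacobian ψ y)⁻¹ a k)
      * ∑ f, jacobian ψ y f d * (curvM (conn G) e f (ψ y) * jacobian ψ y) k b := by
    intro a
    rw [hR, mul_assoc, Matrix.mul_apply]
    refine Finset.sum_congr rfl fun k _ => ?_
    rw [Finset.sum_mul, Matrix.sum_apply, Finset.mul_sum]
    refine Finset.sum_congr rfl fun e _ => ?_
    rw [Finset.sum_mul, Matrix.sum_apply, Finset.mul_sum, Finset.mul_sum]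
    refine Finset.sum_congr rfl fun f _ => ?_
    rw [Matrix.smul_mul, Matrix.smul_apply, smul_eq_mul]; ring
  simp only [e1]
  rw [Finset.sum_comm]
  simp only [fun k => Finset.sum_comm (s := Finset.univ) (t := Finset.univ)
    (f := fun a e => (jacobian ψ y e a * (jacobian ψ y)⁻¹ a k)
      * ∑ f, jacobian ψ y f d * (curvM (conn G) e f (ψ y) * jacobian ψ y) k b),
    ← Finset.sum_mul, hdel, ite_mul, one_mul, zero_mul, Finset.sum_ite_eq', Finset.mem_univ,
    if_true]
  simp only [Matrix.mul_apply, ricci_apply, Matrix.transpose_apply, Finset.sum_mul, Finset.mul_sum]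
  rw [Finset.sum_comm]
  refine Finset.sum_congr rfl fun f _ => ?_
  rw [Finset.sum_comm]
  refine Finset.sum_congr rfl fun p _ => Finset.sum_congr rfl fun e _ => ?_
  ring

end Transformation

/-! ### Codazzi Ricci tensors with two double eigenvalues -/

section Codazzi

variable {G : R4 → Matrix (Fin 4) (Fin 4) ℝ} {U : Set R4} {x : R4}

/-- On `U` the Ricci tensor of the metric `G` is a Codazzi tensor with two distinct double
eigenvalues, the first of which has a timelike eigenvector. -/
structure IsCodazziPair (G : R4 → Matrix (Fin 4) (Fin 4) ℝ) (U : Set R4) : Prop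
    extends MetricOn G U where
  codazzi : ∀ x ∈ U, ∀ a b c, covM G (ricci G) a x b c = covM G (ricci G) b x a c
  tetrad : ∀ x ∈ U, ∃ E ρ₁ ρ₂, ρ₁ ≠ ρ₂ ∧ IsEigenTetrad (G x) (ricci G x) E ρ₁ ρ₂

/-- The product of the two eigenvalues of the Ricci tensor, as a function. -/
def eigProd (G : R4 → Matrix (Fin 4) (Fin 4) ℝ) (x : R4) : ℝ :=
  (((G x)⁻¹ * ricci G x).trace ^ 2 / 2
    - ((G x)⁻¹ * (ricci G x * (G x)⁻¹ * ricci G x)).trace) / 4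

theorem trace_contDiffOn {M : R4 → Matrix (Fin 4) (Fin 4) ℝ} (hM : MSmooth U M) :
    ContDiffOn ℝ ∞ (fun x => (M x).trace) U :=
  ContDiffOn.sum fun i _ => hM i i

theorem MetricOn.eigProd_smooth (h : MetricOn G U) : ContDiffOn ℝ ∞ (eigProd G) U :=
  ((((trace_contDiffOn (h.inv_smooth.mul h.ricci_smooth)).pow 2).div_const 2).sub
    (trace_contDiffOn (h.inv_smooth.mul
      ((h.ricci_smooth.mul h.inv_smooth).mul h.ricci_smooth)))).div_const 4

theorem MetricOn.scalarCurv_smooth (h : MetricOn G U) : ContDiffOn ℝ ∞ (scalarCurv G) U :=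
  (trace_contDiffOn (h.inv_smooth.mul h.ricci_smooth)).congr fun _ hx => h.scalarCurv_eq_trace hx

/-- The coefficients are smooth functions defined without eigenvectors, so the equation can be
differentiated before any smooth tetrad is known. -/
theorem IsCodazziPair.quadratic (h : IsCodazziPair G U) (hx : x ∈ U) :
    ricci G x * (G x)⁻¹ * ricci G x
      = (scalarCurv G x / 2) • ricci G x - eigProd G x • G x := by
  obtain ⟨E, ρ₁, ρ₂, -, hE⟩ := h.tetrad x hx
  rw [eigProd, ← hE.prod_eq, h.scalarCurv_eq_trace hx, hE.trace_eq, hE.quadratic,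
    mul_div_cancel_left₀ _ (two_ne_zero' ℝ)]

/-- Differentiation of the quadratic equation satisfied by the Ricci tensor. -/
theorem IsCodazziPair.deriv_quadratic (h : IsCodazziPair G U) (hx : x ∈ U) (c : Fin 4) :
    covM G (ricci G) c x * (G x)⁻¹ * ricci G x + ricci G x * (G x)⁻¹ * covM G (ricci G) c x
      = (scalarCurv G x / 2) • covM G (ricci G) c x - pd c (eigProd G) x • G x := by
  have hU := h.isOpen
  have h0 := mpd_congr c hU (fun y hy => h.quadratic hy) hx
  have hs : pd c (fun y => scalarCurv G y / 2) x = 0 := by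
    simp only [div_eq_inv_mul]
    rw [pd_const_mul c _ (h.scalarCurv_smooth.differentiableAt_of_isOpen hU hx),
      h.pd_scalarCurv_eq_zero hx (h.codazzi x hx), mul_zero]
  rw [mpd_mul c hU (h.ricci_smooth.mul h.inv_smooth) h.ricci_smooth hx,
    mpd_mul c hU h.ricci_smooth h.inv_smooth hx,
    mpd_sub c hU (MSmooth.smul (h.scalarCurv_smooth.div_const 2) h.ricci_smooth)
      (MSmooth.smul h.eigProd_smooth h.smooth) hx,
    mpd_smul c hU (h.scalarCurv_smooth.div_const 2) h.ricci_smooth hx,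
    mpd_smul c hU h.eigProd_smooth h.smooth hx, hs, h.mpd_inv hx, h.mpd_eq hx, zero_smul,
    zero_add] at h0
  have e : mpd c (ricci G) x = covM G (ricci G) c x
      + ((conn G c x).transpose * ricci G x + ricci G x * conn G c x) := by
    simp only [covM]; abel
  rw [e] at h0
  -- The connection terms reproduce the quadratic expression multiplied by the connection on either
  -- side, so the undifferentiated equation removes them.
  have h1 : (conn G c x).transpose * (ricci G x * (G x)⁻¹ * ricci G x)
      = (conn G c x).transpose * ((scalarCurv G x / 2) • ricci G x - eigProd G x • G x) := by
    rw [h.quadratic hx]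
  have h2 : (ricci G x * (G x)⁻¹ * ricci G x) * conn G c x
      = ((scalarCurv G x / 2) • ricci G x - eigProd G x • G x) * conn G c x := by
    rw [h.quadratic hx]
  have h3 : covM G (ricci G) c x * (G x)⁻¹ * ricci G x
      + ricci G x * (G x)⁻¹ * covM G (ricci G) c x
      + (conn G c x).transpose * (ricci G x * (G x)⁻¹ * ricci G x)
      + (ricci G x * (G x)⁻¹ * ricci G x) * conn G c x
      = (scalarCurv G x / 2) • (covM G (ricci G) c x
        + ((conn G c x).transpose * ricci G x + ricci G x * conn G c x))
        - (pd c (eigProd G) x • G x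
          + eigProd G x • (G x * conn G c x + (conn G c x).transpose * G x)) := by
    rw [← h0]; noncomm_ring
  rw [h1, h2] at h3
  simp only [mul_sub, sub_mul, Matrix.mul_smul, Matrix.smul_mul, smul_add] at h3
  rw [← sub_eq_zero] at h3 ⊢
  rw [← h3]
  abel

/-- A totally symmetric 3-tensor `σ` with `(d_i + d_j - ρ₁ - ρ₂) σ_{kij} = - q_k η_{ij}` vanishes,
and so does `q`. -/
theorem symm_tensor_eq_zero {ρ₁ ρ₂ : ℝ} (hne : ρ₁ ≠ ρ₂) {σ : Fin 4 → Matrix (Fin 4) (Fin 4) ℝ}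
    {q : Fin 4 → ℝ} (h12 : ∀ k i j, σ k i j = σ i k j) (h23 : ∀ k i j, σ k i j = σ k j i)
    (h : ∀ k, σ k * eigDiag ρ₁ ρ₂ + eigDiag ρ₁ ρ₂ * σ k
      = (ρ₁ + ρ₂) • σ k - q k • minkowski) : (∀ k, σ k = 0) ∧ ∀ k, q k = 0 := by
  have he : ∀ k i j, σ k i j * (![ρ₁, ρ₁, ρ₂, ρ₂] i + ![ρ₁, ρ₁, ρ₂, ρ₂] j - ρ₁ - ρ₂)
      = - q k * minkowski i j := by
    intro k i j
    have := congrFun (congrFun (h k) i) j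
    simp only [eigDiag, Matrix.add_apply, Matrix.sub_apply, Matrix.smul_apply,
      Matrix.mul_diagonal, Matrix.diagonal_mul, smul_eq_mul] at this
    linarith
  have hd : ρ₁ - ρ₂ ≠ 0 := sub_ne_zero.2 hne
  have z01 : ∀ k, σ k 0 1 = 0 := fun k => by
    have := he k 0 1
    simp [minkowski] at this
    rcases this with h | h
    · exact h
    · exact absurd (by linarith) hd
  have z23 : ∀ k, σ k 2 3 = 0 := fun k => by
    have := he k 2 3
    simp [minkowski] at this
    rcases this with h | h
    · exact h
    · exact absurd (by linarith) hd
  -- Total symmetry turns a vanishing off-diagonal entry into a diagonal one: `σ 0 1 1 = σ 1 0 1 =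
  -- 0`, and the equation for `σ 0 1 1` then reads `q 0 = 0`. The other three are similar.
  have hq : ∀ k, q k = 0 := by
    intro k
    fin_cases k
    · have := he 0 1 1
      rw [h12, z01] at this
      simpa [minkowski] using this.symm
    · have := he 1 0 0
      rw [h12, h23, z01] at this
      simpa [minkowski] using this.symm
    · have := he 2 3 3
      rw [h12, z23] at this
      simpa [minkowski] using this.symm
    · have := he 3 2 2
      rw [h12, h23, z23] at this
      simpa [minkowski] using this.symm
  refine ⟨fun k => ?_, hq⟩
  have hz : ∀ k i j, ![ρ₁, ρ₁, ρ₂, ρ₂] i + ![ρ₁, ρ₁, ρ₂, ρ₂] j - ρ₁ - ρ₂ ≠ 0 → σ k i j = 0 := by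
    intro k i j hn
    have := he k i j
    rw [hq, neg_zero, zero_mul] at this
    exact (mul_eq_zero.1 this).resolve_right hn
  have n11 : ρ₁ + ρ₁ - ρ₁ - ρ₂ ≠ 0 := fun h => hd (by linarith)
  have n22 : ρ₂ + ρ₂ - ρ₁ - ρ₂ ≠ 0 := fun h => hd (by linarith)
  have hb : ∀ i : Fin 4, ![ρ₁, ρ₁, ρ₂, ρ₂] i = ρ₁ ∨ ![ρ₁, ρ₁, ρ₂, ρ₂] i = ρ₂ := by
    intro i; fin_cases i <;> simp
  ext i j
  -- Two of the three indices lie in the same plane. Symmetry moves them to the last two slots,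
  -- where the factor is `±(ρ₁ - ρ₂)`.
  rcases hb i with hi | hi <;> rcases hb j with hj | hj
  · exact hz k i j (by rw [hi, hj]; exact n11)
  · rcases hb k with hk | hk
    · rw [h23, h12]
      exact hz _ _ _ (by rw [hk, hi]; exact n11)
    · rw [h12]
      exact hz _ _ _ (by rw [hk, hj]; exact n22)
  · rcases hb k with hk | hk
    · rw [h12]
      exact hz _ _ _ (by rw [hk, hj]; exact n11)
    · rw [h23, h12]
      exact hz _ _ _ (by rw [hk, hi]; exact n22)
  · exact hz k i j (by rw [hi, hj]; exact n22)

/-- The Ricci tensor is parallel. -/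
theorem IsCodazziPair.covM_ricci (h : IsCodazziPair G U) (hx : x ∈ U) :
    (∀ c, covM G (ricci G) c x = 0) ∧ ∀ c, pd c (eigProd G) x = 0 := by
  obtain ⟨E, ρ₁, ρ₂, hne, hE⟩ := h.tetrad x hx
  set T := fun c => covM G (ricci G) c x with hT
  -- The differentiated quadratic equation in tetrad components. The index `c` of the derivative is
  -- still a coordinate index.
  have hTe : ∀ c, (E.transpose * T c * E) * eigDiag ρ₁ ρ₂ + eigDiag ρ₁ ρ₂ * (E.transpose * T c * E)
      = (ρ₁ + ρ₂) • (E.transpose * T c * E) - pd c (eigProd G) x • minkowski := by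
    intro c
    have h1 := h.deriv_quadratic hx c
    rw [h.scalarCurv_eq_trace hx, hE.trace_eq, mul_div_cancel_left₀ _ (two_ne_zero' ℝ)] at h1
    have h2 : E.transpose * (T c * (G x)⁻¹ * ricci G x + ricci G x * (G x)⁻¹ * T c) * E
        = E.transpose * ((ρ₁ + ρ₂) • T c - pd c (eigProd G) x • G x) * E := by rw [← h1]
    have e1 : E.transpose * (T c * (G x)⁻¹ * ricci G x) * E
        = (E.transpose * T c * E) * (minkowski * (E.transpose * ricci G x * E)) := by
      rw [hE.inv_eq]; simp only [mul_assoc]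
    have e2 : E.transpose * (ricci G x * (G x)⁻¹ * T c) * E
        = (E.transpose * ricci G x * E * minkowski) * (E.transpose * T c * E) := by
      rw [hE.inv_eq]; simp only [mul_assoc]
    rw [mul_add, add_mul, e1, e2, hE.conj_eq, ← mul_assoc minkowski, minkowski_mul_self, one_mul,
      minkowski_mul_eigDiag, mul_assoc (eigDiag ρ₁ ρ₂), minkowski_mul_self, mul_one, mul_sub,
      sub_mul, Matrix.mul_smul, Matrix.mul_smul, Matrix.smul_mul, Matrix.smul_mul,
      hE.orthonormal] at h2
    exact h2
  -- The derivative index is referred to the tetrad as well, so that the Codazzi condition becomes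
  -- total symmetry of the components.
  have key := symm_tensor_eq_zero hne (σ := fun k => ∑ c, E c k • (E.transpose * T c * E))
    (q := fun k => ∑ c, E c k * pd c (eigProd G) x) ?_ ?_ ?_
  · obtain ⟨k1, k2⟩ := key
    have hinv : ∀ c d, ∑ k, E c k * (minkowski * E.transpose * G x) k d
        = if c = d then 1 else 0 := fun c d => by
      rw [← Matrix.mul_apply, hE.right_inv, Matrix.one_apply]
    constructor
    · intro d
      apply hE.eq_of_conj
      have h1 : ∑ k, (minkowski * E.transpose * G x) k d
          • ∑ c, E c k • (E.transpose * T c * E) = 0 :=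
        Finset.sum_eq_zero fun k _ => by rw [k1 k, smul_zero]
      simp only [Finset.smul_sum, smul_smul] at h1
      rw [Finset.sum_comm] at h1
      simp only [← Finset.sum_smul, mul_comm ((minkowski * E.transpose * G x) _ d), hinv, ite_smul,
        one_smul, zero_smul, Finset.sum_ite_eq', Finset.mem_univ, if_true] at h1
      rw [h1]; simp
    · intro d
      have h1 : ∑ k, (minkowski * E.transpose * G x) k d
          * ∑ c, E c k * pd c (eigProd G) x = 0 :=
        Finset.sum_eq_zero fun k _ => by rw [k2 k, mul_zero]
      simp only [Finset.mul_sum, ← mul_assoc] at h1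
      rw [Finset.sum_comm] at h1
      simp only [← Finset.sum_mul, mul_comm ((minkowski * E.transpose * G x) _ d), hinv, ite_mul,
        one_mul, zero_mul, Finset.sum_ite_eq', Finset.mem_univ, if_true] at h1
      exact h1
  · intro k i j
    simp only [Matrix.sum_apply, Matrix.smul_apply, smul_eq_mul, Matrix.mul_apply,
      Matrix.transpose_apply, Finset.mul_sum, Finset.sum_mul]
    refine Finset.sum_comm.trans (Eq.trans ?_ Finset.sum_comm)
    refine Finset.sum_congr rfl fun b _ => ?_
    rw [Finset.sum_comm]
    refine Finset.sum_congr rfl fun c _ => Finset.sum_congr rfl fun d _ => ?_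
    have hc : T d c b = T c d b := h.codazzi x hx d c b
    rw [hc]; ring
  · intro k i j
    have hs : ∀ c, (E.transpose * T c * E).transpose = E.transpose * T c * E := fun c => by
      rw [Matrix.transpose_mul, Matrix.transpose_mul, Matrix.transpose_transpose,
        h.covM_ricci_symm hx, mul_assoc]
    simp only [Matrix.sum_apply, Matrix.smul_apply]
    refine Finset.sum_congr rfl fun c _ => ?_
    conv_lhs => rw [← hs c]
    rfl
  · intro k
    simp only [Finset.sum_mul, Finset.mul_sum, Matrix.smul_mul, Matrix.mul_smul,
      ← Finset.sum_add_distrib, ← smul_add, hTe]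
    simp only [smul_sub, Finset.sum_sub_distrib, Finset.smul_sum, Finset.sum_smul, smul_smul,
      mul_comm (ρ₁ + ρ₂)]

theorem eq_of_pd_eq_zero {f : R4 → ℝ} {x₀ : R4} {ε : ℝ}
    (hf : ContDiffOn ℝ ∞ f (Metric.ball x₀ ε))
    (h : ∀ x ∈ Metric.ball x₀ ε, ∀ c, pd c f x = 0) (hx : x ∈ Metric.ball x₀ ε) :
    f x = f x₀ := by
  have hb : x₀ ∈ Metric.ball x₀ ε := Metric.mem_ball_self (Metric.pos_of_mem_ball hx)
  refine (convex_ball x₀ ε).is_const_of_fderivWithin_eq_zero (𝕜 := ℝ)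
    (hf.differentiableOn (by simp)) (fun y hy => ?_) hx hb
  rw [fderivWithin_of_isOpen Metric.isOpen_ball hy]
  ext v
  rw [fderiv_eq_sum_pd]
  simp [h y hy]

end Codazzi

/-! ### Smooth eigenvector tetrads -/

section Frame

variable {G : R4 → Matrix (Fin 4) (Fin 4) ℝ} {U : Set R4} {x : R4}

/-- The Gram-Schmidt matrix, within the blocks `{0, 1}` and `{2, 3}`, of a Gram matrix `M`. -/
def gramSchmidtBlock (M : Matrix (Fin 4) (Fin 4) ℝ) : Matrix (Fin 4) (Fin 4) ℝ :=
  !![(√(-M 0 0))⁻¹, -(M 0 1 / M 0 0) * (√(M 1 1 - M 0 1 ^ 2 / M 0 0))⁻¹, 0, 0;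
     0, (√(M 1 1 - M 0 1 ^ 2 / M 0 0))⁻¹, 0, 0;
     0, 0, (√(M 2 2))⁻¹, -(M 2 3 / M 2 2) * (√(M 3 3 - M 2 3 ^ 2 / M 2 2))⁻¹;
     0, 0, 0, (√(M 3 3 - M 2 3 ^ 2 / M 2 2))⁻¹]

/-- The sign conditions on `M` under which `gramSchmidtBlock` works. -/
def GramPos (M : Matrix (Fin 4) (Fin 4) ℝ) : Prop :=
  0 < - M 0 0 ∧ 0 < M 1 1 - M 0 1 ^ 2 / M 0 0 ∧ 0 < M 2 2 ∧ 0 < M 3 3 - M 2 3 ^ 2 / M 2 2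

/-- Gram–Schmidt in each plane separately, which suffices as `M` does not couple the planes. The
first vector is timelike, hence the root of `-M 0 0`. -/
theorem gramSchmidtBlock_spec {M : Matrix (Fin 4) (Fin 4) ℝ} (hM : GramPos M)
    (hs : M.transpose = M) (h02 : M 0 2 = 0) (h03 : M 0 3 = 0) (h12 : M 1 2 = 0)
    (h13 : M 1 3 = 0) :
    (gramSchmidtBlock M).transpose * M * gramSchmidtBlock M = minkowski := by
  obtain ⟨p0, p1, p2, p3⟩ := hM
  have hs' : ∀ i j, M i j = M j i := fun i j => congrFun (congrFun hs j) i
  have q : ∀ {a : ℝ}, 0 < a → a * (√a)⁻¹ ^ 2 = 1 := fun {a} ha => by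
    rw [inv_pow, Real.sq_sqrt ha.le, mul_inv_cancel₀ ha.ne']
  have q0 := q p0
  have q1 := q p1
  have q2 := q p2
  have q3 := q p3
  have n0 : M 0 0 ≠ 0 := fun h => by rw [h] at p0; simp at p0
  have n2 : M 2 2 ≠ 0 := p2.ne'
  have r0 : M 0 1 / M 0 0 * M 0 0 = M 0 1 := div_mul_cancel₀ _ n0
  have r2 : M 2 3 / M 2 2 * M 2 2 = M 2 3 := div_mul_cancel₀ _ n2
  have e0 : M 0 1 ^ 2 / M 0 0 = M 0 1 / M 0 0 * M 0 1 := by ring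
  have e2 : M 2 3 ^ 2 / M 2 2 = M 2 3 / M 2 2 * M 2 3 := by ring
  rw [e0] at q1
  rw [e2] at q3
  simp only [gramSchmidtBlock, e0, e2]
  -- Once the roots and quotients are free variables, the relations `q0`–`q3`, `r0`, `r2` make each
  -- entry a polynomial identity.
  generalize (√(-M 0 0))⁻¹ = c0 at *
  generalize (√(M 1 1 - M 0 1 / M 0 0 * M 0 1))⁻¹ = c1 at *
  generalize (√(M 2 2))⁻¹ = c2 at *
  generalize (√(M 3 3 - M 2 3 / M 2 2 * M 2 3))⁻¹ = c3 at *
  generalize M 0 1 / M 0 0 = s0 at *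
  generalize M 2 3 / M 2 2 = s2 at *
  ext i j
  simp only [Matrix.mul_apply, Fin.sum_univ_four, Matrix.transpose_apply]
  fin_cases i <;> fin_cases j <;>
    simp [minkowski, hs' 1 0, hs' 2 0, hs' 3 0, hs' 2 1, hs' 3 1, hs' 3 2, h02, h03, h12, h13]
  · linear_combination -q0
  · linear_combination (-c0 * c1) * r0
  · exact Or.inl (by linear_combination (-c1) * r0)
  · linear_combination q1 + c1 ^ 2 * s0 * r0
  · linear_combination q2
  · linear_combination (-c2 * c3) * r2
  · exact Or.inl (by linear_combination (-c3) * r2)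
  · linear_combination q3 + c3 ^ 2 * s2 * r2

/-- Orthonormalising does not mix the two eigenspaces, so eigenvectors remain eigenvectors. -/
theorem gramSchmidtBlock_comm (M : Matrix (Fin 4) (Fin 4) ℝ) (a b : ℝ) :
    gramSchmidtBlock M * eigDiag a b = eigDiag a b * gramSchmidtBlock M := by
  ext i j
  rw [eigDiag, Matrix.mul_diagonal, Matrix.diagonal_mul]
  fin_cases i <;> fin_cases j <;> simp [gramSchmidtBlock, mul_comm]

theorem gramSchmidtBlock_smooth {M : R4 → Matrix (Fin 4) (Fin 4) ℝ} (hM : MSmooth U M)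
    (hp : ∀ x ∈ U, GramPos (M x)) : MSmooth U fun x => gramSchmidtBlock (M x) := by
  have n0 : ∀ x ∈ U, M x 0 0 ≠ 0 := fun x hx h => by
    have := (hp x hx).1; rw [h] at this; simp at this
  have n2 : ∀ x ∈ U, M x 2 2 ≠ 0 := fun x hx => (hp x hx).2.2.1.ne'
  have s0 : ContDiffOn ℝ ∞ (fun x => (√(-M x 0 0))⁻¹) U :=
    ((hM 0 0).neg.sqrt fun x hx => (hp x hx).1.ne').inv fun x hx =>
      (Real.sqrt_pos.2 (hp x hx).1).ne'
  have s1 : ContDiffOn ℝ ∞ (fun x => (√(M x 1 1 - M x 0 1 ^ 2 / M x 0 0))⁻¹) U :=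
    (((hM 1 1).sub (((hM 0 1).pow 2).div (hM 0 0) n0)).sqrt fun x hx =>
      (hp x hx).2.1.ne').inv fun x hx => (Real.sqrt_pos.2 (hp x hx).2.1).ne'
  have s2 : ContDiffOn ℝ ∞ (fun x => (√(M x 2 2))⁻¹) U :=
    ((hM 2 2).sqrt n2).inv fun x hx => (Real.sqrt_pos.2 (hp x hx).2.2.1).ne'
  have s3 : ContDiffOn ℝ ∞ (fun x => (√(M x 3 3 - M x 2 3 ^ 2 / M x 2 2))⁻¹) U :=
    (((hM 3 3).sub (((hM 2 3).pow 2).div (hM 2 2) n2)).sqrt fun x hx =>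
      (hp x hx).2.2.2.ne').inv fun x hx => (Real.sqrt_pos.2 (hp x hx).2.2.2).ne'
  intro i j
  fin_cases i <;> fin_cases j <;> simp only [gramSchmidtBlock] <;>
    first
      | exact contDiffOn_const
      | exact s0
      | exact s1
      | exact s2
      | exact s3
      | exact (((hM 0 1).div (hM 0 0) n0).neg).mul s1
      | exact (((hM 2 3).div (hM 2 2) n2).neg).mul s3

/-- Near each point there is a smooth tetrad of eigenvectors, with constant eigenvalues. -/
theorem IsCodazziPair.exists_frame (h : IsCodazziPair G U) {x₀ : R4} (hx₀ : x₀ ∈ U)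
    {E₀ : Matrix (Fin 4) (Fin 4) ℝ} {ρ₁ ρ₂ : ℝ} (hne : ρ₁ ≠ ρ₂)
    (hE₀ : IsEigenTetrad (G x₀) (ricci G x₀) E₀ ρ₁ ρ₂) :
    ∃ ε > 0, Metric.ball x₀ ε ⊆ U ∧ ∃ E : R4 → Matrix (Fin 4) (Fin 4) ℝ,
      MSmooth (Metric.ball x₀ ε) E ∧
      ∀ x ∈ Metric.ball x₀ ε, IsEigenTetrad (G x) (ricci G x) (E x) ρ₁ ρ₂ := by
  obtain ⟨ε, hε, hεU⟩ := Metric.isOpen_iff.1 h.isOpen x₀ hx₀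
  have hB : IsOpen (Metric.ball x₀ ε) := Metric.isOpen_ball
  have hd : ρ₁ - ρ₂ ≠ 0 := sub_ne_zero.2 hne
  -- the quadratic equation with constant coefficients
  have hquad : ∀ x ∈ Metric.ball x₀ ε, ricci G x * (G x)⁻¹ * ricci G x
      = (ρ₁ + ρ₂) • ricci G x - (ρ₁ * ρ₂) • G x := by
    intro x hx
    have h1 : scalarCurv G x = scalarCurv G x₀ :=
      eq_of_pd_eq_zero (h.scalarCurv_smooth.mono hεU)
        (fun y hy c => h.pd_scalarCurv_eq_zero (hεU hy) (h.codazzi y (hεU hy)) c) hx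
    have h2 : eigProd G x = eigProd G x₀ :=
      eq_of_pd_eq_zero (h.eigProd_smooth.mono hεU)
        (fun y hy c => (h.covM_ricci (hεU hy)).2 c) hx
    rw [h.quadratic (hεU hx), h1, h2, h.scalarCurv_eq_trace hx₀, hE₀.trace_eq,
      mul_div_cancel_left₀ _ (two_ne_zero' ℝ), eigProd, ← hE₀.prod_eq]
  -- The spectral projector onto the `ρ₁`-eigenspace. It is affine in the mixed Ricci tensor with
  -- constant coefficients, hence smooth.
  set P : R4 → Matrix (Fin 4) (Fin 4) ℝ := fun x =>
    (ρ₁ - ρ₂)⁻¹ • ((G x)⁻¹ * ricci G x - ρ₂ • (1 : Matrix (Fin 4) (Fin 4) ℝ)) with hP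
  have hPs : MSmooth (Metric.ball x₀ ε) P :=
    MSmooth.smul contDiffOn_const (((h.inv_smooth.mul h.ricci_smooth).mono hεU).sub
      (MSmooth.const _))
  have hHR : ∀ x, (G x)⁻¹ * ricci G x = ρ₂ • 1 + (ρ₁ - ρ₂) • P x := by
    intro x
    rw [hP, smul_smul, mul_inv_cancel₀ hd, one_smul]; abel
  have hPP : ∀ x ∈ Metric.ball x₀ ε, P x * P x = P x := by
    intro x hx
    have h1 : ((G x)⁻¹ * ricci G x) * ((G x)⁻¹ * ricci G x)
        = (ρ₁ + ρ₂) • ((G x)⁻¹ * ricci G x) - (ρ₁ * ρ₂) • 1 := by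
      calc _ = (G x)⁻¹ * (ricci G x * (G x)⁻¹ * ricci G x) := by simp only [mul_assoc]
        _ = _ := by rw [hquad x hx, mul_sub, Matrix.mul_smul, Matrix.mul_smul,
                    h.inv_mul (hεU hx)]
    have h2 : ((G x)⁻¹ * ricci G x - ρ₂ • (1 : Matrix (Fin 4) (Fin 4) ℝ))
        * ((G x)⁻¹ * ricci G x - ρ₂ • (1 : Matrix (Fin 4) (Fin 4) ℝ))
        = (ρ₁ - ρ₂) • ((G x)⁻¹ * ricci G x - ρ₂ • (1 : Matrix (Fin 4) (Fin 4) ℝ)) := by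
      rw [sub_mul, mul_sub, mul_sub, h1]
      simp only [Matrix.smul_mul, Matrix.mul_smul, one_mul, mul_one, smul_sub, smul_smul]
      module
    simp only [hP]
    rw [Matrix.smul_mul, Matrix.mul_smul, h2, smul_smul, smul_smul, mul_assoc,
      inv_mul_cancel₀ hd, mul_one]
  have hGP : ∀ x ∈ Metric.ball x₀ ε, (P x).transpose * G x = G x * P x := by
    intro x hx
    have hx := hεU hx
    simp only [hP, Matrix.transpose_smul, Matrix.transpose_sub, Matrix.transpose_mul,
      Matrix.transpose_one, h.ricci_symm hx, h.inv_symm hx, Matrix.smul_mul, Matrix.mul_smul,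
      sub_mul, mul_sub, one_mul, mul_one]
    rw [mul_assoc, h.inv_mul hx, ← mul_assoc, h.mul_inv hx, one_mul, mul_one]
  set D := eigDiag 1 0 with hD
  have hDD : D * D = D := by
    rw [hD, eigDiag_mul_self]; simp
  have hDt : D.transpose = D := Matrix.diagonal_transpose _
  have hPE₀ : P x₀ * E₀ = E₀ * D := by
    have h1 : (G x₀)⁻¹ * ricci G x₀ * E₀ = E₀ * eigDiag ρ₁ ρ₂ := by
      rw [mul_assoc, hE₀.eigen, ← mul_assoc, ← mul_assoc, h.inv_mul hx₀, one_mul]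
    have h2 : eigDiag ρ₁ ρ₂ = ρ₂ • 1 + (ρ₁ - ρ₂) • D := by
      ext i j
      simp only [hD, eigDiag, Matrix.add_apply, Matrix.smul_apply, Matrix.diagonal_apply,
        Matrix.one_apply, smul_eq_mul]
      split_ifs
      · fin_cases i <;> simp
      · simp
    rw [hHR, h2, add_mul, mul_add, Matrix.smul_mul, Matrix.smul_mul, Matrix.mul_smul,
      Matrix.mul_smul, one_mul, mul_one, add_right_inj] at h1
    exact smul_right_injective _ hd h1
  -- The frozen tetrad `E₀` projected to the eigenspaces at `x`: columns 0, 1 by `P x`, columns 2, 3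
  -- by the complementary projector. At `x₀` nothing changes.
  set V : R4 → Matrix (Fin 4) (Fin 4) ℝ := fun x => P x * E₀ * D + (E₀ - P x * E₀) * (1 - D)
    with hV
  have hVs : MSmooth (Metric.ball x₀ ε) V :=
    ((hPs.mul (MSmooth.const E₀)).mul (MSmooth.const D)).add
      (((MSmooth.const E₀).sub (hPs.mul (MSmooth.const E₀))).mul (MSmooth.const (1 - D)))
  have hPV : ∀ x ∈ Metric.ball x₀ ε, P x * V x = V x * D := by
    intro x hx
    have e1 : P x * (P x * E₀) = P x * E₀ := by rw [← mul_assoc, hPP x hx]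
    simp only [hV, mul_add, mul_sub, sub_mul, add_mul, mul_assoc, hDD, mul_one]
    simp only [← mul_assoc, hPP x hx]
    abel
  have hV₀ : V x₀ = E₀ := by
    simp only [hV, hPE₀]
    rw [sub_mul, mul_sub, mul_sub, mul_assoc, hDD, mul_one, mul_one]; abel
  set M : R4 → Matrix (Fin 4) (Fin 4) ℝ := fun x => (V x).transpose * G x * V x with hM
  have hMs : MSmooth (Metric.ball x₀ ε) M := (hVs.transpose.mul (h.smooth.mono hεU)).mul hVs
  have hM₀ : M x₀ = minkowski := by simp only [hM, hV₀]; exact hE₀.orthonormal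
  have hMsymm : ∀ x ∈ Metric.ball x₀ ε, (M x).transpose = M x := by
    intro x hx
    simp only [hM, Matrix.transpose_mul, Matrix.transpose_transpose, h.symm x (hεU hx), mul_assoc]
  have hMD : ∀ x ∈ Metric.ball x₀ ε, D * M x = M x * D := by
    intro x hx
    calc D * M x = (V x * D).transpose * G x * V x := by
          rw [Matrix.transpose_mul, hDt]; simp only [hM, mul_assoc]
      _ = (V x).transpose * ((P x).transpose * G x) * V x := by
          rw [← hPV x hx, Matrix.transpose_mul]; simp only [mul_assoc]
      _ = (V x).transpose * G x * (P x * V x) := by rw [hGP x hx]; simp only [mul_assoc]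
      _ = M x * D := by rw [hPV x hx]; simp only [hM, mul_assoc]
  -- The projector is self-adjoint for the metric, so the two eigenspaces are orthogonal and the
  -- Gram matrix has two blocks.
  have hMz : ∀ x ∈ Metric.ball x₀ ε, ∀ i j, ![(1 : ℝ), 1, 0, 0] i ≠ ![1, 1, 0, 0] j →
      M x i j = 0 := by
    intro x hx i j hij
    have := congrFun (congrFun (hMD x hx) i) j
    rw [hD, eigDiag, Matrix.mul_diagonal, Matrix.diagonal_mul] at this
    have h2 : (![(1 : ℝ), 1, 0, 0] i - ![1, 1, 0, 0] j) * M x i j = 0 := by linarith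
    exact (mul_eq_zero.1 h2).resolve_left (sub_ne_zero.2 hij)
  -- The sign conditions are open and hold at `x₀`, where the Gram matrix is `minkowski`.
  have hMpos : ∀ᶠ x in nhds x₀, GramPos (M x) := by
    have hc : ∀ i j, ContinuousAt (fun x => M x i j) x₀ := fun i j =>
      (hMs.diff hB (Metric.mem_ball_self hε) i j).continuousAt
    have v : ∀ i j, M x₀ i j = minkowski i j := fun i j => by rw [hM₀]
    have c0 : ∀ᶠ x in nhds x₀, 0 < - M x 0 0 :=
      (hc 0 0).neg.eventually (lt_mem_nhds (by simp [v, minkowski]))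
    have c1 : ∀ᶠ x in nhds x₀, 0 < M x 1 1 - M x 0 1 ^ 2 / M x 0 0 :=
      ((hc 1 1).sub (((hc 0 1).pow 2).div (hc 0 0) (by simp [v, minkowski]))).eventually
        (lt_mem_nhds (by simp [v, minkowski]))
    have c2 : ∀ᶠ x in nhds x₀, 0 < M x 2 2 :=
      (hc 2 2).eventually (lt_mem_nhds (by simp [v, minkowski]))
    have c3 : ∀ᶠ x in nhds x₀, 0 < M x 3 3 - M x 2 3 ^ 2 / M x 2 2 :=
      ((hc 3 3).sub (((hc 2 3).pow 2).div (hc 2 2) (by simp [v, minkowski]))).eventually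
        (lt_mem_nhds (by simp [v, minkowski]))
    filter_upwards [c0, c1, c2, c3] with x h0 h1 h2 h3 using ⟨h0, h1, h2, h3⟩
  obtain ⟨δ, hδ, hδM⟩ := Metric.eventually_nhds_iff_ball.1 hMpos
  have hsub : Metric.ball x₀ (min ε δ) ⊆ Metric.ball x₀ ε :=
    Metric.ball_subset_ball (min_le_left _ _)
  have hsub' : Metric.ball x₀ (min ε δ) ⊆ Metric.ball x₀ δ :=
    Metric.ball_subset_ball (min_le_right _ _)
  refine ⟨min ε δ, lt_min hε hδ, hsub.trans hεU, fun x => V x * gramSchmidtBlock (M x),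
    (hVs.mono hsub).mul (gramSchmidtBlock_smooth (hMs.mono hsub) fun x hx => hδM x (hsub' hx)),
    fun x hx => ⟨?_, ?_⟩⟩
  · have hx' := hsub hx
    rw [← gramSchmidtBlock_spec (hδM x (hsub' hx)) (hMsymm x hx') (hMz x hx' 0 2 (by simp))
      (hMz x hx' 0 3 (by simp)) (hMz x hx' 1 2 (by simp)) (hMz x hx' 1 3 (by simp)),
      Matrix.transpose_mul]
    simp only [hM, mul_assoc]
  · have hx' := hsub hx
    have h2 : eigDiag ρ₁ ρ₂ = ρ₂ • 1 + (ρ₁ - ρ₂) • D := by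
      ext i j
      simp only [hD, eigDiag, Matrix.add_apply, Matrix.smul_apply, Matrix.diagonal_apply,
        Matrix.one_apply, smul_eq_mul]
      split_ifs
      · fin_cases i <;> simp
      · simp
    have h3 : ricci G x = G x * ((G x)⁻¹ * ricci G x) := by
      rw [← mul_assoc, h.mul_inv (hεU hx'), one_mul]
    have h4 : ∀ W : Matrix (Fin 4) (Fin 4) ℝ, P x * W = W * D →
        (G x)⁻¹ * ricci G x * W = W * eigDiag ρ₁ ρ₂ := by
      intro W hW
      rw [hHR, h2, add_mul, mul_add, Matrix.smul_mul, Matrix.smul_mul, hW, Matrix.mul_smul,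
        Matrix.mul_smul, one_mul, mul_one]
    calc ricci G x * (V x * gramSchmidtBlock (M x))
        = G x * ((G x)⁻¹ * ricci G x * V x) * gramSchmidtBlock (M x) := by
          nth_rewrite 1 [h3]; simp only [mul_assoc]
      _ = _ := by rw [h4 _ (hPV x hx')]; simp only [mul_assoc, gramSchmidtBlock_comm]

end Frame

/-! ### The structure equations of an eigenvector tetrad -/

section StructureEquations

variable {G : R4 → Matrix (Fin 4) (Fin 4) ℝ} {U : Set R4} {x : R4}

/-- Infinitesimal boosts in the first plane and rotations in the second. -/
def boostRot (a b : ℝ) : Matrix (Fin 4) (Fin 4) ℝ :=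
  !![0, a, 0, 0; a, 0, 0, 0; 0, 0, 0, b; 0, 0, -b, 0]

/-- The rows of `Θ` are an orthonormal coframe on `U`, with connection forms `α` and `ν`, of a
product of two surfaces of curvatures `ρ₁` and `ρ₂`. -/
structure IsProductCoframe (Θ : R4 → Matrix (Fin 4) (Fin 4) ℝ) (α ν : Fin 4 → R4 → ℝ)
    (ρ₁ ρ₂ : ℝ) (U : Set R4) : Prop where
  smooth : MSmooth U Θ
  smooth_boost : ∀ c, ContDiffOn ℝ ∞ (α c) U
  smooth_rot : ∀ c, ContDiffOn ℝ ∞ (ν c) U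
  torsion_zero : ∀ x ∈ U, ∀ c d, pd c (fun y => Θ y 0 d) x - pd d (fun y => Θ y 0 c) x
    = -(α c x * Θ x 1 d - α d x * Θ x 1 c)
  torsion_one : ∀ x ∈ U, ∀ c d, pd c (fun y => Θ y 1 d) x - pd d (fun y => Θ y 1 c) x
    = -(α c x * Θ x 0 d - α d x * Θ x 0 c)
  torsion_two : ∀ x ∈ U, ∀ c d, pd c (fun y => Θ y 2 d) x - pd d (fun y => Θ y 2 c) x
    = -(ν c x * Θ x 3 d - ν d x * Θ x 3 c)
  torsion_three : ∀ x ∈ U, ∀ c d, pd c (fun y => Θ y 3 d) x - pd d (fun y => Θ y 3 c) x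
    = ν c x * Θ x 2 d - ν d x * Θ x 2 c
  curv_boost : ∀ x ∈ U, ∀ c d, pd c (α d) x - pd d (α c) x
    = ρ₁ * (Θ x 0 c * Θ x 1 d - Θ x 1 c * Θ x 0 d)
  curv_rot : ∀ x ∈ U, ∀ c d, pd c (ν d) x - pd d (ν c) x
    = ρ₂ * (Θ x 2 c * Θ x 3 d - Θ x 3 c * Θ x 2 d)

/-- The first condition puts `W` in the Lorentz algebra. Commuting with a diagonal matrix with two
distinct values kills the entries that mix the planes. -/
theorem eq_boostRot {W : Matrix (Fin 4) (Fin 4) ℝ} {ρ₁ ρ₂ : ℝ} (hne : ρ₁ ≠ ρ₂)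
    (h1 : (minkowski * W).transpose = - (minkowski * W))
    (h2 : eigDiag ρ₁ ρ₂ * W = W * eigDiag ρ₁ ρ₂) : W = boostRot (W 0 1) (W 2 3) := by
  have a : ∀ i j, ![(-1 : ℝ), 1, 1, 1] i * W i j = - (![(-1 : ℝ), 1, 1, 1] j * W j i) := by
    intro i j
    have := congrFun (congrFun h1 j) i
    rw [minkowski, Matrix.transpose_apply, Matrix.neg_apply, Matrix.diagonal_mul,
      Matrix.diagonal_mul] at this
    exact this
  have b : ∀ i j, ![ρ₁, ρ₁, ρ₂, ρ₂] i ≠ ![ρ₁, ρ₁, ρ₂, ρ₂] j → W i j = 0 := by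
    intro i j hij
    have := congrFun (congrFun h2 i) j
    rw [eigDiag, Matrix.mul_diagonal, Matrix.diagonal_mul] at this
    have h2 : (![ρ₁, ρ₁, ρ₂, ρ₂] i - ![ρ₁, ρ₁, ρ₂, ρ₂] j) * W i j = 0 := by linarith
    exact (mul_eq_zero.1 h2).resolve_left (sub_ne_zero.2 hij)
  have b02 := b 0 2 (by simpa using hne)
  have b03 := b 0 3 (by simpa using hne)
  have b12 := b 1 2 (by simpa using hne)
  have b13 := b 1 3 (by simpa using hne)
  have b20 := b 2 0 (by simpa using hne.symm)
  have b30 := b 3 0 (by simpa using hne.symm)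
  have b21 := b 2 1 (by simpa using hne.symm)
  have b31 := b 3 1 (by simpa using hne.symm)
  have a00 := a 0 0
  have a11 := a 1 1
  have a22 := a 2 2
  have a33 := a 3 3
  have a01 := a 0 1
  have a23 := a 2 3
  simp at a00 a11 a22 a33 a01 a23
  ext i j
  fin_cases i <;> fin_cases j <;> simp [boostRot, b02, b03, b12, b13, b20, b30, b21, b31] <;>
    linarith

/-- Boosts of one plane and rotations of the other form an abelian algebra, so the curvature of such
a connection is just the exterior derivative of its two forms. -/
theorem boostRot_mul_comm (a b a' b' : ℝ) :
    boostRot a b * boostRot a' b' = boostRot a' b' * boostRot a b := by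
  ext i j
  fin_cases i <;> fin_cases j <;>
    simp [boostRot, Matrix.mul_apply, Fin.sum_univ_four, mul_comm]

theorem mpd_boostRot (c : Fin 4) (a b : R4 → ℝ) :
    mpd c (fun y => boostRot (a y) (b y)) x = boostRot (pd c a x) (pd c b x) := by
  ext i j
  fin_cases i <;> fin_cases j <;> simp [mpd, boostRot, pd_const, pd_neg]

theorem sum_rotate (f : Fin 4 → Fin 4 → Fin 4 → ℝ) :
    ∑ b, ∑ c, ∑ d, f b c d = ∑ b, ∑ c, ∑ d, f c d b := by
  conv_rhs => rw [Finset.sum_comm]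
  exact Finset.sum_congr rfl fun c _ => by rw [Finset.sum_comm]

/-- The structure equations of a tetrad of eigenvectors of a parallel Ricci tensor. -/
theorem MetricOn.exists_isProductCoframe (h : MetricOn G U)
    (hpar : ∀ x ∈ U, ∀ c, covM G (ricci G) c x = 0) {E : R4 → Matrix (Fin 4) (Fin 4) ℝ}
    (hEs : MSmooth U E) {ρ₁ ρ₂ : ℝ} (hne : ρ₁ ≠ ρ₂)
    (hE : ∀ x ∈ U, IsEigenTetrad (G x) (ricci G x) (E x) ρ₁ ρ₂) :
    ∃ (Θ : R4 → Matrix (Fin 4) (Fin 4) ℝ) (α ν : Fin 4 → R4 → ℝ),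
      IsProductCoframe Θ α ν ρ₁ ρ₂ U ∧
      ∀ x ∈ U, G x = (Θ x).transpose * minkowski * Θ x ∧
        ricci G x = (Θ x).transpose * (minkowski * eigDiag ρ₁ ρ₂) * Θ x := by
  have hU := h.isOpen
  -- The dual coframe: `Θ x` is the inverse of `E x`.
  obtain ⟨Θ, hΘ⟩ : ∃ Θ : R4 → Matrix (Fin 4) (Fin 4) ℝ,
      ∀ x, Θ x = minkowski * (E x).transpose * G x := ⟨_, fun _ => rfl⟩
  have hΘs : MSmooth U Θ := (((MSmooth.const _).mul hEs.transpose).mul h.smooth).congr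
    fun x _ => hΘ x
  have hΘE : ∀ x ∈ U, Θ x * E x = 1 := fun x hx => by rw [hΘ]; exact (hE x hx).left_inv
  have hEΘ : ∀ x ∈ U, E x * Θ x = 1 := fun x hx => by rw [hΘ]; exact (hE x hx).right_inv
  -- The Levi-Civita connection expressed in the tetrad.
  obtain ⟨W, hW⟩ : ∃ W : Fin 4 → R4 → Matrix (Fin 4) (Fin 4) ℝ, ∀ c x,
      W c x = Θ x * (mpd c E x + conn G c x * E x) := ⟨_, fun _ _ => rfl⟩
  have hWs : ∀ c, MSmooth U (W c) := fun c =>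
    (hΘs.mul ((hEs.mpd c hU).add ((h.conn_smooth c).mul hEs))).congr fun x _ => hW c x
  have hEW : ∀ x ∈ U, ∀ c, E x * W c x = mpd c E x + conn G c x * E x := fun x hx c => by
    rw [hW, ← mul_assoc, hEΘ x hx, one_mul]
  have hdE : ∀ x ∈ U, ∀ c, mpd c E x = E x * W c x - conn G c x * E x := fun x hx c => by
    rw [hEW x hx]; abel
  have hW1 : ∀ x ∈ U, ∀ c, (minkowski * W c x).transpose = - (minkowski * W c x) := by
    intro x hx c
    have e := mpd_congr c hU (fun y hy => (hE y hy).orthonormal) hx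
    rw [mpd_mul c hU (hEs.transpose.mul h.smooth) hEs hx,
      mpd_mul c hU hEs.transpose h.smooth hx, mpd_transpose, mpd_const, h.mpd_eq hx,
      hdE x hx] at e
    have e2 : minkowski * W c x = (E x).transpose * G x * (E x * W c x) := by
      rw [← mul_assoc, (hE x hx).orthonormal]
    have e3 : (minkowski * W c x).transpose = (E x * W c x).transpose * G x * E x := by
      rw [e2, Matrix.transpose_mul, Matrix.transpose_mul (E x).transpose (G x),
        Matrix.transpose_transpose, h.symm x hx, mul_assoc]
    rw [e3, eq_neg_iff_add_eq_zero, e2, ← e, Matrix.transpose_sub, Matrix.transpose_mul (conn G c x)]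
    noncomm_ring
  -- Derivative of the eigenvector equation: the Ricci tensor is parallel and the eigenvalues
  -- constant, so the eigenplanes are parallel.
  have hW2 : ∀ x ∈ U, ∀ c, eigDiag ρ₁ ρ₂ * W c x = W c x * eigDiag ρ₁ ρ₂ := by
    intro x hx c
    have e := mpd_congr c hU (fun y hy => (hE y hy).eigen) hx
    rw [mpd_mul c hU h.ricci_smooth hEs hx,
      mpd_mul c hU (h.smooth.mul hEs) (MSmooth.const _) hx,
      mpd_mul c hU h.smooth hEs hx, mpd_const, mul_zero, add_zero, h.mpd_eq hx,
      hdE x hx] at e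
    have e1 : mpd c (ricci G) x
        = (conn G c x).transpose * ricci G x + ricci G x * conn G c x :=
      sub_eq_zero.1 (hpar x hx c)
    rw [e1] at e
    have e2 : (conn G c x).transpose * (ricci G x * E x) + ricci G x * E x * W c x
        = (conn G c x).transpose * (G x * E x * eigDiag ρ₁ ρ₂)
          + G x * E x * (W c x * eigDiag ρ₁ ρ₂) := by
      have l : (conn G c x).transpose * (ricci G x * E x) + ricci G x * E x * W c x
        = ((conn G c x).transpose * ricci G x + ricci G x * conn G c x) * E x
          + ricci G x * (E x * W c x - conn G c x * E x) := by noncomm_ring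
      rw [l, e]; noncomm_ring
    rw [(hE x hx).eigen, add_right_inj] at e2
    have e3 : (minkowski * (E x).transpose) * (G x * E x * eigDiag ρ₁ ρ₂ * W c x)
        = (minkowski * (E x).transpose) * (G x * E x * (W c x * eigDiag ρ₁ ρ₂)) := by rw [e2]
    have e4 : ∀ S, (minkowski * (E x).transpose) * (G x * E x * S) = S := by
      intro S
      calc _ = Θ x * E x * S := by simp only [hΘ, mul_assoc]
        _ = S := by rw [hΘE x hx, one_mul]
    rw [mul_assoc (G x * E x), e4, e4] at e3
    exact e3
  obtain ⟨α, hα⟩ : ∃ α : Fin 4 → R4 → ℝ, ∀ c, α c = fun x => W c x 0 1 := ⟨_, fun _ => rfl⟩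
  obtain ⟨ν, hν⟩ : ∃ ν : Fin 4 → R4 → ℝ, ∀ c, ν c = fun x => W c x 2 3 := ⟨_, fun _ => rfl⟩
  have hWb : ∀ x ∈ U, ∀ c, W c x = boostRot (α c x) (ν c x) := fun x hx c => by
    rw [hα, hν]; exact eq_boostRot hne (hW1 x hx c) (hW2 x hx c)
  -- torsion
  have htor : ∀ x ∈ U, ∀ i c d, pd c (fun y => Θ y i d) x - pd d (fun y => Θ y i c) x
      = - ((boostRot (α c x) (ν c x) * Θ x) i d - (boostRot (α d x) (ν d x) * Θ x) i c) := by
    intro x hx i c d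
    have e : ∀ c, mpd c Θ x = - (W c x * Θ x) + Θ x * conn G c x := by
      intro c
      have e := mpd_congr c hU (fun y hy => hΘE y hy) hx
      rw [mpd_mul c hU hΘs hEs hx, mpd_const, hdE x hx] at e
      have e1 : mpd c Θ x * E x = - (Θ x * (E x * W c x - conn G c x * E x)) :=
        eq_neg_of_add_eq_zero_left e
      calc mpd c Θ x = mpd c Θ x * E x * Θ x := by rw [mul_assoc, hEΘ x hx, mul_one]
        _ = - (Θ x * E x * W c x * Θ x - Θ x * conn G c x * (E x * Θ x)) := by
          rw [e1]; noncomm_ring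
        _ = _ := by rw [hΘE x hx, hEΘ x hx, one_mul, mul_one]; abel
    have e1 : ∀ c d, pd c (fun y => Θ y i d) x
        = - (W c x * Θ x) i d + (Θ x * conn G c x) i d := fun c d => by
      have := congrFun (congrFun (e c) i) d
      exact this
    have e2 : (Θ x * conn G c x) i d = (Θ x * conn G d x) i c := by
      simp only [Matrix.mul_apply, h.conn_swap hx _ d c]
    rw [e1, e1, e2, ← hWb x hx, ← hWb x hx]; ring
  -- curvature
  have hcurv : ∀ x ∈ U, ∀ c d, Θ x * curvM (conn G) c d x * E x
      = boostRot (pd c (α d) x - pd d (α c) x) (pd c (ν d) x - pd d (ν c) x) := by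
    intro x hx c d
    have e := curvM_gauge hU h.conn_smooth hWs hEs hEW hx c d
    rw [mul_assoc, ← e, ← mul_assoc, hΘE x hx, one_mul, curvM, mpd_congr c hU (fun y hy =>
      hWb y hy d) hx, mpd_congr d hU (fun y hy => hWb y hy c) hx, hWb x hx, hWb x hx,
      boostRot_mul_comm, sub_self, add_zero, mpd_boostRot, mpd_boostRot]
    ext i j
    fin_cases i <;> fin_cases j <;> simp [boostRot]
    ring
  -- `F i j k l` is the curvature with all indices referred to the tetrad. The four properties are
  -- its expansion in the coframe, its definition, the first Bianchi identity and the Ricci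
  -- contraction.
  have hF : ∀ x ∈ U, ∃ F : Fin 4 → Fin 4 → Matrix (Fin 4) (Fin 4) ℝ,
      (∀ c d i j, boostRot (pd c (α d) x - pd d (α c) x) (pd c (ν d) x - pd d (ν c) x) i j
        = ((Θ x).transpose * F i j * Θ x) c d) ∧
      (∀ i j k l, F i j k l = ∑ c, ∑ d, E x c k * E x d l *
        boostRot (pd c (α d) x - pd d (α c) x) (pd c (ν d) x - pd d (ν c) x) i j) ∧
      (∀ i j k l, F i j k l + F i k l j + F i l j k = 0) ∧
      ∀ j l, ∑ i, F i j i l = (minkowski * eigDiag ρ₁ ρ₂) j l := by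
    intro x hx
    obtain ⟨S, hS⟩ : ∃ S : Fin 4 → Fin 4 → Matrix (Fin 4) (Fin 4) ℝ, ∀ i j c d, S i j c d =
        boostRot (pd c (α d) x - pd d (α c) x) (pd c (ν d) x - pd d (ν c) x) i j :=
      ⟨fun i j => Matrix.of fun c d => _, fun _ _ _ _ => rfl⟩
    have hSF : ∀ i j k l, ((E x).transpose * S i j * E x) k l = ∑ c, ∑ d, E x c k * E x d l *
        boostRot (pd c (α d) x - pd d (α c) x) (pd c (ν d) x - pd d (ν c) x) i j := by
      intro i j k l
      simp only [Matrix.mul_apply, Matrix.transpose_apply, hS, Finset.sum_mul]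
      rw [Finset.sum_comm]
      exact Finset.sum_congr rfl fun c _ => Finset.sum_congr rfl fun d _ => by ring
    have hSF' : ∀ i j k l, ((E x).transpose * S i j * E x) k l = ∑ a, Θ x i a *
        ∑ b, ∑ c, ∑ d, E x b j * E x c k * E x d l * curvM (conn G) c d x a b := by
      intro i j k l
      have e0 : ∀ c d, boostRot (pd c (α d) x - pd d (α c) x) (pd c (ν d) x - pd d (ν c) x) i j
          = ∑ a, ∑ b, Θ x i a * (curvM (conn G) c d x a b * E x b j) := fun c d => by
        rw [← hcurv x hx, mul_assoc, Matrix.mul_apply]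
        exact Finset.sum_congr rfl fun a _ => by rw [Matrix.mul_apply, Finset.mul_sum]
      rw [hSF]
      simp only [e0, Finset.mul_sum]
      have e : ∀ c, ∑ d, ∑ a, ∑ b, E x c k * E x d l * (Θ x i a * (curvM (conn G) c d x a b
          * E x b j)) = ∑ a, ∑ b, ∑ d, E x c k * E x d l * (Θ x i a * (curvM (conn G) c d x a b
          * E x b j)) := fun c => by
        rw [Finset.sum_comm]
        exact Finset.sum_congr rfl fun a _ => Finset.sum_comm
      simp only [e]
      rw [Finset.sum_comm]
      refine Finset.sum_congr rfl fun a _ => ?_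
      rw [Finset.sum_comm]
      exact Finset.sum_congr rfl fun b _ => Finset.sum_congr rfl fun c _ =>
        Finset.sum_congr rfl fun d _ => by ring
    refine ⟨fun i j => (E x).transpose * S i j * E x, ?_, hSF, ?_, ?_⟩
    · intro c d i j
      have e1 : (Θ x).transpose * (E x).transpose = 1 := by
        rw [← Matrix.transpose_mul, hEΘ x hx, Matrix.transpose_one]
      have e2 : (Θ x).transpose * ((E x).transpose * S i j * E x) * Θ x = S i j := by
        calc _ = ((Θ x).transpose * (E x).transpose) * S i j * (E x * Θ x) := by
              simp only [mul_assoc]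
          _ = S i j := by rw [e1, hEΘ x hx, one_mul, mul_one]
      rw [e2, hS]
    · intro i j k l
      beta_reduce
      rw [hSF' i j, hSF' i k, hSF' i l, ← Finset.sum_add_distrib, ← Finset.sum_add_distrib]
      refine Finset.sum_eq_zero fun a _ => ?_
      rw [← mul_add, ← mul_add]
      rw [sum_rotate (fun b c d => E x b k * E x c l * E x d j * curvM (conn G) c d x a b),
        sum_rotate (fun b c d => E x b l * E x c j * E x d k * curvM (conn G) c d x a b),
        sum_rotate (fun b c d => E x c l * E x d j * E x b k * curvM (conn G) d b x a c)]
      simp only [← Finset.sum_add_distrib]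
      rw [Finset.sum_eq_zero, mul_zero]
      refine fun b _ => Finset.sum_eq_zero fun c _ => Finset.sum_eq_zero fun d _ => ?_
      linear_combination (E x b j * E x c k * E x d l) * h.bianchi_first hx a b c d
    · intro j l
      rw [← (hE x hx).conj_eq]
      have e : ∀ i, ((E x).transpose * S i j * E x) i l = ∑ a, ∑ c, (E x c i * Θ x i a) *
          ∑ b, ∑ d, E x b j * E x d l * curvM (conn G) c d x a b := by
        intro i
        rw [hSF']
        refine Finset.sum_congr rfl fun a _ => ?_
        rw [Finset.sum_comm, Finset.mul_sum]
        refine Finset.sum_congr rfl fun c _ => ?_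
        rw [Finset.mul_sum, Finset.mul_sum]
        refine Finset.sum_congr rfl fun b _ => ?_
        rw [Finset.mul_sum, Finset.mul_sum]
        exact Finset.sum_congr rfl fun d _ => by ring
      beta_reduce
      rw [Finset.sum_congr rfl fun i _ => e i, Finset.sum_comm]
      have hdel : ∀ c a, ∑ i, E x c i * Θ x i a = if c = a then 1 else 0 := fun c a => by
        rw [← Matrix.mul_apply, hEΘ x hx, Matrix.one_apply]
      have e2 : ∀ a, ∑ i, ∑ c, (E x c i * Θ x i a) *
          ∑ b, ∑ d, E x b j * E x d l * curvM (conn G) c d x a b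
          = ∑ b, ∑ d, E x b j * E x d l * curvM (conn G) a d x a b := by
        intro a
        rw [Finset.sum_comm]
        simp only [← Finset.sum_mul, hdel, ite_mul, one_mul, zero_mul, Finset.sum_ite_eq',
          Finset.mem_univ, if_true]
      rw [Finset.sum_congr rfl fun a _ => e2 a]
      simp only [Matrix.mul_apply, Matrix.transpose_apply, ricci_apply, Finset.sum_mul,
        Finset.mul_sum]
      rw [Finset.sum_comm]
      conv_rhs => rw [Finset.sum_comm]
      refine Finset.sum_congr rfl fun b _ => ?_
      rw [Finset.sum_comm]
      exact Finset.sum_congr rfl fun d _ => Finset.sum_congr rfl fun a _ => by ring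
  have hfin : ∀ x ∈ U, ∀ c d,
      pd c (α d) x - pd d (α c) x = ρ₁ * (Θ x 0 c * Θ x 1 d - Θ x 1 c * Θ x 0 d) ∧
      pd c (ν d) x - pd d (ν c) x = ρ₂ * (Θ x 2 c * Θ x 3 d - Θ x 3 c * Θ x 2 d) := by
    intro x hx c d
    obtain ⟨F, F1, F2, F3, F4⟩ := hF x hx
    have z : ∀ i j, (∀ a b, boostRot a b i j = 0) → ∀ k l, F i j k l = 0 := by
      intro i j hz k l
      rw [F2]
      exact Finset.sum_eq_zero fun c _ => Finset.sum_eq_zero fun d _ => by rw [hz, mul_zero]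
    have f10 : ∀ k l, F 1 0 k l = F 0 1 k l := fun k l => by rw [F2, F2]; rfl
    have f32 : ∀ k l, F 3 2 k l = - F 2 3 k l := fun k l => by
      rw [F2, F2, ← Finset.sum_neg_distrib]
      refine Finset.sum_congr rfl fun c _ => ?_
      rw [← Finset.sum_neg_distrib]
      refine Finset.sum_congr rfl fun d _ => ?_
      simp [boostRot]; ring
    have anti : ∀ i j k l, F i j k l = - F i j l k := by
      intro i j k l
      rw [F2, F2, Finset.sum_comm, ← Finset.sum_neg_distrib]
      refine Finset.sum_congr rfl fun c _ => ?_
      rw [← Finset.sum_neg_distrib]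
      refine Finset.sum_congr rfl fun d _ => ?_
      have : boostRot (pd d (α c) x - pd c (α d) x) (pd d (ν c) x - pd c (ν d) x) i j
          = - boostRot (pd c (α d) x - pd d (α c) x) (pd c (ν d) x - pd d (ν c) x) i j := by
        fin_cases i <;> fin_cases j <;> simp [boostRot]
      rw [this]; ring
    have z00 := z 0 0 (fun a b => rfl)
    have z11 := z 1 1 (fun a b => rfl)
    have z22 := z 2 2 (fun a b => rfl)
    have z33 := z 3 3 (fun a b => rfl)
    have z02 := z 0 2 (fun a b => rfl)
    have z03 := z 0 3 (fun a b => rfl)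
    have z12 := z 1 2 (fun a b => rfl)
    have z13 := z 1 3 (fun a b => rfl)
    have z20 := z 2 0 (fun a b => rfl)
    have z21 := z 2 1 (fun a b => rfl)
    have z30 := z 3 0 (fun a b => rfl)
    have z31 := z 3 1 (fun a b => rfl)
    have diag : ∀ i j k, F i j k k = 0 := fun i j k => by have := anti i j k k; linarith
    -- In each instance of the first Bianchi identity the other terms have a first pair that repeats
    -- an index or mixes the planes, and such components vanish. Only `F 0 1 0 1` and `F 2 3 2 3`
    -- survive, and the Ricci contraction evaluates them.
    have a02 : F 0 1 0 2 = 0 := by have := F3 0 1 0 2; rw [z00, z02] at this; linarith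
    have a03 : F 0 1 0 3 = 0 := by have := F3 0 1 0 3; rw [z00, z03] at this; linarith
    have a12 : F 0 1 1 2 = 0 := by
      have := F3 1 0 1 2; rw [z11, z12, f10] at this; linarith
    have a13 : F 0 1 1 3 = 0 := by
      have := F3 1 0 1 3; rw [z11, z13, f10] at this; linarith
    have a23 : F 0 1 2 3 = 0 := by have := F3 0 1 2 3; rw [z02, z03] at this; linarith
    have b01 : F 2 3 0 1 = 0 := by have := F3 2 3 0 1; rw [z20, z21] at this; linarith
    have b02 : F 2 3 0 2 = 0 := by have := F3 2 3 0 2; rw [z20, z22] at this; linarith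
    have b12 : F 2 3 1 2 = 0 := by have := F3 2 3 1 2; rw [z21, z22] at this; linarith
    have b03 : F 2 3 0 3 = 0 := by
      have := F3 3 2 0 3; rw [z30, z33, f32] at this; linarith
    have b13 : F 2 3 1 3 = 0 := by
      have := F3 3 2 1 3; rw [z31, z33, f32] at this; linarith
    have a01 : F 0 1 0 1 = ρ₁ := by
      have := F4 1 1
      simp only [Fin.sum_univ_four] at this
      rw [z11, z21, z31] at this
      simpa [minkowski, eigDiag] using this
    have b23 : F 2 3 2 3 = ρ₂ := by
      have := F4 3 3
      simp only [Fin.sum_univ_four] at this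
      rw [z03, z13, z33] at this
      simpa [minkowski, eigDiag] using this
    constructor
    · have := F1 c d 0 1
      simp only [Matrix.mul_apply, Fin.sum_univ_four, Matrix.transpose_apply] at this
      rw [anti 0 1 1 0, anti 0 1 2 0, anti 0 1 3 0, anti 0 1 2 1, anti 0 1 3 1, anti 0 1 3 2,
        diag, diag, diag, diag, a01, a02, a03, a12, a13, a23] at this
      have e : boostRot (pd c (α d) x - pd d (α c) x) (pd c (ν d) x - pd d (ν c) x) 0 1
        = pd c (α d) x - pd d (α c) x := rfl
      rw [e] at this
      rw [this]; ring
    · have := F1 c d 2 3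
      simp only [Matrix.mul_apply, Fin.sum_univ_four, Matrix.transpose_apply] at this
      rw [anti 2 3 1 0, anti 2 3 2 0, anti 2 3 3 0, anti 2 3 2 1, anti 2 3 3 1, anti 2 3 3 2,
        diag, diag, diag, diag, b01, b02, b03, b12, b13, b23] at this
      have e : boostRot (pd c (α d) x - pd d (α c) x) (pd c (ν d) x - pd d (ν c) x) 2 3
        = pd c (ν d) x - pd d (ν c) x := rfl
      rw [e] at this
      rw [this]; ring
  refine ⟨Θ, α, ν, ⟨hΘs, fun c => hα c ▸ hWs c 0 1, fun c => hν c ▸ hWs c 2 3, ?_, ?_, ?_, ?_,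
    fun x hx c d => (hfin x hx c d).1, fun x hx c d => (hfin x hx c d).2⟩, ?_⟩
  · intro x hx c d
    rw [htor x hx]
    simp [Matrix.mul_apply, Fin.sum_univ_four, boostRot]
  · intro x hx c d
    rw [htor x hx]
    simp [Matrix.mul_apply, Fin.sum_univ_four, boostRot]
  · intro x hx c d
    rw [htor x hx]
    simp [Matrix.mul_apply, Fin.sum_univ_four, boostRot]
  · intro x hx c d
    rw [htor x hx]
    simp [Matrix.mul_apply, Fin.sum_univ_four, boostRot]
    ring
  · intro x hx
    have e : (Θ x).transpose * minkowski = G x * E x := by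
      rw [hΘ, Matrix.transpose_mul, Matrix.transpose_mul, Matrix.transpose_transpose, h.symm x hx,
        minkowski, Matrix.diagonal_transpose, ← minkowski, mul_assoc, mul_assoc,
        minkowski_mul_self, mul_one]
    constructor
    · rw [e, mul_assoc, hEΘ x hx, mul_one]
    · rw [← mul_assoc, e, ← (hE x hx).eigen, mul_assoc, hEΘ x hx, mul_one]

end StructureEquations

/-! ### Flat linear systems -/

section FlatSystem

open Metric Set Filter Asymptotics

variable {X E : Type*} [NormedAddCommGroup X] [NormedSpace ℝ X] [NormedAddCommGroup E]
  [NormedSpace ℝ E]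

/-- Bounds for a smooth function and its derivative near a point. -/
theorem exists_bounds_of_contDiffOn {F : Type*} [NormedAddCommGroup F] [NormedSpace ℝ F]
    {A : X → F} {U : Set X} (hU : IsOpen U) (hA : ContDiffOn ℝ ∞ A U) {x₀ : X} (hx₀ : x₀ ∈ U) :
    ∃ ε > 0, ∃ C : ℝ, 0 ≤ C ∧ ball x₀ ε ⊆ U ∧ (∀ y ∈ ball x₀ ε, ‖A y‖ ≤ C) ∧
      (∀ y ∈ ball x₀ ε, ∀ z ∈ ball x₀ ε, ‖A z - A y‖ ≤ C * ‖z - y‖) ∧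
      ∀ y ∈ ball x₀ ε, ∀ z ∈ ball x₀ ε,
        ‖A z - A y - fderiv ℝ A y (z - y)‖ ≤ C * ‖z - y‖ ^ 2 := by
  have hA0 : ContDiffAt ℝ ∞ A x₀ := hA.contDiffAt (hU.mem_nhds hx₀)
  have hA1 : ContDiffAt ℝ ∞ (fderiv ℝ A) x₀ :=
    (hA.fderiv_of_isOpen (m := ∞) hU (by simp)).contDiffAt (hU.mem_nhds hx₀)
  obtain ⟨K0, t0, ht0, hK0⟩ := (hA0.of_le (m := 1) (by simp)).exists_lipschitzOnWith
  obtain ⟨K1, t1, ht1, hK1⟩ := (hA1.of_le (m := 1) (by simp)).exists_lipschitzOnWith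
  have hb : ∀ᶠ y in nhds x₀, ‖A y‖ < ‖A x₀‖ + 1 :=
    hA0.continuousAt.norm.eventually (gt_mem_nhds (by linarith))
  obtain ⟨ε, hε, hεs⟩ := Metric.mem_nhds_iff.1
    (inter_mem (inter_mem ht0 ht1) (inter_mem (hU.mem_nhds hx₀) hb))
  have hs0 : ∀ y ∈ ball x₀ ε, y ∈ t0 := fun y hy => (hεs hy).1.1
  have hs1 : ∀ y ∈ ball x₀ ε, y ∈ t1 := fun y hy => (hεs hy).1.2
  have hsU : ball x₀ ε ⊆ U := fun y hy => (hεs hy).2.1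
  refine ⟨ε, hε, K0 + K1 + (‖A x₀‖ + 1), by positivity, hsU, ?_, ?_, ?_⟩
  · intro y hy
    have : ‖A y‖ < ‖A x₀‖ + 1 := (hεs hy).2.2
    have h0 := K0.2
    have h1 := K1.2
    simp only [NNReal.val_eq_coe] at h0 h1
    linarith
  · intro y hy z hz
    have := hK0.dist_le_mul z (hs0 z hz) y (hs0 y hy)
    rw [dist_eq_norm, dist_eq_norm] at this
    refine this.trans (mul_le_mul_of_nonneg_right ?_ (norm_nonneg _))
    have h1 := K1.2
    simp only [NNReal.val_eq_coe] at h1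
    linarith [norm_nonneg (A x₀)]
  · intro y hy z hz
    -- On this convex set the derivative differs from its value at `y` by at most `K1 * ‖z - y‖`, so
    -- the mean value inequality gives a quadratic remainder.
    have hconv : Convex ℝ (ball x₀ ε ∩ closedBall y ‖z - y‖) :=
      (convex_ball _ _).inter (convex_closedBall _ _)
    have key := hconv.norm_image_sub_le_of_norm_hasFDerivWithin_le' (f := A) (f' := fderiv ℝ A)
      (φ := fderiv ℝ A y) (C := K1 * ‖z - y‖) (x := y) (y := z) ?_ ?_ ?_ ?_
    · refine key.trans ?_
      rw [mul_assoc, ← sq]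
      refine mul_le_mul_of_nonneg_right ?_ (by positivity)
      have h0 := K0.2
      simp only [NNReal.val_eq_coe] at h0
      linarith [norm_nonneg (A x₀)]
    · intro w hw
      exact ((hA.contDiffAt (hU.mem_nhds (hsU hw.1))).differentiableAt
        (by simp)).hasFDerivAt.hasFDerivWithinAt
    · intro w hw
      have := hK1.dist_le_mul w (hs1 w hw.1) y (hs1 y hy)
      rw [dist_eq_norm] at this
      exact this.trans (mul_le_mul_of_nonneg_left (mem_closedBall.1 hw.2) K1.2)
    · exact ⟨hy, by simp⟩
    · exact ⟨hz, by simp [dist_eq_norm]⟩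

/-- A flat linear system `dY = A Y` has a local solution with any initial value. -/
theorem exists_flat_solution [FiniteDimensional ℝ X] [CompleteSpace E] {A : X → X →L[ℝ] E →L[ℝ] E} {U : Set X}
    (hU : IsOpen U) (hA : ContDiffOn ℝ ∞ A U)
    (hflat : ∀ x ∈ U, ∀ u v z, fderiv ℝ A x u v z - fderiv ℝ A x v u z
      = A x u (A x v z) - A x v (A x u z))
    {x₀ : X} (hx₀ : x₀ ∈ U) (Y₀ : E) :
    ∃ r > 0, ball x₀ r ⊆ U ∧ ∃ Y : X → E, Y x₀ = Y₀ ∧ ContDiffOn ℝ ∞ Y (ball x₀ r) ∧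
      ∀ x ∈ ball x₀ r, HasFDerivAt Y ((A x).flip (Y x)) x := by
  obtain ⟨ε, hε, C, hC, hεU, hb0, hb1, hb2⟩ := exists_bounds_of_contDiffOn hU hA hx₀
  -- Chosen so that `C * r ≤ 1 / 2`, which bounds the operator driving each ray equation by `1 / 2`,
  -- and so that `‖v‖ ≤ 1` in the error estimates.
  set r := min ε (min 1 (1 / (2 * C + 2))) with hr
  have hr0 : 0 < r := lt_min hε (lt_min one_pos (by positivity))
  have hrε : r ≤ ε := min_le_left _ _
  have hr1 : r ≤ 1 := (min_le_right _ _).trans (min_le_left _ _)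
  have hrC : C * r ≤ 1 / 2 := by
    have h1 : r ≤ 1 / (2 * C + 2) := (min_le_right _ _).trans (min_le_right _ _)
    have h2 : r * (2 * C + 2) ≤ 1 := by rwa [le_div_iff₀ (by positivity)] at h1
    nlinarith
  have hmem : ∀ v : X, ‖v‖ < r → ∀ t ∈ Icc (0 : ℝ) 1, x₀ + t • v ∈ ball x₀ ε := by
    intro v hv t ht
    rw [mem_ball, dist_eq_norm, add_sub_cancel_left, norm_smul, Real.norm_of_nonneg ht.1]
    have := mul_le_of_le_one_left (norm_nonneg v) ht.2
    linarith
  have hAd : ∀ y ∈ ball x₀ ε, HasFDerivAt A (fderiv ℝ A y) y := fun y hy =>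
    ((hA.contDiffAt (hU.mem_nhds (hεU hy))).differentiableAt (by simp)).hasFDerivAt
  have hline : ∀ v : X, ‖v‖ < r → ∀ t ∈ Icc (0 : ℝ) 1,
      HasDerivAt (fun t : ℝ => A (x₀ + t • v)) (fderiv ℝ A (x₀ + t • v) v) t := by
    intro v hv t ht
    have h1 : HasDerivAt (fun t : ℝ => x₀ + t • v) v t := by
      simpa using ((hasDerivAt_id t).smul_const v).const_add x₀
    exact HasFDerivAt.comp_hasDerivAt (E := X →L[ℝ] E →L[ℝ] E) t (hAd _ (hmem v hv t ht)) h1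
  have hnorm : ∀ v : X, ‖v‖ < r → ∀ t ∈ Icc (0 : ℝ) 1, ‖A (x₀ + t • v) v‖ ≤ 1 / 2 := by
    intro v hv t ht
    refine ((A _).le_opNorm v).trans (le_trans ?_ hrC)
    exact mul_le_mul (hb0 _ (hmem v hv t ht)) hv.le (norm_nonneg _) hC
  -- the solutions along rays
  have hex : ∀ v : X, ∃ z : ℝ → E, ‖v‖ < r → z 0 = Y₀ ∧ ∀ t ∈ Icc (0 : ℝ) 1,
      HasDerivWithinAt z (A (x₀ + t • v) v (z t)) (Icc 0 1) t := by
    intro v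
    by_cases hv : ‖v‖ < r
    -- In the ball of radius `‖Y₀‖` about `Y₀` one has `‖z‖ ≤ 2 * ‖Y₀‖`, so the field is bounded by
    -- `‖Y₀‖` and solutions last for unit time.
    · have hPL : IsPicardLindelof (fun t z => A (x₀ + t • v) v z)
          (⟨0, by simp⟩ : Icc (0 : ℝ) 1) Y₀ ‖Y₀‖₊ 0 ‖Y₀‖₊ 1 := by
        constructor
        · intro t ht
          refine LipschitzOnWith.of_dist_le_mul fun y _ z _ => ?_
          rw [dist_eq_norm, dist_eq_norm, ← map_sub]
          refine ((A (x₀ + t • v) v).le_opNorm _).trans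
            (mul_le_mul_of_nonneg_right ?_ (norm_nonneg _))
          have := hnorm v hv t ht
          simp only [NNReal.coe_one]; linarith
        · intro z _ t ht
          exact (((hline v hv t ht).clm_apply (hasDerivAt_const t v)).clm_apply
            (hasDerivAt_const t z)).continuousAt.continuousWithinAt
        · intro t ht z hz
          have h1 := (A (x₀ + t • v) v).le_opNorm z
          have h2 := hnorm v hv t ht
          have h3 : ‖z‖ ≤ 2 * ‖Y₀‖ := by
            have := norm_sub_norm_le z Y₀
            rw [mem_closedBall, dist_eq_norm] at hz
            simp only [coe_nnnorm] at hz
            linarith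
          have h4 := mul_le_mul h2 h3 (norm_nonneg z) (by norm_num)
          simp only [coe_nnnorm]
          linarith
        · simp
      obtain ⟨z, hz0, hz⟩ := hPL.exists_eq_forall_mem_Icc_hasDerivWithinAt₀
      exact ⟨z, fun _ => ⟨hz0, hz⟩⟩
    · exact ⟨0, fun h => absurd h hv⟩
  choose Z hZ using hex
  have hY0 : Z (x₀ - x₀) 1 = Y₀ := by
    have h0 : ‖x₀ - x₀‖ < r := by simpa using hr0
    have h1 : ∀ t ∈ Ico (0 : ℝ) 1, HasDerivWithinAt (Z (x₀ - x₀)) 0 (Ici t) t := by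
      intro t ht
      have := (hZ _ h0).2 t ⟨ht.1, ht.2.le⟩
      simp only [sub_self, map_zero, zero_apply] at this
      simp only [sub_self]
      exact this.mono_of_mem_nhdsWithin (Icc_mem_nhdsGE_of_mem ht)
    have := constant_of_has_deriv_right_zero
      (fun t ht => ((hZ _ h0).2 t ht).continuousWithinAt) h1 1 ⟨zero_le_one, le_rfl⟩
    rw [this, (hZ _ h0).1]
  have hderiv : ∀ x ∈ ball x₀ r,
      HasFDerivAt (fun x => Z (x - x₀) 1) ((A x).flip (Z (x - x₀) 1)) x := by
    intro x hx
    obtain ⟨v, rfl⟩ : ∃ v, x = x₀ + v := ⟨x - x₀, by abel⟩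
    have hv : ‖v‖ < r := by simpa [dist_eq_norm] using hx
    have hv1 : ‖v‖ ≤ 1 := hv.le.trans hr1
    have hzc : ContinuousOn (Z v) (Icc 0 1) := fun t ht =>
      ((hZ v hv).2 t ht).continuousWithinAt
    obtain ⟨M, hM⟩ := isCompact_Icc.exists_bound_of_continuousOn hzc
    have hM0 : 0 ≤ M := (norm_nonneg _).trans (hM 0 ⟨le_rfl, zero_le_one⟩)
    have key : ∀ h : X, ‖v + h‖ < r →
        ‖Z (v + h) 1 - (Z v 1 + A (x₀ + v) h (Z v 1))‖
          ≤ ((2 * C + 2 * C ^ 2) * M * (Real.exp 1 - 1)) * ‖h‖ ^ 2 := by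
      intro h hw
      -- The first-order prediction for the solution along the ray `v + h`, built from the solution
      -- along `v`.
      set g : ℝ → E := fun t => Z v t + t • A (x₀ + t • v) h (Z v t) with hg
      set g' : ℝ → E := fun t => A (x₀ + t • v) v (Z v t) +
        (t • (fderiv ℝ A (x₀ + t • v) v h (Z v t)
          + A (x₀ + t • v) h (A (x₀ + t • v) v (Z v t))) + A (x₀ + t • v) h (Z v t)) with hg'
      have hgd : ∀ t ∈ Icc (0 : ℝ) 1, HasDerivWithinAt g (g' t) (Icc 0 1) t := by
        intro t ht
        have h1 := (hZ v hv).2 t ht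
        have h2 := (((hline v hv t ht).clm_apply (hasDerivAt_const t h)).hasDerivWithinAt
          (s := Icc 0 1)).clm_apply h1
        have h3 := h1.add ((hasDerivWithinAt_id t (Icc 0 1)).smul h2)
        refine h3.congr_deriv ?_
        simp [hg']
      have hwd := (hZ (v + h) hw).2
      -- Grönwall: `g` solves the equation of the ray `v + h` up to an error of order `‖h‖ ^ 2`,
      -- with the same initial value, so the endpoints differ by the same order.
      have hgr := dist_le_of_approx_trajectories_ODE_of_mem (a := 0) (b := 1) (K := 1)
        (v := fun t z => A (x₀ + t • (v + h)) (v + h) z) (s := fun _ => univ)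
        (f := Z (v + h)) (f' := fun t => A (x₀ + t • (v + h)) (v + h) (Z (v + h) t))
        (g := g) (g' := g') (εf := 0) (εg := (2 * C + 2 * C ^ 2) * M * ‖h‖ ^ 2) (δ := 0)
        ?_ ?_ ?_ ?_ ?_ ?_ ?_ ?_ ?_ ?_ 1 ⟨zero_le_one, le_rfl⟩
      · rw [gronwallBound_of_K_ne_0 (by simp), dist_eq_norm] at hgr
        simp only [hg, one_smul, NNReal.coe_one] at hgr
        refine hgr.trans (le_of_eq ?_)
        simp; ring
      · intro t ht
        refine LipschitzOnWith.of_dist_le_mul fun y _ z _ => ?_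
        rw [dist_eq_norm, dist_eq_norm, ← map_sub]
        refine ((A (x₀ + t • (v + h)) (v + h)).le_opNorm _).trans
          (mul_le_mul_of_nonneg_right ?_ (norm_nonneg _))
        have := hnorm (v + h) hw t ⟨ht.1, ht.2.le⟩
        simp only [NNReal.coe_one]; linarith
      · exact fun t ht => (hwd t ht).continuousWithinAt
      · exact fun t ht => (hwd t ⟨ht.1, ht.2.le⟩).mono_of_mem_nhdsWithin
          (Icc_mem_nhdsGE_of_mem ht)
      · intro t _; simp
      · intro t _; trivial
      · exact fun t ht => (hgd t ht).continuousWithinAt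
      · exact fun t ht => (hgd t ⟨ht.1, ht.2.le⟩).mono_of_mem_nhdsWithin
          (Icc_mem_nhdsGE_of_mem ht)
      · intro t ht'
        have ht : t ∈ Icc (0 : ℝ) 1 := ⟨ht'.1, ht'.2.le⟩
        have hy := hmem v hv t ht
        have hyw := hmem (v + h) hw t ht
        have hfl := hflat _ (hεU hy) v h (Z v t)
        have hdiff : x₀ + t • (v + h) - (x₀ + t • v) = t • h := by rw [smul_add]; abel
        have hth : ‖t • h‖ ≤ ‖h‖ := by
          rw [norm_smul, Real.norm_of_nonneg ht.1]
          exact mul_le_of_le_one_left (norm_nonneg _) ht.2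
        have q1 := hb1 _ hy _ hyw
        have q2 := hb2 _ hy _ hyw
        have qB := hb0 _ hyw
        have qA := hb0 _ hy
        have qz := hM t ht
        rw [hdiff] at q1 q2
        rw [dist_eq_norm]
        simp only [hg, hg']
        generalize hAy : A (x₀ + t • v) = Ay at *
        generalize hBy : A (x₀ + t • (v + h)) = By at *
        generalize hDy : fderiv ℝ A (x₀ + t • v) = Dy at *
        generalize hz : Z v t = z at *
        -- Flatness exchanges `v` and `h` in the derivative term. Every remaining term is then
        -- quadratic in `h`.
        have e : Ay v z + (t • (Dy v h z + Ay h (Ay v z)) + Ay h z)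
            - By (v + h) (z + t • Ay h z)
            = -((By - Ay - Dy (t • h)) v z) - (By - Ay) h z
              - t • (By - Ay) v (Ay h z) - t • By h (Ay h z) := by
          have hfl' : Dy v h z + Ay h (Ay v z) = Dy h v z + Ay v (Ay h z) := by
            rw [← sub_eq_zero]
            rw [← sub_eq_zero] at hfl
            rw [← hfl]; abel
          rw [hfl']
          simp only [map_add, map_smul, add_apply,
            sub_apply, smul_apply, smul_add, smul_sub]
          abel
        rw [e]
        have op : ∀ (L : X →L[ℝ] E →L[ℝ] E) (u : X) (y : E), ‖L u y‖ ≤ ‖L‖ * ‖u‖ * ‖y‖ :=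
          fun L u y => L.le_opNorm₂ u y
        have hh := norm_nonneg h
        have n1 : ‖By - Ay‖ ≤ C * ‖h‖ := q1.trans (mul_le_mul_of_nonneg_left hth hC)
        have n2 : ‖By - Ay - Dy (t • h)‖ ≤ C * ‖h‖ ^ 2 :=
          q2.trans (mul_le_mul_of_nonneg_left (pow_le_pow_left₀ (norm_nonneg _) hth 2) hC)
        have n3 : ‖Ay h z‖ ≤ C * ‖h‖ * M :=
          (op _ _ _).trans (mul_le_mul (mul_le_mul_of_nonneg_right qA hh) qz (norm_nonneg _)
            (by positivity))
        have p1 : ‖(By - Ay - Dy (t • h)) v z‖ ≤ C * ‖h‖ ^ 2 * 1 * M :=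
          (op _ _ _).trans (mul_le_mul (mul_le_mul n2 hv1 (norm_nonneg _) (by positivity)) qz
            (norm_nonneg _) (by positivity))
        have p2 : ‖(By - Ay) h z‖ ≤ C * ‖h‖ * ‖h‖ * M :=
          (op _ _ _).trans (mul_le_mul (mul_le_mul_of_nonneg_right n1 hh) qz
            (norm_nonneg _) (by positivity))
        have p3 : ‖t • (By - Ay) v (Ay h z)‖ ≤ C * ‖h‖ * 1 * (C * ‖h‖ * M) := by
          rw [norm_smul, Real.norm_of_nonneg ht.1]
          refine (mul_le_of_le_one_left (norm_nonneg _) ht.2).trans ?_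
          exact (op _ _ _).trans (mul_le_mul (mul_le_mul n1 hv1 (norm_nonneg _) (by positivity)) n3
            (norm_nonneg _) (by positivity))
        have p4 : ‖t • By h (Ay h z)‖ ≤ C * ‖h‖ * (C * ‖h‖ * M) := by
          rw [norm_smul, Real.norm_of_nonneg ht.1]
          refine (mul_le_of_le_one_left (norm_nonneg _) ht.2).trans ?_
          exact (op _ _ _).trans (mul_le_mul (mul_le_mul_of_nonneg_right qB hh) n3
            (norm_nonneg _) (by positivity))
        have s1 := norm_sub_le (-((By - Ay - Dy (t • h)) v z) - (By - Ay) h z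
          - t • (By - Ay) v (Ay h z)) (t • By h (Ay h z))
        have s2 := norm_sub_le (-((By - Ay - Dy (t • h)) v z) - (By - Ay) h z)
          (t • (By - Ay) v (Ay h z))
        have s3 := norm_sub_le (-((By - Ay - Dy (t • h)) v z)) ((By - Ay) h z)
        rw [norm_neg] at s3
        refine (s1.trans ?_)
        linarith
      · intro t _; trivial
      · simp [hg, (hZ v hv).1, (hZ (v + h) hw).1]
    have hO : (fun x' => Z (x' - x₀) 1
        - (Z v 1 + A (x₀ + v) (x' - (x₀ + v)) (Z v 1))) =O[nhds (x₀ + v)]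
          fun x' => ‖x' - (x₀ + v)‖ ^ 2 := by
      refine IsBigO.of_bound ((2 * C + 2 * C ^ 2) * M * (Real.exp 1 - 1)) ?_
      filter_upwards [isOpen_ball.mem_nhds hx] with x' hx'
      have hx'' : ‖v + (x' - (x₀ + v))‖ < r := by
        rw [mem_ball, dist_eq_norm] at hx'
        rwa [show v + (x' - (x₀ + v)) = x' - x₀ by abel]
      have := key _ hx''
      rw [show v + (x' - (x₀ + v)) = x' - x₀ by abel] at this
      simpa using this
    have hF := hO.hasFDerivAt (𝕜 := ℝ) one_lt_two
    have hlin : HasFDerivAt (fun x' => Z v 1 + A (x₀ + v) (x' - (x₀ + v)) (Z v 1))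
        ((A (x₀ + v)).flip (Z v 1)) (x₀ + v) := by
      have := ((((A (x₀ + v)).flip (Z v 1)).hasFDerivAt (x := x₀ + v)).sub_const
        (A (x₀ + v) (x₀ + v) (Z v 1))).const_add (Z v 1)
      simpa only [ContinuousLinearMap.flip_apply, map_sub, sub_apply] using this
    have := hF.add hlin
    simp only [add_sub_cancel_left, zero_add] at this ⊢
    refine this.congr_of_eventuallyEq (Eventually.of_forall fun x' => ?_)
    simp
  refine ⟨r, hr0, (ball_subset_ball hrε).trans hεU, fun x => Z (x - x₀) 1, hY0, ?_, hderiv⟩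
  rw [contDiffOn_infty]
  intro n
  have hB : IsOpen (ball x₀ r) := isOpen_ball
  have hd : DifferentiableOn ℝ (fun x => Z (x - x₀) 1) (ball x₀ r) := fun x hx =>
    (hderiv x hx).differentiableAt.differentiableWithinAt
  -- Bootstrap: the derivative is `(A x).flip` applied to the solution itself, so it is as regular
  -- as the solution.
  induction n with
  | zero => exact contDiffOn_zero.2 hd.continuousOn
  | succ n ih =>
    rw [show ((n + 1 : ℕ) : WithTop ℕ∞) = (n : WithTop ℕ∞) + 1 by norm_cast,
      contDiffOn_succ_iff_fderiv_of_isOpen hB]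
    refine ⟨hd, by simp, ?_⟩
    have h1 : ContDiffOn ℝ n (fun x => (A x).flip (Z (x - x₀) 1)) (ball x₀ r) := by
      have hAn : ContDiffOn ℝ n A (ball x₀ r) :=
        (hA.mono ((ball_subset_ball hrε).trans hεU)).of_le
          (by exact_mod_cast le_top)
      exact contDiffOn_clm_apply.2 fun u => (hAn.clm_apply contDiffOn_const).clm_apply ih
    exact h1.congr fun x hx => (hderiv x hx).fderiv

end FlatSystem

/-! ### Adapted coordinates -/

section Coordinates

variable {U : Set R4}

/-- Flat linear systems of partial differential equations, in components. -/
theorem exists_matrix_solution {n : ℕ} (hU : IsOpen U)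
    {M : Fin 4 → R4 → Matrix (Fin n) (Fin n) ℝ} (hM : ∀ c, MSmooth U (M c))
    (hflat : ∀ x ∈ U, ∀ c d, mpd c (M d) x - mpd d (M c) x = M c x * M d x - M d x * M c x)
    {x₀ : R4} (hx₀ : x₀ ∈ U) (Y₀ : Fin n → ℝ) :
    ∃ r > 0, Metric.ball x₀ r ⊆ U ∧ ∃ Y : R4 → Fin n → ℝ, Y x₀ = Y₀ ∧
      (∀ i, ContDiffOn ℝ ∞ (fun x => Y x i) (Metric.ball x₀ r)) ∧
      ∀ x ∈ Metric.ball x₀ r, ∀ c i, pd c (fun y => Y y i) x = ((M c x).mulVec (Y x)) i := by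
  set A : R4 → R4 →L[ℝ] (Fin n → ℝ) →L[ℝ] (Fin n → ℝ) := fun x => ∑ c, ∑ i, ∑ j,
    M c x i j • (EuclideanSpace.proj (𝕜 := ℝ) c : R4 →L[ℝ] ℝ).smulRight
      ((ContinuousLinearMap.proj (R := ℝ) (φ := fun _ : Fin n => ℝ) j).smulRight
        (Pi.single i (1 : ℝ) : Fin n → ℝ)) with hA
  have hAv : ∀ x v z k, A x v z k = ∑ c, v c * ((M c x).mulVec z) k := by
    intro x v z k
    simp only [hA, sum_apply, smul_apply, ContinuousLinearMap.smulRight_apply,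
      Finset.sum_apply, Pi.smul_apply, smul_eq_mul, Matrix.mulVec, dotProduct, Finset.mul_sum,
      ContinuousLinearMap.proj_apply, PiLp.proj_apply]
    refine Finset.sum_congr rfl fun c _ => ?_
    rw [Finset.sum_eq_single k]
    · exact Finset.sum_congr rfl fun j _ => by simp; ring
    · intro i _ hik
      exact Finset.sum_eq_zero fun j _ => by simp [hik.symm]
    · simp
  have hAs : ContDiffOn ℝ ∞ A U := by
    refine contDiffOn_clm_apply.2 fun v => contDiffOn_clm_apply.2 fun z => contDiffOn_pi.2 fun k => ?_
    simp only [hAv, Matrix.mulVec, dotProduct]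
    exact ContDiffOn.sum fun c _ => contDiffOn_const.mul
      (ContDiffOn.sum fun j _ => (hM c k j).mul contDiffOn_const)
  have hAd : ∀ x ∈ U, DifferentiableAt ℝ A x := fun x hx =>
    (hAs.contDiffAt (hU.mem_nhds hx)).differentiableAt (by simp)
  have hmv : ∀ x ∈ U, ∀ c z k, DifferentiableAt ℝ (fun y => ((M c y).mulVec z) k) x :=
    fun x hx c z k => by
      simp only [Matrix.mulVec, dotProduct]
      exact DifferentiableAt.fun_sum fun j _ => ((hM c).diff hU hx k j).mul_const _
  have hpd : ∀ x ∈ U, ∀ d c z k, pd d (fun y => ((M c y).mulVec z) k) x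
      = ((mpd d (M c) x).mulVec z) k := by
    intro x hx d c z k
    have h1 := pd_sum d Finset.univ (f := fun j y => M c y k j * z j) (x := x) fun j _ =>
      ((hM c).diff hU hx k j).mul_const _
    refine h1.trans (Finset.sum_congr rfl fun j _ => ?_)
    rw [pd_mul d ((hM c).diff hU hx k j) (differentiableAt_const _), pd_const, mul_zero, add_zero]
    rfl
  have hA' : ∀ x ∈ U, ∀ u v z k, fderiv ℝ A x u v z k
      = ∑ d, ∑ c, u d * v c * ((mpd d (M c) x).mulVec z) k := by
    intro x hx u v z k
    have h1 : HasFDerivAt (fun y => A y v z k)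
        ((ContinuousLinearMap.proj (R := ℝ) (φ := fun _ : Fin n => ℝ) k).comp
          (((fderiv ℝ A x).flip v).flip z)) x := by
      have h2 := ((hAd x hx).hasFDerivAt.clm_apply (hasFDerivAt_const v x)).clm_apply
        (hasFDerivAt_const z x)
      have h3 := (ContinuousLinearMap.proj (R := ℝ) (φ := fun _ : Fin n => ℝ) k).hasFDerivAt
        (x := A x v z) |>.comp x h2
      refine h3.congr_fderiv ?_
      ext w
      simp
    have h2 : fderiv ℝ A x u v z k = fderiv ℝ (fun y => A y v z k) x u := by
      rw [h1.fderiv]; rfl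
    rw [h2, fderiv_eq_sum_pd]
    refine Finset.sum_congr rfl fun d _ => ?_
    simp only [hAv]
    rw [pd_sum d Finset.univ fun c _ => (hmv x hx c z k).const_mul _, Finset.mul_sum]
    refine Finset.sum_congr rfl fun c _ => ?_
    rw [pd_const_mul d _ (hmv x hx c z k), hpd x hx]; ring
  have hAA : ∀ x u v z k, A x u (A x v z) k
      = ∑ d, ∑ c, u d * v c * ((M d x * M c x).mulVec z) k := by
    intro x u v z k
    have e : A x v z = ∑ c, v c • (M c x).mulVec z := by
      ext k; rw [hAv]; simp
    rw [hAv]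
    refine Finset.sum_congr rfl fun d _ => ?_
    rw [e, Matrix.mulVec_sum, Finset.sum_apply, Finset.mul_sum]
    refine Finset.sum_congr rfl fun c _ => ?_
    rw [Matrix.mulVec_smul, Matrix.mulVec_mulVec, Pi.smul_apply, smul_eq_mul]; ring
  obtain ⟨r, hr, hrU, Y, hY0, hYs, hY⟩ := exists_flat_solution hU hAs (fun x hx u v z => by
    ext k
    rw [Pi.sub_apply, Pi.sub_apply, hA' x hx, hA' x hx, hAA, hAA]
    rw [Finset.sum_comm (f := fun d c => v d * u c * ((mpd d (M c) x).mulVec z) k),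
      Finset.sum_comm (f := fun d c => v d * u c * ((M d x * M c x).mulVec z) k),
      ← Finset.sum_sub_distrib, ← Finset.sum_sub_distrib]
    refine Finset.sum_congr rfl fun d _ => ?_
    rw [← Finset.sum_sub_distrib, ← Finset.sum_sub_distrib]
    refine Finset.sum_congr rfl fun c _ => ?_
    have h1 := congrArg (fun W : Matrix (Fin n) (Fin n) ℝ => W.mulVec z k) (hflat x hx d c)
    simp only [Matrix.sub_mulVec, Pi.sub_apply] at h1
    linear_combination (u d * v c) * h1) hx₀ Y₀
  refine ⟨r, hr, hrU, Y, hY0, fun i => contDiffOn_pi.1 hYs i, fun x hx c i => ?_⟩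
  have h1 := ((ContinuousLinearMap.proj (R := ℝ) (φ := fun _ : Fin n => ℝ) i).hasFDerivAt
    (x := Y x)).comp x (hY x hx)
  have h2 : pd c (fun y => Y y i) x = A x (EuclideanSpace.single c 1) (Y x) i := by
    rw [pd, show (fun y => Y y i) = (ContinuousLinearMap.proj (R := ℝ)
      (φ := fun _ : Fin n => ℝ) i) ∘ Y from rfl, h1.fderiv]
    rfl
  rw [h2, hAv, Finset.sum_eq_single c]
  · simp
  · intro d _ hdc; simp [hdc]
  · simp

end Coordinates

/-! ### Coordinates on the two surfaces. -/

section SurfaceCoordinates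

variable {U : Set R4} {Θ : R4 → Matrix (Fin 4) (Fin 4) ℝ} {α ν : Fin 4 → R4 → ℝ} {ρ₁ ρ₂ : ℝ}

/-- Closed 1-forms are locally exact. -/
theorem exists_potential (hU : IsOpen U) {w : Fin 4 → R4 → ℝ} (hw : ∀ c, ContDiffOn ℝ ∞ (w c) U)
    (hcl : ∀ x ∈ U, ∀ c d, pd c (w d) x = pd d (w c) x) {x₀ : R4} (hx₀ : x₀ ∈ U) :
    ∃ r > 0, Metric.ball x₀ r ⊆ U ∧ ∃ f : R4 → ℝ, ContDiffOn ℝ ∞ f (Metric.ball x₀ r) ∧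
      ∀ x ∈ Metric.ball x₀ r, ∀ c, pd c f x = w c x := by
  have hz : ∀ (c : Fin 4) (x : R4), pd c (fun _ => (0 : ℝ)) x = 0 := fun c x => pd_const c 0 x
  -- A nilpotent system: the second component stays equal to 1, so the first is a primitive of `w`.
  obtain ⟨r, hr, hrU, Y, hY0, hYs, hY⟩ := exists_matrix_solution hU
    (M := fun c x => !![0, w c x; 0, 0])
    (by
      intro c i j
      fin_cases i <;> fin_cases j <;>
        first
          | exact contDiffOn_const
          | exact hw c)
    (by
      intro x hx c d
      have := hcl x hx c d
      ext i j
      fin_cases i <;> fin_cases j <;> simp [mpd, hz]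
      exact sub_eq_zero.2 this) hx₀ ![0, 1]
  have hY1 : ∀ x ∈ Metric.ball x₀ r, Y x 1 = 1 := by
    intro x hx
    rw [eq_of_pd_eq_zero (hYs 1) (fun y hy c => ?_) hx, hY0]
    · rfl
    · rw [hY y hy]; simp [Matrix.mulVec, dotProduct, Fin.sum_univ_two]
  refine ⟨r, hr, hrU, fun x => Y x 0, hYs 0, fun x hx c => ?_⟩
  rw [hY x hx]
  simp [Matrix.mulVec, dotProduct, Fin.sum_univ_two, hY1 x hx]

/-- Coordinates `(u, r)` on the Lorentzian factor. -/
theorem IsProductCoframe.exists_lorentzian_coords (h : IsProductCoframe Θ α ν ρ₁ ρ₂ U)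
    (hU : IsOpen U) {x₀ : R4} (hx₀ : x₀ ∈ U) {s : ℝ} (hs : 2 * s ^ 2 = 1) :
    ∃ r > 0, Metric.ball x₀ r ⊆ U ∧ ∃ a b u : R4 → ℝ,
      ContDiffOn ℝ ∞ a (Metric.ball x₀ r) ∧ ContDiffOn ℝ ∞ b (Metric.ball x₀ r) ∧
      ContDiffOn ℝ ∞ u (Metric.ball x₀ r) ∧ ∀ x ∈ Metric.ball x₀ r, a x ≠ 0 ∧ ∀ c,
        pd c u x = s * (Θ x 0 c + Θ x 1 c) / a x ^ 2 ∧
        pd c (fun y => a y * b y) x = ρ₁ / 2 * b x ^ 2 * (s * (Θ x 0 c + Θ x 1 c))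
          + a x ^ 2 * (s * (Θ x 0 c - Θ x 1 c)) := by
  have hΘ : ∀ x ∈ U, ∀ i j, DifferentiableAt ℝ (fun y => Θ y i j) x := fun x hx i j =>
    h.smooth.diff hU hx i j
  have hα : ∀ x ∈ U, ∀ c, DifferentiableAt ℝ (α c) x := fun x hx c =>
    (h.smooth_boost c).differentiableAt_of_isOpen hU hx
  have hp : ∀ x ∈ U, ∀ c d, pd c (fun y => s * (Θ y 0 d + Θ y 1 d)) x
      = s * (pd c (fun y => Θ y 0 d) x + pd c (fun y => Θ y 1 d) x) := fun x hx c d => by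
    rw [pd_const_mul c s ((hΘ x hx 0 d).fun_add (hΘ x hx 1 d)), pd_add c (hΘ x hx 0 d) (hΘ x hx 1 d)]
  have hm : ∀ x ∈ U, ∀ c d, pd c (fun y => s * (Θ y 0 d - Θ y 1 d)) x
      = s * (pd c (fun y => Θ y 0 d) x - pd c (fun y => Θ y 1 d) x) := fun x hx c d => by
    rw [pd_const_mul c s ((hΘ x hx 0 d).fun_sub (hΘ x hx 1 d)), pd_sub c (hΘ x hx 0 d) (hΘ x hx 1 d)]
  -- With `k = s (θ⁰ + θ¹)` and `l = s (θ⁰ - θ¹)` the system is `da = -α a / 2 + ρ₁ k b / 2`, `db =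
  -- l a + α b / 2`. This is a traceless connection whose flatness is the structure equations of the
  -- surface; the coordinates are `r = a b` and `u` with `du = k / a²`.
  obtain ⟨r, hr, hrU, Y, hY0, hYs, hY⟩ := exists_matrix_solution hU
    (M := fun c x => !![-(1 / 2) * α c x, ρ₁ / 2 * (s * (Θ x 0 c + Θ x 1 c));
      s * (Θ x 0 c - Θ x 1 c), 1 / 2 * α c x])
    (by
      intro c i j
      fin_cases i <;> fin_cases j
      · exact contDiffOn_const.mul (h.smooth_boost c)
      · exact contDiffOn_const.mul (contDiffOn_const.mul ((h.smooth 0 c).add (h.smooth 1 c)))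
      · exact contDiffOn_const.mul ((h.smooth 0 c).sub (h.smooth 1 c))
      · exact contDiffOn_const.mul (h.smooth_boost c))
    (by
      intro x hx c d
      have t0 := h.torsion_zero x hx c d
      have t1 := h.torsion_one x hx c d
      have tc := h.curv_boost x hx c d
      ext i j
      fin_cases i <;> fin_cases j <;>
        simp only [mpd, Matrix.sub_apply, Matrix.mul_apply, Fin.sum_univ_two, Matrix.of_apply,
          Matrix.cons_val', Matrix.cons_val_zero, Matrix.cons_val_one,
          Matrix.cons_val_fin_one, Fin.zero_eta, Fin.mk_one, Fin.isValue]
      · rw [pd_const_mul c _ (hα x hx d), pd_const_mul d _ (hα x hx c)]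
        linear_combination (-(1 / 2)) * tc
          + ρ₁ / 2 * (Θ x 0 c * Θ x 1 d - Θ x 1 c * Θ x 0 d) * hs
      · rw [pd_const_mul c _ (((hΘ x hx 0 d).fun_add (hΘ x hx 1 d)).const_mul s),
          pd_const_mul d _ (((hΘ x hx 0 c).fun_add (hΘ x hx 1 c)).const_mul s), hp x hx, hp x hx]
        linear_combination (ρ₁ / 2 * s) * (t0 + t1)
      · rw [hm x hx, hm x hx]
        linear_combination s * (t0 - t1)
      · rw [pd_const_mul c _ (hα x hx d), pd_const_mul d _ (hα x hx c)]
        linear_combination (1 / 2) * tc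
          - ρ₁ / 2 * (Θ x 0 c * Θ x 1 d - Θ x 1 c * Θ x 0 d) * hs) hx₀ ![1, 0]
  -- shrink so that the first component does not vanish
  have hne : ∀ᶠ x in nhds x₀, Y x 0 ≠ 0 := by
    have hc : ContinuousAt (fun x => Y x 0) x₀ :=
      ((hYs 0).differentiableAt_of_isOpen Metric.isOpen_ball
        (Metric.mem_ball_self hr)).continuousAt
    refine hc.eventually_ne ?_
    rw [hY0]; simp
  obtain ⟨r₁, hr₁, hr₁s⟩ := Metric.mem_nhds_iff.1
    (Filter.inter_mem (Metric.ball_mem_nhds x₀ hr) hne)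
  have hB : Metric.ball x₀ r₁ ⊆ Metric.ball x₀ r := fun x hx => (hr₁s hx).1
  have ha0 : ∀ x ∈ Metric.ball x₀ r₁, Y x 0 ≠ 0 := fun x hx => (hr₁s hx).2
  have hda : ∀ x ∈ Metric.ball x₀ r, ∀ c, pd c (fun y => Y y 0) x
      = -(1 / 2) * α c x * Y x 0 + ρ₁ / 2 * (s * (Θ x 0 c + Θ x 1 c)) * Y x 1 := by
    intro x hx c
    rw [hY x hx]
    simp [Matrix.mulVec, dotProduct, Fin.sum_univ_two]
  have hdb : ∀ x ∈ Metric.ball x₀ r, ∀ c, pd c (fun y => Y y 1) x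
      = s * (Θ x 0 c - Θ x 1 c) * Y x 0 + 1 / 2 * α c x * Y x 1 := by
    intro x hx c
    rw [hY x hx]
    simp [Matrix.mulVec, dotProduct, Fin.sum_univ_two]
  have hYd : ∀ x ∈ Metric.ball x₀ r, ∀ i, DifferentiableAt ℝ (fun y => Y y i) x := fun x hx i =>
    (hYs i).differentiableAt_of_isOpen Metric.isOpen_ball hx
  have ha2 : ∀ x ∈ Metric.ball x₀ r₁, ∀ c, pd c (fun y => (Y y 0 * Y y 0)⁻¹) x
      = - (2 * (Y x 0 * pd c (fun y => Y y 0) x)) / (Y x 0 * Y x 0) ^ 2 := by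
    intro x hx c
    have h1 := hYd x (hB hx) 0
    rw [pd_inv c (h1.fun_mul h1) (mul_ne_zero (ha0 x hx) (ha0 x hx)), pd_mul c h1 h1]
    ring
  -- `k / a²` is closed: `dk = -α ∧ k`, and the `α` part of `da` compensates for this while its `k`
  -- part drops out.
  obtain ⟨r₂, hr₂, hr₂s, u, hu, hud⟩ := exists_potential (Metric.isOpen_ball (x := x₀) (ε := r₁))
    (w := fun c x => s * (Θ x 0 c + Θ x 1 c) * (Y x 0 * Y x 0)⁻¹)
    (fun c => (contDiffOn_const.mul (((h.smooth 0 c).add (h.smooth 1 c)).mono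
      (hB.trans hrU))).mul (((((hYs 0).mul (hYs 0)).mono hB)).inv fun x hx =>
        mul_ne_zero (ha0 x hx) (ha0 x hx)))
    (by
      intro x hx c d
      have hxU := hrU (hB hx)
      have h1 := hYd x (hB hx) 0
      have hi : DifferentiableAt ℝ (fun y => (Y y 0 * Y y 0)⁻¹) x :=
        (h1.fun_mul h1).fun_inv (mul_ne_zero (ha0 x hx) (ha0 x hx))
      rw [pd_mul c (((hΘ x hxU 0 d).fun_add (hΘ x hxU 1 d)).const_mul s) hi,
        pd_mul d (((hΘ x hxU 0 c).fun_add (hΘ x hxU 1 c)).const_mul s) hi, hp x hxU, hp x hxU,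
        ha2 x hx, ha2 x hx, hda x (hB hx), hda x (hB hx)]
      have t0 := h.torsion_zero x hxU c d
      have t1 := h.torsion_one x hxU c d
      have := ha0 x hx
      field_simp
      linear_combination (s * Y x 0) * (t0 + t1)) (Metric.mem_ball_self hr₁)
  refine ⟨r₂, hr₂, hr₂s.trans (hB.trans hrU), fun x => Y x 0, fun x => Y x 1, u,
    (hYs 0).mono (hr₂s.trans hB), (hYs 1).mono (hr₂s.trans hB), hu, fun x hx =>
    ⟨ha0 x (hr₂s hx), fun c => ⟨?_, ?_⟩⟩⟩
  · rw [hud x hx]; ring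
  · have hxB := hB (hr₂s hx)
    rw [pd_mul c (hYd x hxB 0) (hYd x hxB 1), hda x hxB, hdb x hxB]; ring

/-- The stereographic coordinate `ζ` on the Riemannian factor. -/
theorem IsProductCoframe.exists_riemannian_coords (h : IsProductCoframe Θ α ν ρ₁ ρ₂ U)
    (hU : IsOpen U) {x₀ : R4} (hx₀ : x₀ ∈ U) {s κ : ℝ} (hs : 2 * s ^ 2 = 1)
    (hκ : 2 * κ = ρ₂) :
    ∃ r > 0, Metric.ball x₀ r ⊆ U ∧ ∃ z w p q N : R4 → ℝ,
      ContDiffOn ℝ ∞ z (Metric.ball x₀ r) ∧ ContDiffOn ℝ ∞ w (Metric.ball x₀ r) ∧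
      ∀ x ∈ Metric.ball x₀ r, 0 < N x ∧ p x ^ 2 + q x ^ 2 = N x ^ 2 ∧
        1 + κ * (z x ^ 2 + w x ^ 2) = (N x)⁻¹ ∧ ∀ c,
        pd c z x = (s * Θ x 2 c * p x + s * Θ x 3 c * q x) / N x ^ 2 ∧
        pd c w x = (s * Θ x 2 c * q x - s * Θ x 3 c * p x) / N x ^ 2 := by
  have hΘ : ∀ x ∈ U, ∀ i j, DifferentiableAt ℝ (fun y => Θ y i j) x := fun x hx i j =>
    h.smooth.diff hU hx i j
  have hν : ∀ x ∈ U, ∀ c, DifferentiableAt ℝ (ν c) x := fun x hx c =>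
    (h.smooth_rot c).differentiableAt_of_isOpen hU hx
  have hz : ∀ (c : Fin 4) (x : R4), pd c (fun _ => (0 : ℝ)) x = 0 := fun c x => pd_const c 0 x
  -- With `P = Y₀ + i Y₁` and `Q = Y₂ + i Y₃` this is the complex system `dP = (i/2) ν P - κ s (θ² +
  -- i θ³) Q`, `dQ = s (θ² - i θ³) P - (i/2) ν Q`. It is flat by the structure equations and
  -- conserves `|P|² + κ |Q|²`.
  obtain ⟨r, hr, hrU, Y, hY0, hYs, hY⟩ := exists_matrix_solution hU
    (M := fun c x => !![0, -(1 / 2) * ν c x, -κ * s * Θ x 2 c, κ * s * Θ x 3 c;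
      1 / 2 * ν c x, 0, -κ * s * Θ x 3 c, -κ * s * Θ x 2 c;
      s * Θ x 2 c, s * Θ x 3 c, 0, 1 / 2 * ν c x;
      -s * Θ x 3 c, s * Θ x 2 c, -(1 / 2) * ν c x, 0])
    (by
      intro c i j
      fin_cases i <;> fin_cases j <;>
        first
          | exact contDiffOn_const
          | exact contDiffOn_const.mul (h.smooth_rot c)
          | exact contDiffOn_const.mul (h.smooth 2 c)
          | exact contDiffOn_const.mul (h.smooth 3 c))
    (by
      intro x hx c d
      have t2 := h.torsion_two x hx c d
      have t3 := h.torsion_three x hx c d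
      have tc := h.curv_rot x hx c d
      have pc : ∀ k c d, pd c (fun y => k * ν d y) x = k * pd c (ν d) x := fun k c d =>
        pd_const_mul c k (hν x hx d)
      have pΘ : ∀ k c d i, pd c (fun y => k * Θ y i d) x = k * pd c (fun y => Θ y i d) x :=
        fun k c d i => pd_const_mul c k (hΘ x hx i d)
      rw [← hκ] at tc
      ext i j
      fin_cases i <;> fin_cases j <;>
        simp only [mpd, Matrix.sub_apply, Matrix.mul_apply, Fin.sum_univ_four, Matrix.of_apply,
          Matrix.cons_val', Matrix.cons_val_zero, Matrix.cons_val_one, Matrix.cons_val,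
          Matrix.cons_val_fin_one, Fin.zero_eta, Fin.mk_one, Fin.isValue, Fin.reduceFinMk,
          hz, pc, pΘ]
      · ring
      · linear_combination (-(1 / 2)) * tc
          + κ * (Θ x 2 c * Θ x 3 d - Θ x 3 c * Θ x 2 d) * hs
      · linear_combination (-κ * s) * t2
      · linear_combination (κ * s) * t3
      · linear_combination (1 / 2) * tc
          - κ * (Θ x 2 c * Θ x 3 d - Θ x 3 c * Θ x 2 d) * hs
      · ring
      · linear_combination (-κ * s) * t3
      · linear_combination (-κ * s) * t2
      · linear_combination s * t2
      · linear_combination s * t3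
      · ring
      · linear_combination (1 / 2) * tc
          - κ * (Θ x 2 c * Θ x 3 d - Θ x 3 c * Θ x 2 d) * hs
      · linear_combination (-s) * t3
      · linear_combination s * t2
      · linear_combination (-(1 / 2)) * tc
          + κ * (Θ x 2 c * Θ x 3 d - Θ x 3 c * Θ x 2 d) * hs
      · ring) hx₀ ![1, 0, 0, 0]
  have d0 : ∀ x ∈ Metric.ball x₀ r, ∀ c, pd c (fun y => Y y 0) x = -(1 / 2) * ν c x * Y x 1
      - κ * s * Θ x 2 c * Y x 2 + κ * s * Θ x 3 c * Y x 3 := by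
    intro x hx c
    rw [hY x hx]
    simp [Matrix.mulVec, dotProduct, Fin.sum_univ_four]; ring
  have d1 : ∀ x ∈ Metric.ball x₀ r, ∀ c, pd c (fun y => Y y 1) x = 1 / 2 * ν c x * Y x 0
      - κ * s * Θ x 3 c * Y x 2 - κ * s * Θ x 2 c * Y x 3 := by
    intro x hx c
    rw [hY x hx]
    simp [Matrix.mulVec, dotProduct, Fin.sum_univ_four]; ring
  have d2 : ∀ x ∈ Metric.ball x₀ r, ∀ c, pd c (fun y => Y y 2) x = s * Θ x 2 c * Y x 0
      + s * Θ x 3 c * Y x 1 + 1 / 2 * ν c x * Y x 3 := by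
    intro x hx c
    rw [hY x hx]
    simp [Matrix.mulVec, dotProduct, Fin.sum_univ_four]
  have d3 : ∀ x ∈ Metric.ball x₀ r, ∀ c, pd c (fun y => Y y 3) x = - s * Θ x 3 c * Y x 0
      + s * Θ x 2 c * Y x 1 - 1 / 2 * ν c x * Y x 2 := by
    intro x hx c
    rw [hY x hx]
    simp [Matrix.mulVec, dotProduct, Fin.sum_univ_four]; ring
  have hYd : ∀ x ∈ Metric.ball x₀ r, ∀ i, DifferentiableAt ℝ (fun y => Y y i) x := fun x hx i =>
    (hYs i).differentiableAt_of_isOpen Metric.isOpen_ball hx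
  -- the conserved norm
  have hcons : ∀ x ∈ Metric.ball x₀ r, Y x 0 * Y x 0 + Y x 1 * Y x 1
      + κ * (Y x 2 * Y x 2 + Y x 3 * Y x 3) = 1 := by
    intro x hx
    refine (eq_of_pd_eq_zero (f := fun x => Y x 0 * Y x 0 + Y x 1 * Y x 1
      + κ * (Y x 2 * Y x 2 + Y x 3 * Y x 3)) ?_ (fun y hy c => ?_) hx).trans (by simp [hY0])
    · exact (((hYs 0).mul (hYs 0)).add ((hYs 1).mul (hYs 1))).add
        (contDiffOn_const.mul (((hYs 2).mul (hYs 2)).add ((hYs 3).mul (hYs 3))))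
    · have y0 := hYd y hy 0
      have y1 := hYd y hy 1
      have y2 := hYd y hy 2
      have y3 := hYd y hy 3
      rw [pd_add c ((y0.fun_mul y0).fun_add (y1.fun_mul y1))
          (((y2.fun_mul y2).fun_add (y3.fun_mul y3)).const_mul κ),
        pd_add c (y0.fun_mul y0) (y1.fun_mul y1),
        pd_const_mul c κ ((y2.fun_mul y2).fun_add (y3.fun_mul y3)),
        pd_add c (y2.fun_mul y2) (y3.fun_mul y3), pd_mul c y0 y0, pd_mul c y1 y1,
        pd_mul c y2 y2, pd_mul c y3 y3, d0 y hy, d1 y hy, d2 y hy, d3 y hy]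
      ring
  have hpos : ∀ᶠ x in nhds x₀, 0 < Y x 0 * Y x 0 + Y x 1 * Y x 1 := by
    have hm := Metric.mem_ball_self (x := x₀) hr
    have hc : ContinuousAt (fun x => Y x 0 * Y x 0 + Y x 1 * Y x 1) x₀ :=
      (((hYd x₀ hm 0).fun_mul (hYd x₀ hm 0)).fun_add
        ((hYd x₀ hm 1).fun_mul (hYd x₀ hm 1))).continuousAt
    refine hc.eventually (lt_mem_nhds ?_)
    beta_reduce
    rw [hY0]; simp
  obtain ⟨r₁, hr₁, hr₁s⟩ := Metric.mem_nhds_iff.1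
    (Filter.inter_mem (Metric.ball_mem_nhds x₀ hr) hpos)
  have hB : Metric.ball x₀ r₁ ⊆ Metric.ball x₀ r := fun x hx => (hr₁s hx).1
  have hN0 : ∀ x ∈ Metric.ball x₀ r₁, 0 < Y x 0 * Y x 0 + Y x 1 * Y x 1 := fun x hx => (hr₁s hx).2
  have hYs' : ∀ i, ContDiffOn ℝ ∞ (fun x => Y x i) (Metric.ball x₀ r₁) := fun i => (hYs i).mono hB
  have hinv : ContDiffOn ℝ ∞ (fun x => (Y x 0 * Y x 0 + Y x 1 * Y x 1)⁻¹) (Metric.ball x₀ r₁) :=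
    (((hYs' 0).mul (hYs' 0)).add ((hYs' 1).mul (hYs' 1))).inv fun x hx => (hN0 x hx).ne'
  -- The witnesses are `z + i w = ζ = Q P / |P|²`, `p + i q = P²` and `N = |P|²`. The conserved norm
  -- gives `1 + κ |ζ|² = 1 / N` and `dζ = s (θ² - i θ³) P² / N²`.
  refine ⟨r₁, hr₁, hB.trans hrU,
    fun x => (Y x 2 * Y x 0 - Y x 3 * Y x 1) * (Y x 0 * Y x 0 + Y x 1 * Y x 1)⁻¹,
    fun x => (Y x 2 * Y x 1 + Y x 3 * Y x 0) * (Y x 0 * Y x 0 + Y x 1 * Y x 1)⁻¹,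
    fun x => Y x 0 * Y x 0 - Y x 1 * Y x 1, fun x => 2 * (Y x 0 * Y x 1),
    fun x => Y x 0 * Y x 0 + Y x 1 * Y x 1,
    (((hYs' 2).mul (hYs' 0)).sub ((hYs' 3).mul (hYs' 1))).mul hinv,
    (((hYs' 2).mul (hYs' 1)).add ((hYs' 3).mul (hYs' 0))).mul hinv, ?_⟩
  intro x hx
  have hxB := hB hx
  have hc := hcons x hxB
  have hN := (hN0 x hx).ne'
  have hN' : Y x 0 ^ 2 + Y x 1 ^ 2 ≠ 0 := by rwa [sq, sq]
  refine ⟨hN0 x hx, by ring, ?_, fun c => ?_⟩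
  · have hi := mul_inv_cancel₀ hN
    linear_combination (κ * (Y x 2 * Y x 2 + Y x 3 * Y x 3)
      * (Y x 0 * Y x 0 + Y x 1 * Y x 1)⁻¹ - 1) * hi + (Y x 0 * Y x 0 + Y x 1 * Y x 1)⁻¹ * hc
  · have y0 := hYd x hxB 0
    have y1 := hYd x hxB 1
    have y2 := hYd x hxB 2
    have y3 := hYd x hxB 3
    have yN := (y0.fun_mul y0).fun_add (y1.fun_mul y1)
    have hdi : pd c (fun y => (Y y 0 * Y y 0 + Y y 1 * Y y 1)⁻¹) x
        = -(2 * (Y x 0 * pd c (fun y => Y y 0) x + Y x 1 * pd c (fun y => Y y 1) x))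
          / (Y x 0 * Y x 0 + Y x 1 * Y x 1) ^ 2 := by
      rw [pd_inv c yN hN, pd_add c (y0.fun_mul y0) (y1.fun_mul y1), pd_mul c y0 y0, pd_mul c y1 y1]
      ring
    constructor
    · rw [pd_mul c ((y2.fun_mul y0).fun_sub (y3.fun_mul y1)) (yN.fun_inv hN), hdi,
        pd_sub c (y2.fun_mul y0) (y3.fun_mul y1), pd_mul c y2 y0, pd_mul c y3 y1,
        d0 x hxB, d1 x hxB, d2 x hxB, d3 x hxB]
      field_simp
      linear_combination 2 * (s * Θ x 2 c * (Y x 0 * Y x 0 - Y x 1 * Y x 1)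
        + s * Θ x 3 c * (2 * (Y x 0 * Y x 1))) * hc
    · rw [pd_mul c ((y2.fun_mul y1).fun_add (y3.fun_mul y0)) (yN.fun_inv hN), hdi,
        pd_add c (y2.fun_mul y1) (y3.fun_mul y0), pd_mul c y2 y1, pd_mul c y3 y0,
        d0 x hxB, d1 x hxB, d2 x hxB, d3 x hxB]
      field_simp
      linear_combination 2 * (s * Θ x 2 c * (2 * (Y x 0 * Y x 1))
        - s * Θ x 3 c * (Y x 0 * Y x 0 - Y x 1 * Y x 1)) * hc

end SurfaceCoordinates

/-! ### Coordinates on a product of surfaces of constant curvature -/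

section ProductCoordinates

variable {G : R4 → Matrix (Fin 4) (Fin 4) ℝ} {U : Set R4}

theorem eigDiag_one_one : eigDiag 1 1 = 1 := by
  ext i j; fin_cases i <;> fin_cases j <;> rfl

/-- The quadratic form of `decomposableMetric`, with its two blocks rescaled by `c₁`, `c₂`. -/
theorem transpose_mul_decomposableMetric_mul (Φ Λ c₁ c₂ : ℝ) (y : R4)
    (J : Matrix (Fin 4) (Fin 4) ℝ) (i j : Fin 4) :
    (J.transpose * (decomposableMetric Φ Λ y * eigDiag c₁ c₂) * J) i j
      = c₁ * (-2 * (Φ - Λ / 2) * y 1 ^ 2 * (J 0 i * J 0 j) - J 0 i * J 1 j - J 1 i * J 0 j)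
        + c₂ * (2 * ((1 + (Φ + Λ / 2) * (y 2 ^ 2 + y 3 ^ 2)) ^ 2)⁻¹)
          * (J 2 i * J 2 j + J 3 i * J 3 j) := by
  simp only [decomposableMetric, eigDiag, Matrix.mul_apply, Fin.sum_univ_four,
    Matrix.transpose_apply, Matrix.of_apply, Matrix.diagonal_apply, Matrix.cons_val',
    Matrix.cons_val_zero, Matrix.cons_val_one, Matrix.cons_val, Matrix.cons_val_fin_one,
    Fin.isValue, Fin.reduceEq, if_true, if_false]
  ring

theorem transpose_mul_minkowski_mul (c₁ c₂ : ℝ) (T : Matrix (Fin 4) (Fin 4) ℝ) (i j : Fin 4) :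
    (T.transpose * (minkowski * eigDiag c₁ c₂) * T) i j
      = c₁ * (T 1 i * T 1 j - T 0 i * T 0 j) + c₂ * (T 2 i * T 2 j + T 3 i * T 3 j) := by
  simp only [minkowski, eigDiag, Matrix.mul_apply, Fin.sum_univ_four,
    Matrix.transpose_apply, Matrix.diagonal_apply,
    Matrix.cons_val_zero, Matrix.cons_val_one, Matrix.cons_val,
    Fin.isValue, Fin.reduceEq, if_true, if_false]
  ring

/-- Local coordinates bringing the metric to the form `decomposableMetric Φ Λ`. -/
theorem IsCodazziPair.exists_coords (h : IsCodazziPair G U) {x₀ : R4} (hx₀ : x₀ ∈ U) {Φ Λ : ℝ}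
    (hΦ : Φ ≠ 0) {E₀ : Matrix (Fin 4) (Fin 4) ℝ}
    (hE₀ : IsEigenTetrad (G x₀) (ricci G x₀) E₀ (Λ - 2 * Φ) (Λ + 2 * Φ)) :
    ∃ r > 0, Metric.ball x₀ r ⊆ U ∧ ∃ φ : R4 → R4,
      (∀ a, ContDiffOn ℝ ∞ (fun y => φ y a) (Metric.ball x₀ r)) ∧ ∀ x ∈ Metric.ball x₀ r,
        0 < 1 + (Φ + Λ / 2) * (φ x 2 ^ 2 + φ x 3 ^ 2) ∧
        G x = (jacobian φ x).transpose * decomposableMetric Φ Λ (φ x) * jacobian φ x ∧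
        ricci G x = (jacobian φ x).transpose *
          (decomposableMetric Φ Λ (φ x) * eigDiag (Λ - 2 * Φ) (Λ + 2 * Φ)) * jacobian φ x := by
  have hne : Λ - 2 * Φ ≠ Λ + 2 * Φ := fun h0 => hΦ (by linarith)
  obtain ⟨ε, hε, hεU, E, hEs, hE⟩ := h.exists_frame hx₀ hne hE₀
  have hB : IsOpen (Metric.ball x₀ ε) := Metric.isOpen_ball
  obtain ⟨Θ, α, ν, hΘ, hGΘ⟩ := (h.toMetricOn.mono hB hεU).exists_isProductCoframe
    (fun x hx c => (h.covM_ricci (hεU hx)).1 c) hEs hne hE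
  obtain ⟨s, hs⟩ : ∃ s : ℝ, 2 * s ^ 2 = 1 :=
    ⟨(√2)⁻¹, by rw [inv_pow, Real.sq_sqrt zero_le_two]; norm_num⟩
  have hm := Metric.mem_ball_self (x := x₀) hε
  obtain ⟨r₁, hr₁, hr₁ε, a, b, u, ha, hb, hu, hab⟩ := hΘ.exists_lorentzian_coords hB hm hs
  obtain ⟨r₂, hr₂, hr₂ε, z, w, p, q, N, hz, hw, hzw⟩ :=
    hΘ.exists_riemannian_coords (κ := Φ + Λ / 2) hB hm hs (by ring)
  have hs₁ : Metric.ball x₀ (min r₁ r₂) ⊆ Metric.ball x₀ r₁ :=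
    Metric.ball_subset_ball (min_le_left _ _)
  have hs₂ : Metric.ball x₀ (min r₁ r₂) ⊆ Metric.ball x₀ r₂ :=
    Metric.ball_subset_ball (min_le_right _ _)
  refine ⟨min r₁ r₂, lt_min hr₁ hr₂, hs₁.trans (hr₁ε.trans hεU),
    fun x => WithLp.toLp 2 ![u x, a x * b x, z x, w x], fun i => ?_, fun x hx => ?_⟩
  · fin_cases i
    · exact hu.mono hs₁
    · exact (ha.mul hb).mono hs₁
    · exact hz.mono hs₂
    · exact hw.mono hs₂
  obtain ⟨ha0, hL⟩ := hab x (hs₁ hx)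
  obtain ⟨hN, hpq, hzN, hR⟩ := hzw x (hs₂ hx)
  -- The two planes are weighted independently, so one identity covers the metric (weights 1, 1) and
  -- the Ricci tensor (the two eigenvalues).
  have key : ∀ c₁ c₂ : ℝ,
      (jacobian (fun x => WithLp.toLp 2 ![u x, a x * b x, z x, w x]) x).transpose *
        (decomposableMetric Φ Λ (WithLp.toLp 2 ![u x, a x * b x, z x, w x]) * eigDiag c₁ c₂) *
        jacobian (fun x => WithLp.toLp 2 ![u x, a x * b x, z x, w x]) x
      = (Θ x).transpose * (minkowski * eigDiag c₁ c₂) * Θ x := by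
    intro c₁ c₂
    ext i j
    rw [transpose_mul_decomposableMetric_mul, transpose_mul_minkowski_mul]
    have j0 : ∀ i, jacobian (fun x => WithLp.toLp 2 ![u x, a x * b x, z x, w x]) x 0 i
        = s * (Θ x 0 i + Θ x 1 i) / a x ^ 2 := fun i => (hL i).1
    have j1 : ∀ i, jacobian (fun x => WithLp.toLp 2 ![u x, a x * b x, z x, w x]) x 1 i
        = _ := fun i => (hL i).2
    have j2 : ∀ i, jacobian (fun x => WithLp.toLp 2 ![u x, a x * b x, z x, w x]) x 2 i
        = _ := fun i => (hR i).1
    have j3 : ∀ i, jacobian (fun x => WithLp.toLp 2 ![u x, a x * b x, z x, w x]) x 3 i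
        = _ := fun i => (hR i).2
    have hd : (1 + (Φ + Λ / 2) * ((WithLp.toLp 2 ![u x, a x * b x, z x, w x] : R4) 2 ^ 2
        + (WithLp.toLp 2 ![u x, a x * b x, z x, w x] : R4) 3 ^ 2)) = (N x)⁻¹ := hzN
    have h1 : (WithLp.toLp 2 ![u x, a x * b x, z x, w x] : R4) 1 = a x * b x := rfl
    rw [hd, h1]
    simp only [j0, j1, j2, j3]
    have e1 : -2 * (Φ - Λ / 2) * (a x * b x) ^ 2
          * (s * (Θ x 0 i + Θ x 1 i) / a x ^ 2 * (s * (Θ x 0 j + Θ x 1 j) / a x ^ 2))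
        - s * (Θ x 0 i + Θ x 1 i) / a x ^ 2
          * ((Λ - 2 * Φ) / 2 * b x ^ 2 * (s * (Θ x 0 j + Θ x 1 j))
            + a x ^ 2 * (s * (Θ x 0 j - Θ x 1 j)))
        - ((Λ - 2 * Φ) / 2 * b x ^ 2 * (s * (Θ x 0 i + Θ x 1 i))
            + a x ^ 2 * (s * (Θ x 0 i - Θ x 1 i))) * (s * (Θ x 0 j + Θ x 1 j) / a x ^ 2)
        = Θ x 1 i * Θ x 1 j - Θ x 0 i * Θ x 0 j := by
      field_simp
      linear_combination (2 * a x ^ 2) * (Θ x 1 i * Θ x 1 j - Θ x 0 i * Θ x 0 j) * hs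
    have e2 : (2 * ((N x)⁻¹ ^ 2)⁻¹)
        * ((s * Θ x 2 i * p x + s * Θ x 3 i * q x) / N x ^ 2
            * ((s * Θ x 2 j * p x + s * Θ x 3 j * q x) / N x ^ 2)
          + (s * Θ x 2 i * q x - s * Θ x 3 i * p x) / N x ^ 2
            * ((s * Θ x 2 j * q x - s * Θ x 3 j * p x) / N x ^ 2))
        = Θ x 2 i * Θ x 2 j + Θ x 3 i * Θ x 3 j := by
      have hN' := hN.ne'
      field_simp
      linear_combination (Θ x 2 i * Θ x 2 j + Θ x 3 i * Θ x 3 j) * (2 * s ^ 2 * hpq + N x ^ 2 * hs)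
    rw [e1, mul_assoc c₂, e2]
  refine ⟨?_, ?_, ?_⟩
  · refine lt_of_lt_of_eq (inv_pos.2 hN) hzN.symm
  · have := key 1 1
    rw [eigDiag_one_one, mul_one, mul_one] at this
    rw [this]
    exact (hGΘ x (hr₁ε (hs₁ hx))).1
  · rw [key]
    exact (hGΘ x (hr₁ε (hs₁ hx))).2

end ProductCoordinates

/-! ### Electromagnetic sources -/

section Electromagnetic

variable {G : R4 → Matrix (Fin 4) (Fin 4) ℝ} {V : Set R4} {Φ Λ : ℝ} {x : R4}

/-- The factor `2 (1 + (Φ + Λ/2) ζ ζ̄)⁻²`. -/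
def confFactor (Φ Λ : ℝ) (x : R4) : ℝ :=
  2 * ((1 + (Φ + Λ / 2) * (x 2 ^ 2 + x 3 ^ 2)) ^ 2)⁻¹

theorem confFactor_pos (hx : 0 < 1 + (Φ + Λ / 2) * (x 2 ^ 2 + x 3 ^ 2)) :
    0 < confFactor Φ Λ x := by
  unfold confFactor; positivity

theorem decomposableMetric_eq (Φ Λ : ℝ) (x : R4) : decomposableMetric Φ Λ x =
    !![(Λ - 2 * Φ) * x 1 ^ 2, -1, 0, 0; -1, 0, 0, 0;
      0, 0, confFactor Φ Λ x, 0; 0, 0, 0, confFactor Φ Λ x] := by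
  rw [show Λ - 2 * Φ = -2 * (Φ - Λ / 2) by ring]; rfl

theorem decomposableMetric_inv (hx : 0 < 1 + (Φ + Λ / 2) * (x 2 ^ 2 + x 3 ^ 2)) :
    (decomposableMetric Φ Λ x)⁻¹ = !![0, -1, 0, 0; -1, -((Λ - 2 * Φ) * x 1 ^ 2), 0, 0;
      0, 0, (confFactor Φ Λ x)⁻¹, 0; 0, 0, 0, (confFactor Φ Λ x)⁻¹] := by
  have := (confFactor_pos hx).ne'
  rw [decomposableMetric_eq]
  refine Matrix.inv_eq_right_inv ?_
  ext i j
  fin_cases i <;> fin_cases j <;> simp [Matrix.mul_apply, Fin.sum_univ_four, this]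

theorem pd_eq_zero_of_forall_add {c : Fin 4} {f : R4 → ℝ} (x : R4)
    (h : ∀ t : ℝ, f (x + t • EuclideanSpace.single c 1) = f x) : pd c f x = 0 := by
  by_cases hf : DifferentiableAt ℝ f x
  · rw [pd, ← hf.lineDeriv_eq_fderiv, lineDeriv]
    simp only [h, deriv_const]
  -- Without differentiability `fderiv` is zero by convention.
  · simp [pd, fderiv_zero_of_not_differentiableAt hf]

/-- The only nonvanishing derivatives of the components of `decomposableMetric`. -/
theorem mpd_decomposableMetric (Φ Λ : ℝ) (x : R4) : ∃ A H : Fin 4 → ℝ,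
    A 0 = 0 ∧ A 2 = 0 ∧ A 3 = 0 ∧ H 0 = 0 ∧ H 1 = 0 ∧
    ∀ c, mpd c (decomposableMetric Φ Λ) x
      = !![A c, 0, 0, 0; 0, 0, 0, 0; 0, 0, H c, 0; 0, 0, 0, H c] := by
  have hA : ∀ c : Fin 4, c ≠ 1 → pd c (fun y => (Λ - 2 * Φ) * y 1 ^ 2) x = 0 := fun c hc =>
    pd_eq_zero_of_forall_add x fun t => by simp [hc.symm]
  have hH : ∀ c : Fin 4, c ≠ 2 → c ≠ 3 → pd c (confFactor Φ Λ) x = 0 := fun c h2 h3 =>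
    pd_eq_zero_of_forall_add x fun t => by simp [confFactor, h2.symm, h3.symm]
  refine ⟨fun c => pd c (fun y => (Λ - 2 * Φ) * y 1 ^ 2) x, fun c => pd c (confFactor Φ Λ) x,
    hA 0 (by decide), hA 2 (by decide), hA 3 (by decide), hH 0 (by decide) (by decide),
    hH 1 (by decide) (by decide), fun c => ?_⟩
  rw [funext (decomposableMetric_eq Φ Λ)]
  ext i j
  fin_cases i <;> fin_cases j <;> first | rfl | exact pd_const c _ x

/-- The constant field `E du ∧ dr`. -/
def electricField (E : ℝ) : Matrix (Fin 4) (Fin 4) ℝ :=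
  !![0, E, 0, 0; -E, 0, 0, 0; 0, 0, 0, 0; 0, 0, 0, 0]

theorem fieldInvariant_electricField (hG : G x = decomposableMetric Φ Λ x)
    (hx : 0 < 1 + (Φ + Λ / 2) * (x 2 ^ 2 + x 3 ^ 2)) (E : ℝ) :
    fieldInvariant G (fun _ => electricField E) x = -(2 * E ^ 2) := by
  simp only [fieldInvariant, hG, decomposableMetric_inv hx, electricField, Fin.sum_univ_four,
    Matrix.of_apply, Matrix.cons_val', Matrix.cons_val_zero, Matrix.cons_val_one, Matrix.cons_val,
    Matrix.cons_val_fin_one, Fin.isValue, mul_zero, zero_mul, add_zero, zero_add]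
  ring

/-- This has the shape of the trace-free Ricci tensor, namely the metric with its sign reversed on
the first plane. -/
theorem emStress_electricField (hG : G x = decomposableMetric Φ Λ x)
    (hx : 0 < 1 + (Φ + Λ / 2) * (x 2 ^ 2 + x 3 ^ 2)) (E : ℝ) :
    emStress G (fun _ => electricField E) x
      = (E ^ 2 / 2) • (decomposableMetric Φ Λ x * eigDiag (-1) 1) := by
  ext i j
  simp only [emStress, fieldInvariant_electricField hG hx, Matrix.of_apply,
    Matrix.smul_apply, smul_eq_mul, eigDiag, Matrix.mul_diagonal]
  rw [hG, decomposableMetric_inv hx, decomposableMetric_eq]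
  fin_cases i <;> fin_cases j <;>
    simp [electricField, Fin.sum_univ_four] <;> ring

/-- The Lorentzian block has determinant `-1`, so `du ∧ dr` is an area form of that factor and is
parallel. -/
theorem coclosed_electricField (hV : IsOpen V) (hG : ∀ x ∈ V, G x = decomposableMetric Φ Λ x)
    (hxV : x ∈ V) (hx : 0 < 1 + (Φ + Λ / 2) * (x 2 ^ 2 + x 3 ^ 2)) (E : ℝ) (b : Fin 4) :
    ∑ a, ∑ c, (G x)⁻¹ a c * covDeriv G (fun _ => electricField E) c a b x = 0 := by
  obtain ⟨A, H, A0, A2, A3, H0, H1, hAH⟩ := mpd_decomposableMetric Φ Λ x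
  have hP : ∀ c i j, pd c (fun y => G y i j) x
      = !![A c, 0, 0, 0; 0, 0, 0, 0; 0, 0, H c, 0; 0, 0, 0, H c] i j := fun c i j => by
    rw [← hAH]; exact pd_congr c hV (fun y hy => by rw [hG y hy]) hxV
  simp only [covDeriv, christoffel, hP, pd_const, hG x hxV, decomposableMetric_inv hx]
  fin_cases b <;>
    simp [electricField, Fin.sum_univ_four, A0, A2, A3, H0, H1]

/-- In the trace over the second plane the components of `F` that mix the planes cancel, leaving a
sum of squares. This positivity determines the sign of `Φ`. -/
theorem emStress_two_add_three (hG : G x = decomposableMetric Φ Λ x)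
    (hx : 0 < 1 + (Φ + Λ / 2) * (x 2 ^ 2 + x 3 ^ 2)) {F : R4 → Matrix (Fin 4) (Fin 4) ℝ}
    (hF : ∀ a b, F x a b = - F x b a) :
    emStress G F x 2 2 + emStress G F x 3 3
      = confFactor Φ Λ x * (F x 0 1 ^ 2 + (F x 2 3 * (confFactor Φ Λ x)⁻¹) ^ 2) := by
  have d : ∀ a, F x a a = 0 := fun a => self_eq_neg.1 (hF a a)
  have h0 := (confFactor_pos hx).ne'
  simp only [emStress, fieldInvariant, hG, decomposableMetric_inv hx, Matrix.of_apply]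
  rw [decomposableMetric_eq]
  simp [Fin.sum_univ_four, d, hF 1 0, hF 2 0, hF 2 1, hF 3 0, hF 3 1, hF 3 2]
  field_simp
  ring

/-- The metric `decomposableMetric Φ Λ` is generated by a non-null electromagnetic field if and
only if `0 < Φ`. -/
theorem exists_emSource_iff (hV : IsOpen V) (hne : V.Nonempty)
    (hpos : ∀ x ∈ V, 0 < 1 + (Φ + Λ / 2) * (x 2 ^ 2 + x 3 ^ 2))
    (hG : ∀ x ∈ V, G x = decomposableMetric Φ Λ x)
    (hR : ∀ x ∈ V, ricci G x = decomposableMetric Φ Λ x * eigDiag (Λ - 2 * Φ) (Λ + 2 * Φ))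
    (hS : ∀ x ∈ V, scalarCurv G x = 4 * Λ) (hΦ : Φ ≠ 0) :
    (∃ F, IsNonNullEMSource G V Λ F) ↔ 0 < Φ := by
  constructor
  · rintro ⟨F, hF⟩
    obtain ⟨x, hx⟩ := hne
    -- The same trace of the left side is `4 Φ` times the positive conformal factor.
    have h1 := congrArg (fun M : Matrix (Fin 4) (Fin 4) ℝ => M 2 2 + M 3 3) (hF.einstein x hx)
    have h2 := emStress_two_add_three (hG x hx) (hpos x hx) (hF.antisymm x hx)
    have h3 := confFactor_pos (hpos x hx)
    simp only [hS x hx, hR x hx, hG x hx, Matrix.add_apply, Matrix.sub_apply, Matrix.smul_apply,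
      smul_eq_mul, eigDiag, Matrix.mul_diagonal] at h1
    rw [← mul_add, h2, decomposableMetric_eq] at h1
    simp at h1
    have h4 : 0 ≤ confFactor Φ Λ x * Φ := by
      have : 0 ≤ 8 * Real.pi * (confFactor Φ Λ x *
          (F x 0 1 ^ 2 + (F x 2 3 * (confFactor Φ Λ x)⁻¹) ^ 2)) := by positivity
      linarith
    exact lt_of_le_of_ne (nonneg_of_mul_nonneg_right h4 h3) hΦ.symm
  · intro hΦ0
    -- Fixed by `8 π E² / 2 = 2 Φ`, which matches the stress tensor to the left side of Einstein's
    -- equations.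
    set E : ℝ := √(Φ / (2 * Real.pi)) with hE
    have hE2 : 8 * Real.pi * (E ^ 2 / 2) = 2 * Φ := by
      rw [hE, Real.sq_sqrt (by positivity)]
      field_simp
      ring
    have hE0 : E ≠ 0 := by
      rintro h0; rw [h0] at hE2; exact hΦ (by linarith)
    refine ⟨fun _ => electricField E, fun a b => contDiffOn_const, fun x _ a b => ?_,
      fun x _ a b c => by simp only [pd_const, add_zero], fun x hx b =>
        coclosed_electricField hV hG hx (hpos x hx) E b, fun x hx h0 => ?_, fun x hx => ?_⟩
    · fin_cases a <;> fin_cases b <;> simp [electricField]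
    · have := h0.1
      rw [fieldInvariant_electricField (hG x hx) (hpos x hx)] at this
      exact hE0 (by simpa using this)
    · rw [emStress_electricField (hG x hx) (hpos x hx), hS x hx, hR x hx, hG x hx, smul_smul, hE2]
      ext i j
      simp only [Matrix.add_apply, Matrix.sub_apply, Matrix.smul_apply, smul_eq_mul, eigDiag,
        Matrix.mul_diagonal]
      fin_cases j <;> simp <;> ring

end Electromagnetic

/-! ### Change of charts -/

section Jacobian

variable {φ : R4 → R4} {x : R4}

theorem fderiv_apply_eq_jacobian (hφ : ∀ a, DifferentiableAt ℝ (fun y => φ y a) x) (v : R4)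
    (a : Fin 4) : fderiv ℝ φ x v a = ∑ i, jacobian φ x a i * v i := by
  have hφ' : DifferentiableAt ℝ φ x := differentiableAt_euclidean.2 hφ
  have h1 : HasFDerivAt (fun y => φ y a)
      ((EuclideanSpace.proj a : R4 →L[ℝ] ℝ).comp (fderiv ℝ φ x)) x :=
    (EuclideanSpace.proj a : R4 →L[ℝ] ℝ).hasFDerivAt.comp x hφ'.hasFDerivAt
  have h2 : fderiv ℝ φ x v a = fderiv ℝ (fun y => φ y a) x v := by rw [h1.fderiv]; rfl
  rw [h2, fderiv_eq_sum_pd]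
  exact Finset.sum_congr rfl fun i _ => mul_comm _ _

theorem fderiv_single_eq_sum (hφ : ∀ a, DifferentiableAt ℝ (fun y => φ y a) x) (i : Fin 4) :
    fderiv ℝ φ x (EuclideanSpace.single i 1)
      = ∑ a, jacobian φ x a i • (EuclideanSpace.single a 1 : R4) := by
  ext a
  rw [fderiv_apply_eq_jacobian hφ]
  simp [Pi.single_apply]

theorem exists_fderiv_equiv (hφ : ∀ a, DifferentiableAt ℝ (fun y => φ y a) x)
    (hJ : (jacobian φ x).det ≠ 0) :
    ∃ L : R4 ≃L[ℝ] R4, HasFDerivAt φ (L : R4 →L[ℝ] R4) x := by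
  have hinj : Function.Injective (fderiv ℝ φ x).toLinearMap := by
    rw [← LinearMap.ker_eq_bot, LinearMap.ker_eq_bot']
    intro v hv
    have h0 : (jacobian φ x).mulVec (fun i => v i) = 0 := by
      ext a
      have := fderiv_apply_eq_jacobian hφ v a
      rw [show fderiv ℝ φ x v = 0 from hv] at this
      exact this.symm
    ext i
    exact congrFun (Matrix.eq_zero_of_mulVec_eq_zero hJ h0) i
  refine ⟨(LinearEquiv.ofInjectiveEndo _ hinj).toContinuousLinearEquiv,
    (differentiableAt_euclidean.2 hφ).hasFDerivAt.congr_fderiv ?_⟩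
  exact ContinuousLinearMap.ext fun v => rfl

/-- The inverse function theorem on a ball. -/
theorem exists_local_diffeo {r : ℝ} (hr : 0 < r)
    (hφ : ∀ a, ContDiffOn ℝ ∞ (fun y => φ y a) (Metric.ball x r))
    (hJ : ∀ y ∈ Metric.ball x r, (jacobian φ y).det ≠ 0) :
    ∃ f : OpenPartialHomeomorph R4 R4, (f : R4 → R4) = φ ∧ x ∈ f.source ∧
      f.source ⊆ Metric.ball x r ∧ ContDiffOn ℝ ∞ f f.source ∧ ContDiffOn ℝ ∞ f.symm f.target := by
  have hφ' : ContDiffOn ℝ ∞ φ (Metric.ball x r) := contDiffOn_euclidean.2 hφ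
  have hd : ∀ y ∈ Metric.ball x r, ∀ a, DifferentiableAt ℝ (fun y => φ y a) y := fun y hy a =>
    (hφ a).differentiableAt_of_isOpen Metric.isOpen_ball hy
  have hat : ∀ y ∈ Metric.ball x r, ContDiffAt ℝ ∞ φ y := fun y hy =>
    hφ'.contDiffAt (Metric.isOpen_ball.mem_nhds hy)
  have hx := Metric.mem_ball_self (x := x) hr
  obtain ⟨L, hL⟩ := exists_fderiv_equiv (hd x hx) (hJ x hx)
  have hn : (∞ : WithTop ℕ∞) ≠ 0 := by simp
  set f₀ := (hat x hx).toOpenPartialHomeomorph φ hL hn with hf₀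
  have hs : (f₀.restrOpen (Metric.ball x r) Metric.isOpen_ball).source
      = f₀.source ∩ Metric.ball x r := rfl
  refine ⟨f₀.restrOpen (Metric.ball x r) Metric.isOpen_ball, rfl, ?_, ?_, ?_, ?_⟩
  · rw [hs]; exact ⟨(hat x hx).mem_toOpenPartialHomeomorph_source hL hn, hx⟩
  · rw [hs]; exact Set.inter_subset_right
  · exact hφ'.mono (by rw [hs]; exact Set.inter_subset_right)
  -- The Jacobian is invertible on the whole ball, so the inverse is smooth at every point of the
  -- target and not only at the image of the centre.
  · intro y hy
    have hm := (f₀.restrOpen (Metric.ball x r) Metric.isOpen_ball).map_target hy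
    rw [hs] at hm
    obtain ⟨L', hL'⟩ := exists_fderiv_equiv (hd _ hm.2) (hJ _ hm.2)
    exact ((f₀.restrOpen (Metric.ball x r) Metric.isOpen_ball).contDiffAt_symm hy hL'
      (hat _ hm.2)).contDiffWithinAt

end Jacobian

/-! ### Metric components and eigenvalues under change of chart. -/

section Charts

variable {M : Type*} [TopologicalSpace M] [ChartedSpace R4 M] {e e' : OpenPartialHomeomorph M R4}

/-- The derivative of the inverse of a chart, as a linear map of `ℝ⁴`. -/
def chartDeriv (e : OpenPartialHomeomorph M R4) (x : R4) : R4 →L[ℝ] R4 :=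
  mfderiv (𝓡 4) (𝓡 4) e.symm x

/-- The metric at a point, as a bilinear form on `ℝ⁴`. -/
def LorentzMetric.bilin (g : LorentzMetric M) (p : M) : LinearMap.BilinForm ℝ R4 := g.form p

theorem LorentzMetric.comp_eq_bilin (g : LorentzMetric M) (x : R4) (i j : Fin 4) :
    g.comp e x i j = g.bilin (e.symm x) (chartDeriv e x (EuclideanSpace.single i 1))
      (chartDeriv e x (EuclideanSpace.single j 1)) := rfl

/-- The chain rule for `e'.symm = e.symm ∘ ψ`. -/
theorem chartDeriv_eq (he : e ∈ IsManifold.maximalAtlas (𝓡 4) ∞ M) {V : Set R4} (hV : IsOpen V)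
    {ψ : R4 → R4} (hψ : ∀ a, ContDiffOn ℝ ∞ (fun y => ψ y a) V)
    (hm : Set.MapsTo ψ V e.target) (heq : ∀ y ∈ V, e.symm (ψ y) = e'.symm y) {y : R4}
    (hy : y ∈ V) : chartDeriv e' y = (chartDeriv e (ψ y)).comp (fderiv ℝ ψ y) := by
  have hψd : DifferentiableAt ℝ ψ y :=
    differentiableAt_euclidean.2 fun a => (hψ a).differentiableAt_of_isOpen hV hy
  have h1 : MDifferentiableAt (𝓡 4) (𝓡 4) e.symm (ψ y) :=
    (contMDiffAt_symm_of_mem_maximalAtlas he (hm hy)).mdifferentiableAt (by simp)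
  have h2 : MDifferentiableAt (𝓡 4) (𝓡 4) ψ y := hψd.mdifferentiableAt
  have h3 : (e'.symm : R4 → M) =ᶠ[nhds y] e.symm ∘ ψ :=
    Filter.eventuallyEq_of_mem (hV.mem_nhds hy) fun z hz => (heq z hz).symm
  have h4 : mfderiv (𝓡 4) (𝓡 4) (e.symm ∘ ψ) y = chartDeriv e' y :=
    h3.symm.mfderiv_eq
  rw [← h4, mfderiv_comp y h1 h2, mfderiv_eq_fderiv]
  rfl

/-- The transformation law of the metric components. -/
theorem LorentzMetric.comp_change (g : LorentzMetric M)
    (he : e ∈ IsManifold.maximalAtlas (𝓡 4) ∞ M) {V : Set R4} (hV : IsOpen V)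
    {ψ : R4 → R4} (hψ : ∀ a, ContDiffOn ℝ ∞ (fun y => ψ y a) V)
    (hm : Set.MapsTo ψ V e.target) (heq : ∀ y ∈ V, e.symm (ψ y) = e'.symm y) {y : R4}
    (hy : y ∈ V) :
    g.comp e' y = (jacobian ψ y).transpose * g.comp e (ψ y) * jacobian ψ y := by
  have hd : ∀ a, DifferentiableAt ℝ (fun y => ψ y a) y := fun a =>
    (hψ a).differentiableAt_of_isOpen hV hy
  ext i j
  rw [g.comp_eq_bilin, chartDeriv_eq he hV hψ hm heq hy, ← heq y hy,
    ContinuousLinearMap.comp_apply, ContinuousLinearMap.comp_apply, fderiv_single_eq_sum hd,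
    fderiv_single_eq_sum hd]
  simp only [Matrix.mul_apply, Matrix.transpose_apply, g.comp_eq_bilin, map_sum, map_smul,
    LinearMap.sum_apply, LinearMap.smul_apply, smul_eq_mul, Finset.sum_mul, Finset.mul_sum]
  refine Finset.sum_congr rfl fun a _ => Finset.sum_congr rfl fun b _ => ?_
  ring

theorem LorentzMetric.isCodazziPair (g : LorentzMetric M) (hYang : IsYangPureSpace g)
    (hSegre : HasSegreType_11_11 g) (he : e ∈ IsManifold.maximalAtlas (𝓡 4) ∞ M) :
    IsCodazziPair (g.comp e) e.target where
  isOpen := e.open_target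
  smooth := g.smooth e he
  symm x _ := by ext i j; exact g.symm _ _ _
  -- Nondegeneracy in coordinates follows from the existence of a pseudo-orthonormal tetrad of
  -- coordinate vectors.
  det x hx h0 := by
    obtain ⟨t, ρ₁, ρ₂, -, ht⟩ := hSegre e he x hx
    have h1 := congrArg Matrix.det ht.isEigenTetrad.mul_inv
    rw [Matrix.det_mul, h0, zero_mul, Matrix.det_one] at h1
    exact zero_ne_one h1
  codazzi x hx a b c := by
    rw [← covDeriv_eq_covM, ← covDeriv_eq_covM]
    exact sub_eq_zero.1 (hYang e he x hx a b c)
  tetrad x hx := by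
    obtain ⟨t, ρ₁, ρ₂, hne, ht⟩ := hSegre e he x hx
    exact ⟨_, ρ₁, ρ₂, hne, ht.isEigenTetrad⟩

/-- Eigenvalues in one chart are eigenvalues in every other chart. -/
theorem LorentzMetric.exists_eigenTetrad_change (g : LorentzMetric M) (hYang : IsYangPureSpace g)
    (hSegre : HasSegreType_11_11 g) (he : e ∈ IsManifold.maximalAtlas (𝓡 4) ∞ M)
    (he' : e' ∈ IsManifold.maximalAtlas (𝓡 4) ∞ M) {p : M} (hp : p ∈ e.source)
    (hp' : p ∈ e'.source) {E : Matrix (Fin 4) (Fin 4) ℝ} {ρ₁ ρ₂ : ℝ}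
    (hE : IsEigenTetrad (g.comp e (e p)) (ricci (g.comp e) (e p)) E ρ₁ ρ₂) :
    ∃ E', IsEigenTetrad (g.comp e' (e' p)) (ricci (g.comp e') (e' p)) E' ρ₁ ρ₂ := by
  set V := (e'.symm.trans e).source with hVdef
  have hV : IsOpen V := (e'.symm.trans e).open_source
  have hVt : V ⊆ e'.target := fun y hy => (by simpa [hVdef] using hy : _ ∧ _).1
  have hVs : ∀ y ∈ V, e'.symm y ∈ e.source := fun y hy =>
    (by simpa [hVdef] using hy : _ ∧ _).2
  have hψ' : ContDiffOn ℝ ∞ (fun y => e (e'.symm y)) V :=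
    ((contMDiffOn_of_mem_maximalAtlas he).comp
      ((contMDiffOn_symm_of_mem_maximalAtlas he').mono hVt) hVs).contDiffOn
  have hψ := contDiffOn_euclidean.1 hψ'
  have hm : Set.MapsTo (fun y => e (e'.symm y)) V e.target := fun y hy => e.map_source (hVs y hy)
  have heq : ∀ y ∈ V, e.symm (e (e'.symm y)) = e'.symm y := fun y hy => e.left_inv (hVs y hy)
  have hpV : e' p ∈ V := by simp [hVdef, hp', hp]
  have hG := fun y (hy : y ∈ V) => g.comp_change he hV hψ hm heq hy
  have hM := (g.isCodazziPair hYang hSegre he).toMetricOn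
  have hM' := (g.isCodazziPair hYang hSegre he').toMetricOn
  have hR := hM.ricci_pullback (hM'.mono hV hVt) hψ hm hG hpV
  have hJ : (jacobian (fun y => e (e'.symm y)) (e' p)).det ≠ 0 := fun h0 =>
    hM'.det _ (hVt hpV) (by rw [hG _ hpV, Matrix.det_mul, h0, mul_zero])
  have hep : e (e'.symm (e' p)) = e p := by rw [e'.left_inv hp']
  rw [hG _ hpV, hR, hep]
  exact ⟨_, hE.pullback hJ⟩

end Charts

/-! ### Global constancy of the eigenvalues and adapted charts -/

section Global

variable {M : Type*} [TopologicalSpace M] [ChartedSpace R4 M]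

theorem eq_of_transpose_mul_mul_eq {J A B : Matrix (Fin 4) (Fin 4) ℝ} (hJ : J.det ≠ 0)
    (h : J.transpose * A * J = J.transpose * B * J) : A = B := by
  have h1 : J * J⁻¹ = 1 := Matrix.mul_nonsing_inv _ (isUnit_iff_ne_zero.2 hJ)
  have h2 : (J⁻¹).transpose * J.transpose = 1 := by
    rw [← Matrix.transpose_mul, h1, Matrix.transpose_one]
  have key : ∀ S, (J⁻¹).transpose * (J.transpose * S * J) * J⁻¹ = S := fun S => by
    calc _ = ((J⁻¹).transpose * J.transpose) * S * (J * J⁻¹) := by simp only [mul_assoc]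
      _ = S := by rw [h1, h2, one_mul, mul_one]
  rw [← key A, h, key B]

/-- A chart in which the metric is `decomposableMetric Φ Λ`. -/
theorem LorentzMetric.exists_adapted_chart [IsManifold (𝓡 4) ∞ M] (g : LorentzMetric M)
    (hYang : IsYangPureSpace g) (hSegre : HasSegreType_11_11 g)
    {e : OpenPartialHomeomorph M R4} (he : e ∈ IsManifold.maximalAtlas (𝓡 4) ∞ M) {p : M}
    (hp : p ∈ e.source) {Φ Λ : ℝ} (hΦ : Φ ≠ 0) {E : Matrix (Fin 4) (Fin 4) ℝ}
    (hE : IsEigenTetrad (g.comp e (e p)) (ricci (g.comp e) (e p)) E (Λ - 2 * Φ) (Λ + 2 * Φ)) :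
    ∃ e' ∈ IsManifold.maximalAtlas (𝓡 4) ∞ M, p ∈ e'.source ∧ ∀ y ∈ e'.target,
      0 < 1 + (Φ + Λ / 2) * (y 2 ^ 2 + y 3 ^ 2) ∧ g.comp e' y = decomposableMetric Φ Λ y ∧
      ricci (g.comp e') y = decomposableMetric Φ Λ y * eigDiag (Λ - 2 * Φ) (Λ + 2 * Φ) := by
  have hC := g.isCodazziPair hYang hSegre he
  obtain ⟨r, hr, hrU, φ, hφ, hx⟩ := hC.exists_coords (e.map_source hp) hΦ hE
  have hJ : ∀ x ∈ Metric.ball (e p) r, (jacobian φ x).det ≠ 0 := fun x hxr h0 =>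
    hC.det x (hrU hxr) (by rw [(hx x hxr).2.1, Matrix.det_mul, h0, mul_zero])
  obtain ⟨f, hf, hpf, hfr, hfs, hfs'⟩ := exists_local_diffeo hr hφ hJ
  have he' : e.trans f ∈ IsManifold.maximalAtlas (𝓡 4) ∞ M := by
    refine OpenPartialHomeomorph.mem_maximalAtlas_of_contMDiffOn _ ?_ ?_
    · refine hfs.contMDiffOn.comp ((contMDiffOn_of_mem_maximalAtlas he).mono ?_) ?_
      · intro q hq; exact hq.1
      · intro q hq; exact hq.2
    · refine (contMDiffOn_symm_of_mem_maximalAtlas he).comp (hfs'.contMDiffOn.mono ?_) ?_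
      · intro q hq; exact hq.1
      · intro q hq; exact hq.2
  have hV : f.source ⊆ e.target := hfr.trans hrU
  have hφV : ∀ a, ContDiffOn ℝ ∞ (fun y => φ y a) f.source := fun a => (hφ a).mono hfr
  have hm : Set.MapsTo φ f.source (e.trans f).target := fun x hxf => by
    refine ⟨?_, ?_⟩
    · rw [← hf]; exact f.map_source hxf
    · rw [← hf]
      show f.symm (f x) ∈ e.target
      rw [f.left_inv hxf]; exact hV hxf
  have heq : ∀ x ∈ f.source, (e.trans f).symm (φ x) = e.symm x := fun x hxf => by
    show e.symm (f.symm (φ x)) = e.symm x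
    rw [← hf, f.left_inv hxf]
  -- The transition is used from the old chart to the new one, along `φ`. Both the metric in the new
  -- chart and `decomposableMetric` pull back along `φ` to the metric in the old chart, and the
  -- invertible Jacobian cancels; the Ricci tensor is handled in the same way.
  have hG := fun x (hxf : x ∈ f.source) => g.comp_change he' f.open_source hφV hm heq hxf
  have hM' := (g.isCodazziPair hYang hSegre he').toMetricOn
  have hM := hC.toMetricOn.mono f.open_source hV
  refine ⟨e.trans f, he', ⟨hp, hpf⟩, fun y hy => ?_⟩
  obtain ⟨x, hxf, rfl⟩ : ∃ x ∈ f.source, φ x = y :=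
    ⟨f.symm y, f.map_target hy.1, by rw [← hf]; exact f.right_inv hy.1⟩
  obtain ⟨h1, h2, h3⟩ := hx x (hfr hxf)
  have hJx := hJ x (hfr hxf)
  refine ⟨h1, eq_of_transpose_mul_mul_eq hJx ?_, eq_of_transpose_mul_mul_eq hJx ?_⟩
  · rw [← hG x hxf, h2]
  · rw [← hM'.ricci_pullback hM hφV hm hG hxf, h3]

/-- The eigenvalues of the Ricci tensor are constant. -/
theorem LorentzMetric.exists_eigenvalues [IsManifold (𝓡 4) ∞ M] [ConnectedSpace M]
    (g : LorentzMetric M) (hYang : IsYangPureSpace g) (hSegre : HasSegreType_11_11 g) :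
    ∃ ρ₁ ρ₂ : ℝ, ρ₁ ≠ ρ₂ ∧ ∀ e ∈ IsManifold.maximalAtlas (𝓡 4) ∞ M, ∀ p ∈ e.source,
      ∃ E, IsEigenTetrad (g.comp e (e p)) (ricci (g.comp e) (e p)) E ρ₁ ρ₂ := by
  have hat := fun p : M => IsManifold.chart_mem_maximalAtlas (I := 𝓡 4) (n := ∞) p
  have hsrc := fun p : M => mem_chart_source R4 p
  have hex : ∀ p : M, ∃ ρ : ℝ × ℝ, ρ.1 ≠ ρ.2 ∧ ∃ E, IsEigenTetrad (g.comp (chartAt R4 p)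
      (chartAt R4 p p)) (ricci (g.comp (chartAt R4 p)) (chartAt R4 p p)) E ρ.1 ρ.2 := fun p => by
    obtain ⟨E, ρ₁, ρ₂, hne, hE⟩ := (g.isCodazziPair hYang hSegre (hat p)).tetrad _
      ((chartAt R4 p).map_source (hsrc p))
    exact ⟨(ρ₁, ρ₂), hne, E, hE⟩
  choose ρ hρ E hE using hex
  have hloc : IsLocallyConstant ρ := by
    refine (IsLocallyConstant.iff_eventually_eq ρ).2 fun p => ?_
    -- Near `p` the eigenvalues at `p` persist, in the chart at `p`. Comparison with the chart at
    -- `q` uses invariance under change of chart and uniqueness.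
    obtain ⟨ε, hε, hεU, E', -, hE'⟩ := (g.isCodazziPair hYang hSegre (hat p)).exists_frame
      ((chartAt R4 p).map_source (hsrc p)) (hρ p) (hE p)
    have h1 : ∀ᶠ q in nhds p, chartAt R4 p q ∈ Metric.ball (chartAt R4 p p) ε :=
      ((chartAt R4 p).continuousAt (hsrc p)).eventually (Metric.ball_mem_nhds _ hε)
    filter_upwards [h1, (chartAt R4 p).open_source.mem_nhds (hsrc p)] with q hq hqs
    obtain ⟨E'', hE''⟩ := g.exists_eigenTetrad_change hYang hSegre (hat p) (hat q) hqs (hsrc q)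
      (hE' _ hq)
    have := hE''.unique (hρ p) (hE q)
    exact Prod.ext this.1 this.2
  obtain ⟨p₀⟩ := (inferInstance : Nonempty M)
  refine ⟨(ρ p₀).1, (ρ p₀).2, hρ p₀, fun e he p hp => ?_⟩
  rw [hloc.apply_eq_of_preconnectedSpace p₀ p]
  exact g.exists_eigenTetrad_change hYang hSegre (hat p) he (hsrc p) hp (hE p)

end Global

end

/-! ### The main theorem. -/

theorem mainTheorem5 {M : Type*} [TopologicalSpace M] [ChartedSpace R4 M]
    [IsManifold (𝓡 4) ∞ M] [ConnectedSpace M] (g : LorentzMetric M)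
    (hYang : IsYangPureSpace g) (hSegre : HasSegreType_11_11 g) :
    ∃ Λ Φ : ℝ, Φ ≠ 0 ∧
      (∀ e ∈ IsManifold.maximalAtlas (𝓡 4) ∞ M, ∀ x ∈ e.target,
        scalarCurv (g.comp e) x = 4 * Λ ∧
        ∀ (t : Fin 4 → Fin 4 → ℝ) (ρ₁ ρ₂ : ℝ), IsRicciTetrad (g.comp e) x t ρ₁ ρ₂ →
          npPhi11 (g.comp e) x t = Φ) ∧
      ∀ p : M, ∃ e ∈ IsManifold.maximalAtlas (𝓡 4) ∞ M, p ∈ e.source ∧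
        (∀ x ∈ e.target, 0 < 1 + (Φ + Λ / 2) * (x 2 ^ 2 + x 3 ^ 2) ∧
          g.comp e x = decomposableMetric Φ Λ x) ∧
        ((∃ F : R4 → Matrix (Fin 4) (Fin 4) ℝ,
          IsNonNullEMSource (g.comp e) e.target Λ F) ↔ 0 < Φ) := by
  obtain ⟨ρ₁, ρ₂, hne, hE⟩ := g.exists_eigenvalues hYang hSegre
  -- Dictated by `R = 2 (ρ₁ + ρ₂)` and by `IsRicciTetrad.npPhi11_eq`.
  obtain ⟨Λ, hΛ⟩ : ∃ Λ, Λ = (ρ₁ + ρ₂) / 2 := ⟨_, rfl⟩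
  obtain ⟨Φ, hΦ⟩ : ∃ Φ, Φ = (ρ₂ - ρ₁) / 4 := ⟨_, rfl⟩
  have hΦ0 : Φ ≠ 0 := fun h0 => hne (by linarith)
  have h1 : ρ₁ = Λ - 2 * Φ := by rw [hΛ, hΦ]; ring
  have h2 : ρ₂ = Λ + 2 * Φ := by rw [hΛ, hΦ]; ring
  have hE' : ∀ e ∈ IsManifold.maximalAtlas (𝓡 4) ∞ M, ∀ x ∈ e.target,
      ∃ E, IsEigenTetrad (g.comp e x) (ricci (g.comp e) x) E ρ₁ ρ₂ := fun e he x hx => by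
    have := hE e he (e.symm x) (e.map_target hx)
    rwa [e.right_inv hx] at this
  have hS : ∀ e ∈ IsManifold.maximalAtlas (𝓡 4) ∞ M, ∀ x ∈ e.target,
      scalarCurv (g.comp e) x = 4 * Λ := fun e he x hx => by
    obtain ⟨E, hEx⟩ := hE' e he x hx
    rw [(g.isCodazziPair hYang hSegre he).toMetricOn.scalarCurv_eq_trace hx, hEx.trace_eq, hΛ]
    ring
  refine ⟨Λ, Φ, hΦ0, fun e he x hx => ⟨hS e he x hx, fun t σ₁ σ₂ ht => ?_⟩, fun p => ?_⟩
  · obtain ⟨E, hEx⟩ := hE' e he x hx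
    -- An arbitrary tetrad has the same ordered eigenvalues, so its component is the same constant.
    obtain ⟨rfl, rfl⟩ := hEx.unique hne ht.isEigenTetrad
    rw [ht.npPhi11_eq, hΦ]
  · have hat := IsManifold.chart_mem_maximalAtlas (I := 𝓡 4) (n := ∞) p
    obtain ⟨E, hEp⟩ := hE _ hat p (mem_chart_source R4 p)
    rw [h1, h2] at hEp
    obtain ⟨e, he, hp, h⟩ := g.exists_adapted_chart hYang hSegre hat (mem_chart_source R4 p)
      hΦ0 hEp
    exact ⟨e, he, hp, fun x hx => ⟨(h x hx).1, (h x hx).2.1⟩,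
      exists_emSource_iff e.open_target ⟨_, e.map_source hp⟩ (fun x hx => (h x hx).1)
        (fun x hx => (h x hx).2.1) (fun x hx => (h x hx).2.2) (hS e he) hΦ0⟩
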